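/- **Conventions.** Manifolds are smooth, finite-dimensional, Hausdorff, second countable and without boundary. A *singular semi-Riemannian manifold* $(M,g)$ is a manifold $M$ with a smooth symmetric bilinear form $g=\langle\cdot,\cdot\rangle$ on $TM$, which may be degenerate and of variable signature. For vector fields $X,Y,Z,P\in\Gamma(TM)$ put $$\mathcal K(X,Y,Z)=\tfrac12\{X\langle Y,Z\rangle+Y\langle Z,X\rangle-Z\langle X,Y\rangle-\langle X,[Y,Z]\rangle+\langle Y,[Z,X]\rangle+\langle Z,[X,Y]\rangle\},$$ $$\overline{\mathcal K}(X,Y,Z)=\overline{\mathcal K}_P(X,Y,Z)=\mathcal K(X,Y,Z)+g(Y,P)g(X,Z)-g(X,Y)g(P,Z),$$ $\nabla^\flat_XY=\mathcal K(X,Y,\cdot)$ and $\overline\nabla^\flat_XY=\overline{\mathcal K}(X,Y,\cdot)$. Let $\mathcal A^\bullet(M)$ be the set of smooth one-forms $\omega$ such that for every $p\in M$ there is $u\in T_pM$ with $\omega_p=g_p(u,\cdot)$; if moreover $\tau_p=g_p(v,\cdot)$, put $g_\bullet(\omega_p,\tau_p)=g_p(u,v)$. For $\omega,\tau\in\mathcal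 A^\bullet(M)$, the function $\langle\langle\omega,\tau\rangle\rangle_\bullet$ equals $g_\bullet(\omega_p,\tau_p)$ on the (open dense) set of points near which the signature of $g$ is constant, and is extended from there by continuity to the remaining points, wherever this is possible. Put $$(\nabla_X\omega)(Y)=X(\omega(Y))-\langle\langle\nabla^\flat_XY,\omega\rangle\rangle_\bullet,\qquad (\overline\nabla_X\omega)(Y)=X(\omega(Y))-\langle\langle\overline\nabla^\flat_XY,\omega\rangle\rangle_\bullet .$$ $(M,g)$ is *semi-regular* if $\nabla^\flat_XY\in\mathcal A^\bullet(M)$ and $\nabla_Z(\nabla^\flat_XY)\in\mathcal A^\bullet(M)$ for all $X,Y,Z\in\Gamma(TM)$. In that case let $$R(X,Y,Z,T)=(\nabla_X\nabla^\flat_YZ)(T)-(\nabla_Y\nabla^\flat_XZ)(T)-(\nabla^\flat_{[X,Y]}Z)(T),$$ $$\overline R(X,Y,Z,T)=(\overline\nabla_X\overline\nabla^\flat_YZ)(T)-(\overline\nabla_Y\overline\nabla^\flat_XZ)(T)-(\overline\nabla^\flat_{[X,Y]}Z)(T).$$ The Hessian of $f$ is $H^f(X,Y)=(\nabla_X df)(Y)$.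 The warped product $B\times_fF$ of $(B,g_B)$ and $(F,g_F)$ with $f\in C^\infty(B)$ (zeros of $f$ are allowed) is $B\times F$ with the metric $\pi_B^*g_B+(f\circ\pi_B)^2\pi_F^*g_F$. Vector fields on $B$ and $F$ are identified with their lifts to $B\times F$. **Theorem 2.17.** Let $(B,g_B)$ be a singular semi-Riemannian manifold with $g_B$ non-degenerate, $(F,g_F)$ a semi-regular manifold, and $f\in C^\infty(B)$. Then $B\times_fF$ is semi-regular. Let $P,X,Y,Z,T\in\Gamma(TB)$ and $U,V,W,Q\in\Gamma(TF)$. Let $\overline R$ be the curvature of $B\times_fF$ formed with the lift of $P$, $\overline R_B$ that of $(B,g_B)$ formed with $P$, $R_F$ the curvature $R$ of $(F,g_F)$, $\mathcal K_B$ the form $\mathcal K$ and $H^f$ the Hessian of $f$ on $(B,g_B)$, and $g_B^*$ the inner product on $T^*B$ dual to $g_B$. Then, at every point of $B\times F$: 1. $\overline R(X,Y,Z,T)=\overline R_B(X,Y,Z,T)$. 2. $\overline R(X,Y,Z,Q)=\overline R(Z,Q,X,Y)=0$. 3. $\overline R(X,Y,W,Q)=\overline R(W,Q,X,Y)=0$.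 4. $\overline R(X,V,W,T)=-fH^f(X,T)g_F(V,W)+f^2g_B(X,P)g_F(V,W)g_B(P,T)-fP(f)g_F(V,W)g_B(X,T)-f^2g_B(P,P)g_F(V,W)g_B(X,T)-f^2g_F(V,W)\mathcal K_B(X,P,T)$. 5. $\overline R(U,V,Z,Q)=\overline R(Z,Q,U,V)=0$. 6. $\overline R(U,V,W,Q)=f^2R_F(U,V,W,Q)+\bigl[f^2g_B^*(df,df)+2f^3P(f)+f^4g_B(P,P)\bigr]\bigl[g_F(U,W)g_F(V,Q)-g_F(V,W)g_F(U,Q)\bigr]$. -/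

import Mathlib

open scoped Manifold ContDiff Topology

noncomputable section

namespace SingularGeometry

section Basic

variable {E : Type*} [NormedAddCommGroup E] [NormedSpace ℝ E]
  {H : Type*} [TopologicalSpace H]

/-- Not necessarily smooth vector fields on `M`. -/
abbrev VField (I : ModelWithCorners ℝ E H) (M : Type*) [TopologicalSpace M] [ChartedSpace H M] :=
  (p : M) → TangentSpace I p

/-- Fields of bilinear forms on the tangent spaces of `M`, without smoothness or symmetry. -/
abbrev BilinField (I : ModelWithCorners ℝ E H) (M : Type*) [TopologicalSpace M]
    [ChartedSpace H M] :=
  (p : M) → TangentSpace I p →L[ℝ] TangentSpace I p →L[ℝ] ℝ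

/-- Operations from vector fields to functions; the differential one-forms are those that
satisfy `IsOneForm`. -/
abbrev FieldFunctional (I : ModelWithCorners ℝ E H) (M : Type*) [TopologicalSpace M]
    [ChartedSpace H M] :=
  VField I M → M → ℝ

variable {I : ModelWithCorners ℝ E H} {M : Type*} [TopologicalSpace M] [ChartedSpace H M]

/-- `X ∈ Γ(TM)`. -/
def IsSmoothField [IsManifold I ∞ M] (X : VField I M) : Prop :=
  ContMDiff I I.tangent ∞ (fun p => (⟨p, X p⟩ : TangentBundle I M))

/-- `φ ∈ C^∞(M)`. -/
def IsSmoothFun (I : ModelWithCorners ℝ E H) (φ : M → ℝ) : Prop :=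
  ContMDiff I 𝓘(ℝ, ℝ) ∞ φ

/-- `g` is a smooth symmetric bilinear form on `M`, so that `(M, g)` is a singular
semi-Riemannian manifold; no condition is put on the rank or the signature of `g`. -/
structure IsSingularMetric [IsManifold I ∞ M] (g : BilinField I M) : Prop where
  symm : ∀ (p : M) (u v : TangentSpace I p), g p u v = g p v u
  smooth : ContMDiff I (I.prod 𝓘(ℝ, E →L[ℝ] E →L[ℝ] ℝ)) ∞
    (fun p => Bundle.TotalSpace.mk' (E →L[ℝ] E →L[ℝ] ℝ)
      (E := fun p : M => TangentSpace I p →L[ℝ] TangentSpace I p →L[ℝ] ℝ) p (g p))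

/-- All the bilinear forms `g_p` are non-degenerate. -/
def IsNondegenerate (g : BilinField I M) : Prop :=
  ∀ (p : M) (u : TangentSpace I p), (∀ v : TangentSpace I p, g p u v = 0) → u = 0

/-- The function `g(X, Y)`. -/
def pairing (g : BilinField I M) (X Y : VField I M) : M → ℝ := fun p => g p (X p) (Y p)

/-- The derivative `X(φ)` of a function along a vector field. -/
def dirDeriv (X : VField I M) (φ : M → ℝ) : M → ℝ :=
  fun p => (mfderiv I 𝓘(ℝ, ℝ) φ p (X p) : ℝ)

/-- The differential `df : Z ↦ Z(f)`. -/
def differential (f : M → ℝ) : FieldFunctional I M := fun Z => dirDeriv Z f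

/-- `[X, Y]`. -/
def bracket (X Y : VField I M) : VField I M := VectorField.mlieBracket I X Y

/-- A differential one-form on `M`, as a `C^∞(M)`-linear map `Γ(TM) → C^∞(M)`. -/
structure IsOneForm [IsManifold I ∞ M] (α : FieldFunctional I M) : Prop where
  smooth : ∀ Z : VField I M, IsSmoothField Z → IsSmoothFun I (α Z)
  add : ∀ Z Z' : VField I M, IsSmoothField Z → IsSmoothField Z' →
    α (fun p => Z p + Z' p) = fun p => α Z p + α Z' p
  smul : ∀ (φ : M → ℝ) (Z : VField I M), IsSmoothFun I φ → IsSmoothField Z →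
    α (fun p => φ p • Z p) = fun p => φ p * α Z p

/-- `α_p = u^♭ = g_p(u, ·)`. -/
def IsFlatAt [IsManifold I ∞ M] (g : BilinField I M) (α : FieldFunctional I M) (p : M)
    (u : TangentSpace I p) : Prop :=
  ∀ Z : VField I M, IsSmoothField Z → α Z p = g p u (Z p)

/-- `α ∈ 𝒜^•(M)`: `α` is a one-form and `α_p` lies in the image `(T_pM)^•` of
`♭ : T_pM → T_p^*M` at every point `p`. -/
structure IsRadicalAnnihilator [IsManifold I ∞ M] (g : BilinField I M)
    (α : FieldFunctional I M) : Prop where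
  isOneForm : IsOneForm α
  mem : ∀ p : M, ∃ u : TangentSpace I p, IsFlatAt g α p u

open Classical in
/-- The inner product `g_•` induced on `(T_pM)^•`: if `α_p = u^♭` and `β_p = v^♭`, then
`g_•(α_p, β_p) = g_p(u, v)`. If `g` is non-degenerate, this is the dual inner product `g^*`
on `T_p^*M`. -/
def coInner [IsManifold I ∞ M] (g : BilinField I M) (α β : FieldFunctional I M) (p : M) : ℝ :=
  if h : (∃ u, IsFlatAt g α p u) ∧ (∃ v, IsFlatAt g β p v) then
    g p h.1.choose h.2.choose
  else 0

/-- The quadratic form `v ↦ g_p(v, v)`. -/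
def quadAt (g : BilinField I M) (p : M) : QuadraticForm ℝ (TangentSpace I p) :=
  LinearMap.BilinMap.toQuadraticMap (g p).toLinearMap₁₂

/-- The numbers of positive and of negative squares of `g_p`. -/
def signatureAt (g : BilinField I M) (p : M) : ℕ × ℕ :=
  (sigPos (quadAt g p), sigNeg (quadAt g p))

/-- The union of the regions of constant signature: the points near which the signature of `g`
is constant. It is open and, for a singular metric, dense. -/
def constSignature (g : BilinField I M) : Set M :=
  {p | ∀ᶠ q in 𝓝 p, signatureAt g q = signatureAt g p}

/-- The covariant contraction `⟪α, β⟫_•`: it is computed by `g_•` on the regions of constant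
signature, and extended from there by continuity to the points where the signature changes. -/
def contraction [IsManifold I ∞ M] (g : BilinField I M) (α β : FieldFunctional I M) : M → ℝ :=
  extendFrom (constSignature g) (coInner g α β)

/-- The Koszul form `𝒦(X, Y, Z)`. -/
def koszul (g : BilinField I M) (X Y Z : VField I M) : M → ℝ := fun p =>
  (1 / 2 : ℝ) *
    (dirDeriv X (pairing g Y Z) p + dirDeriv Y (pairing g Z X) p - dirDeriv Z (pairing g X Y) p
      - pairing g X (bracket Y Z) p + pairing g Y (bracket Z X) p + pairing g Z (bracket X Y) p)

/-- The semi-symmetric metric Koszul form `𝒦̄_P(X, Y, Z)`. -/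
def ssKoszul (g : BilinField I M) (P X Y Z : VField I M) : M → ℝ := fun p =>
  koszul g X Y Z p + pairing g Y P p * pairing g X Z p - pairing g X Y p * pairing g P Z p

/-- The lower covariant derivative `∇^♭_X Y`. -/
def lowerCov (g : BilinField I M) (X Y : VField I M) : FieldFunctional I M := koszul g X Y

/-- The semi-symmetric metric lower covariant derivative `∇̄^♭_X Y`. -/
def ssLowerCov (g : BilinField I M) (P X Y : VField I M) : FieldFunctional I M :=
  ssKoszul g P X Y

/-- The covariant derivative of one-forms,
`(∇_X α)(Y) = X(α(Y)) - ⟪∇^♭_X Y, α⟫_•`. -/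
def cov [IsManifold I ∞ M] (g : BilinField I M) (X : VField I M) (α : FieldFunctional I M) :
    FieldFunctional I M :=
  fun Y p => dirDeriv X (α Y) p - contraction g (lowerCov g X Y) α p

/-- The semi-symmetric metric covariant derivative of one-forms,
`(∇̄_X α)(Y) = X(α(Y)) - ⟪∇̄^♭_X Y, α⟫_•`. -/
def ssCov [IsManifold I ∞ M] (g : BilinField I M) (P X : VField I M)
    (α : FieldFunctional I M) : FieldFunctional I M :=
  fun Y p => dirDeriv X (α Y) p - contraction g (ssLowerCov g P X Y) α p

/-- `(M, g)` is a semi-regular semi-Riemannian manifold. -/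
structure IsSemiRegular [IsManifold I ∞ M] (g : BilinField I M) : Prop where
  isSingularMetric : IsSingularMetric g
  lowerCov_mem : ∀ X Y : VField I M, IsSmoothField X → IsSmoothField Y →
    IsRadicalAnnihilator g (lowerCov g X Y)
  cov_mem : ∀ X Y Z : VField I M, IsSmoothField X → IsSmoothField Y → IsSmoothField Z →
    IsRadicalAnnihilator g (cov g Z (lowerCov g X Y))

/-- The Riemann curvature `R(X, Y, Z, T)`. -/
def curvature [IsManifold I ∞ M] (g : BilinField I M) (X Y Z T : VField I M) : M → ℝ := fun p =>
  cov g X (lowerCov g Y Z) T p - cov g Y (lowerCov g X Z) T p - lowerCov g (bracket X Y) Z T p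

/-- The curvature `R̄(X, Y, Z, T)` of the semi-symmetric metric covariant derivative. -/
def ssCurvature [IsManifold I ∞ M] (g : BilinField I M) (P X Y Z T : VField I M) : M → ℝ :=
  fun p =>
    ssCov g P X (ssLowerCov g P Y Z) T p - ssCov g P Y (ssLowerCov g P X Z) T p
      - ssLowerCov g P (bracket X Y) Z T p

/-- The Hessian `H^f(X, Y) = (∇_X df)(Y)`. -/
def hessian [IsManifold I ∞ M] (g : BilinField I M) (f : M → ℝ) (X Y : VField I M) : M → ℝ :=
  cov g X (differential f) Y

end Basic

section Warped

variable {E₁ : Type*} [NormedAddCommGroup E₁] [NormedSpace ℝ E₁]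
  {H₁ : Type*} [TopologicalSpace H₁] {I : ModelWithCorners ℝ E₁ H₁}
  {B : Type*} [TopologicalSpace B] [ChartedSpace H₁ B]
  {E₂ : Type*} [NormedAddCommGroup E₂] [NormedSpace ℝ E₂]
  {H₂ : Type*} [TopologicalSpace H₂] {J : ModelWithCorners ℝ E₂ H₂}
  {F : Type*} [TopologicalSpace F] [ChartedSpace H₂ F]

/-- The pullback `(u, v) ↦ h(L u, L v)` of a bilinear form along a linear map. -/
def pullbackForm {V V' : Type*} [AddCommGroup V] [Module ℝ V] [TopologicalSpace V]
    [AddCommGroup V'] [Module ℝ V'] [TopologicalSpace V'] (L : V →L[ℝ] V')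
    (h : V' →L[ℝ] V' →L[ℝ] ℝ) : V →L[ℝ] V →L[ℝ] ℝ :=
  (ContinuousLinearMap.precomp ℝ L).comp (h.comp L)

/-- The metric `π_B^* g_B + (f ∘ π_B)² π_F^* g_F` of the warped product `B ×_f F`. -/
def warpedMetric (f : B → ℝ) (gB : BilinField I B) (gF : BilinField J F) :
    BilinField (I.prod J) (B × F) := fun p =>
  pullbackForm (mfderiv (I.prod J) I Prod.fst p) (gB p.1)
    + (f p.1) ^ 2 • pullbackForm (mfderiv (I.prod J) J Prod.snd p) (gF p.2)

/-- The lift to `B × F` of a vector field on `B`, under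
`T_(b,x)(B × F) = T_b B × T_x F`. -/
def liftBase (X : VField I B) : VField (I.prod J) (B × F) :=
  fun p => ((X p.1, 0) : TangentSpace I p.1 × TangentSpace J p.2)

/-- The lift to `B × F` of a vector field on `F`. -/
def liftFiber (V : VField J F) : VField (I.prod J) (B × F) :=
  fun p => ((0, V p.2) : TangentSpace I p.1 × TangentSpace J p.2)

end Warped

end SingularGeometry

end

set_option linter.unusedSectionVars false

noncomputable section

namespace SingularGeometry

/-! ### Smooth functions and fields, directional derivatives, pairings -/

section Fields

variable {E : Type*} [NormedAddCommGroup E] [NormedSpace ℝ E]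
  {H : Type*} [TopologicalSpace H] {I : ModelWithCorners ℝ E H}
  {M : Type*} [TopologicalSpace M] [ChartedSpace H M]

/-! Write `g` for the warped metric `g_B + f² g_F`. The Koszul forms of lifts are elementary, since
lifts from different factors are orthogonal and commute. Each of them has horizontal part `a η`,
with `a` a function on `F` and `η` a one-form on `B`, and vertical part `f e V^♭ + f² κ`, where `♭`
is taken in `g_F`, `e` is a function on `B`, and `κ` is `0` or a Koszul form of `F`. This shape is
`IsSplitForm`.

The difficulty is the contraction across the zeros of `f`, where `g` degenerates. Where `f ≠ 0`, the
vertical part is represented by `(e/f) V + v`, with `v` representing `κ`. In the inner product the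
factor `f²` of the metric cancels the denominators, leaving `a a' g_B^*(η, η') + e e' g_F(V, V') + f
e κ'(V) + f e' κ(V') + f² ⟪κ, κ'⟫`. This expression is smooth on all of `B × F`, the last term by
semi-regularity of `F`. The contraction is defined by continuity from the points of constant
signature, a dense set because both indices of inertia are lower semicontinuous. So it suffices to
compare there. If such a point lies over a zero of `f`, either `f` vanishes near its base point, and
then `e`, which is `0`, `X(f)` or `X(f) + f g_B(X, P)`, vanishes too, or `g_F` vanishes at its fibre
point. In both cases the only term without a factor `f` on the vertical side, `e e' g_F(V, V')`, is
zero. Hence `IsSplitForm.contraction_eq` holds everywhere.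

The curvature formulas follow by evaluating `∇̄` of the forms `∇̄^♭` on lifts with this contraction
formula, and combining the results with the identities `[X, Y](f) = X(Y(f)) - Y(X(f))`, metric
compatibility and absence of torsion of the Koszul form. The one-form `f df + f² P^♭` on `B`, the
horizontal part of `-∇̄^♭` of two fibre lifts, produces the Hessian term of the fourth formula
through its covariant derivative (`ssCov_warpForm`), and the bracket of the sixth through its square
norm (`coInner_warpForm_warpForm`).

Semi-regularity concerns all vector fields, which near each point are `C^∞`-combinations of lifts.
The Koszul form is `C^∞`-linear in its first argument and obeys a Leibniz rule in the second, whose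
error term is a multiple of `C^♭`; so forms `∇^♭_A C` reduce to those of lifts and to flats of
fields (`koszul_induction`). Smoothness of all contractions comes first, and makes `∇_D ∇^♭_A C` a
one-form. It then lies in the image of `♭` at a point once it kills the radical of `g` there. The
radical is vertical: it is the whole fibre direction where `f = 0`, and the radical of `g_F` where
`f ≠ 0`. The vertical components of the covariant derivatives of lifts all vanish on it
(`IsWarpedData.cov_koszul_liftFiber_eq_zero`). -/

theorem IsSmoothFun.mdifferentiableAt {φ : M → ℝ} (hφ : IsSmoothFun I φ) (p : M) :
    MDifferentiableAt I 𝓘(ℝ, ℝ) φ p :=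
  (hφ p).mdifferentiableAt (by simp)

theorem IsSmoothFun.add {φ ψ : M → ℝ} (hφ : IsSmoothFun I φ) (hψ : IsSmoothFun I ψ) :
    IsSmoothFun I (fun p => φ p + ψ p) := ContMDiff.add hφ hψ

theorem IsSmoothFun.sub {φ ψ : M → ℝ} (hφ : IsSmoothFun I φ) (hψ : IsSmoothFun I ψ) :
    IsSmoothFun I (fun p => φ p - ψ p) := ContMDiff.sub hφ hψ

theorem IsSmoothFun.neg {φ : M → ℝ} (hφ : IsSmoothFun I φ) :
    IsSmoothFun I (fun p => - φ p) := ContMDiff.neg hφ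

theorem IsSmoothFun.mul {φ ψ : M → ℝ} (hφ : IsSmoothFun I φ) (hψ : IsSmoothFun I ψ) :
    IsSmoothFun I (fun p => φ p * ψ p) := ContMDiff.mul hφ hψ

theorem IsSmoothFun.pow {φ : M → ℝ} (hφ : IsSmoothFun I φ) (n : ℕ) :
    IsSmoothFun I (fun p => φ p ^ n) := ContMDiff.pow hφ n

theorem isSmoothFun_const (c : ℝ) : IsSmoothFun I (fun _ : M => c) := contMDiff_const

/-! ### Derivatives along vector fields -/

theorem dirDeriv_congr {φ ψ : M → ℝ} {X Y : VField I M} {p : M} (h : φ =ᶠ[𝓝 p] ψ)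
    (hXY : X p = Y p) : dirDeriv X φ p = dirDeriv Y ψ p := by
  simp only [dirDeriv]
  rw [hXY, h.mfderiv_eq]
  rfl

theorem dirDeriv_eq_mvfderiv (X : VField I M) (φ : M → ℝ) (p : M) :
    dirDeriv X φ p = mvfderiv I φ p (X p) := rfl

theorem dirDeriv_add_field (X Y : VField I M) (φ : M → ℝ) (p : M) :
    dirDeriv (fun q => X q + Y q) φ p = dirDeriv X φ p + dirDeriv Y φ p := by
  simp only [dirDeriv_eq_mvfderiv, map_add]

theorem dirDeriv_smul_field (a : M → ℝ) (X : VField I M) (φ : M → ℝ) (p : M) :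
    dirDeriv (fun q => a q • X q) φ p = a p * dirDeriv X φ p := by
  simp only [dirDeriv_eq_mvfderiv, map_smul, smul_eq_mul]

theorem dirDeriv_zero_field (φ : M → ℝ) (p : M) :
    dirDeriv (0 : VField I M) φ p = 0 := by
  simp only [dirDeriv_eq_mvfderiv, Pi.zero_apply, map_zero]

theorem dirDeriv_const (X : VField I M) (c : ℝ) (p : M) : dirDeriv X (fun _ => c) p = 0 := by
  rw [dirDeriv_eq_mvfderiv, mvfderiv_const]; rfl

theorem dirDeriv_add {φ ψ : M → ℝ} (hφ : IsSmoothFun I φ) (hψ : IsSmoothFun I ψ)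
    (X : VField I M) (p : M) :
    dirDeriv X (fun q => φ q + ψ q) p = dirDeriv X φ p + dirDeriv X ψ p := by
  have := mvfderiv_add (hφ.mdifferentiableAt p) (hψ.mdifferentiableAt p)
  exact congrArg (fun L => L (X p)) this

theorem dirDeriv_mul {φ ψ : M → ℝ} (hφ : IsSmoothFun I φ) (hψ : IsSmoothFun I ψ)
    (X : VField I M) (p : M) :
    dirDeriv X (fun q => φ q * ψ q) p = φ p * dirDeriv X ψ p + dirDeriv X φ p * ψ p := by
  have := mvfderiv_mul (hφ.mdifferentiableAt p) (hψ.mdifferentiableAt p)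
  have := congrArg (fun L => L (X p)) this
  refine this.trans ?_
  simp [dirDeriv_eq_mvfderiv, mul_comm]

theorem pairing_add_left (g : BilinField I M) (X X' Y : VField I M) :
    pairing g (fun q => X q + X' q) Y = fun p => pairing g X Y p + pairing g X' Y p := by
  funext p; simp [pairing]

theorem pairing_add_right (g : BilinField I M) (X Y Y' : VField I M) :
    pairing g X (fun q => Y q + Y' q) = fun p => pairing g X Y p + pairing g X Y' p := by
  funext p; simp [pairing]

theorem pairing_smul_left (g : BilinField I M) (a : M → ℝ) (X Y : VField I M) :
    pairing g (fun q => a q • X q) Y = fun p => a p * pairing g X Y p := by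
  funext p; simp [pairing]

theorem pairing_smul_right (g : BilinField I M) (a : M → ℝ) (X Y : VField I M) :
    pairing g X (fun q => a q • Y q) = fun p => a p * pairing g X Y p := by
  funext p; simp [pairing]

theorem bracket_swap (X Y : VField I M) (p : M) : bracket X Y p = - bracket Y X p :=
  VectorField.mlieBracket_swap_apply

theorem bracket_congr {X X' Y Y' : VField I M} {p : M} (hX : X =ᶠ[𝓝 p] X')
    (hY : Y =ᶠ[𝓝 p] Y') : bracket X Y p = bracket X' Y' p :=
  hX.mlieBracket_vectorField_eq hY

variable [IsManifold I ∞ M]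

theorem IsSmoothField.add {X Y : VField I M} (hX : IsSmoothField X) (hY : IsSmoothField Y) :
    IsSmoothField (fun p => X p + Y p) :=
  ContMDiff.add_section hX hY

theorem IsSmoothField.smul {φ : M → ℝ} {X : VField I M} (hφ : IsSmoothFun I φ)
    (hX : IsSmoothField X) : IsSmoothField (fun p => φ p • X p) :=
  ContMDiff.smul_section hφ hX

theorem isSmoothField_zero : IsSmoothField (0 : VField I M) :=
  Bundle.contMDiff_zeroSection ℝ (TangentSpace I)

theorem IsSmoothField.sum {ι : Type*} {s : Finset ι} {X : ι → VField I M}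
    (hX : ∀ i, IsSmoothField (X i)) : IsSmoothField (fun p => ∑ i ∈ s, X i p) :=
  ContMDiff.sum_section fun i _ => hX i

theorem IsSmoothField.mdifferentiableAt {X : VField I M} (hX : IsSmoothField X) (p : M) :
    MDifferentiableAt I I.tangent (fun p => (⟨p, X p⟩ : TangentBundle I M)) p :=
  (hX p).mdifferentiableAt (by simp)

theorem IsSmoothFun.dirDeriv {X : VField I M} {φ : M → ℝ} (hX : IsSmoothField X)
    (hφ : IsSmoothFun I φ) : IsSmoothFun I (dirDeriv X φ) := by
  have h1 : ContMDiff I.tangent 𝓘(ℝ, ℝ).tangent ∞ (tangentMap I 𝓘(ℝ, ℝ) φ) :=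
    ContMDiff.contMDiff_tangentMap hφ (by simp)
  have h2 := h1.comp hX
  have h3 : ContMDiff I 𝓘(ℝ, ℝ) ∞ fun p =>
      ((tangentMap I 𝓘(ℝ, ℝ) φ) (⟨p, X p⟩ : TangentBundle I M)).2 := by
    intro p
    have h4 := (Bundle.contMDiffAt_totalSpace.1 (h2 p)).2
    simpa using h4
  exact h3

/-! ### Pairings -/

theorem IsSingularMetric.isSmoothFun_pairing {g : BilinField I M} (hg : IsSingularMetric g)
    {X Y : VField I M} (hX : IsSmoothField X) (hY : IsSmoothField Y) :
    IsSmoothFun I (pairing g X Y) := by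
  have h := ContMDiff.clm_bundle_apply₂ (F₁ := E) (F₂ := E) (F₃ := ℝ)
    (E₁ := TangentSpace I) (E₂ := TangentSpace I) (E₃ := fun _ : M => ℝ) hg.smooth hX hY
  intro p
  have h4 := (Bundle.contMDiffAt_totalSpace.1 (h p)).2
  simp only [Bundle.Trivial.trivialization_apply, Bundle.Trivial.fiberBundle_trivializationAt'] at h4
  exact h4

theorem IsSingularMetric.pairing_comm {g : BilinField I M} (hg : IsSingularMetric g)
    (X Y : VField I M) : pairing g X Y = pairing g Y X :=
  funext fun p => hg.symm p _ _

end Fields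

section FiniteDimensional

variable {E : Type*} [NormedAddCommGroup E] [NormedSpace ℝ E] [FiniteDimensional ℝ E]
  {H : Type*} [TopologicalSpace H] {I : ModelWithCorners ℝ E H}
  {M : Type*} [TopologicalSpace M] [ChartedSpace H M] [IsManifold I ∞ M]

/-! ### Lie brackets -/

theorem IsSmoothField.bracket {X Y : VField I M} (hX : IsSmoothField X) (hY : IsSmoothField Y) :
    IsSmoothField (bracket X Y) :=
  haveI : CompleteSpace E := FiniteDimensional.complete ℝ E
  haveI : IsManifold I (minSmoothness ℝ 2) M := by
    rw [minSmoothness_of_isRCLikeNormedField]; infer_instance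
  haveI : IsManifold I (((⊤ : ℕ∞) : WithTop ℕ∞) + 1) M := by
    change IsManifold I ∞ M; infer_instance
  ContDiff.mlieBracket_vectorField (m := ⊤) (n := ⊤) hX hY
    (by rw [minSmoothness_of_isRCLikeNormedField]; exact le_rfl)

theorem bracket_add_right {X Y Y' : VField I M} (hY : IsSmoothField Y) (hY' : IsSmoothField Y')
    (p : M) : bracket X (fun q => Y q + Y' q) p = bracket X Y p + bracket X Y' p :=
  haveI : CompleteSpace E := FiniteDimensional.complete ℝ E
  VectorField.mlieBracket_add_right (hY.mdifferentiableAt p) (hY'.mdifferentiableAt p)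

theorem bracket_add_left {X X' Y : VField I M} (hX : IsSmoothField X) (hX' : IsSmoothField X')
    (p : M) : bracket (fun q => X q + X' q) Y p = bracket X Y p + bracket X' Y p :=
  haveI : CompleteSpace E := FiniteDimensional.complete ℝ E
  VectorField.mlieBracket_add_left (hX.mdifferentiableAt p) (hX'.mdifferentiableAt p)

theorem bracket_smul_right {φ : M → ℝ} {X Y : VField I M} (hφ : IsSmoothFun I φ)
    (hY : IsSmoothField Y) (p : M) :
    bracket X (fun q => φ q • Y q) p = dirDeriv X φ p • Y p + φ p • bracket X Y p :=
  haveI : CompleteSpace E := FiniteDimensional.complete ℝ E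
  VectorField.mlieBracket_smul_right (hφ.mdifferentiableAt p) (hY.mdifferentiableAt p)

theorem bracket_smul_left {φ : M → ℝ} {X Y : VField I M} (hφ : IsSmoothFun I φ)
    (hX : IsSmoothField X) (p : M) :
    bracket (fun q => φ q • X q) Y p = - dirDeriv Y φ p • X p + φ p • bracket X Y p :=
  haveI : CompleteSpace E := FiniteDimensional.complete ℝ E
  VectorField.mlieBracket_smul_left (hφ.mdifferentiableAt p) (hX.mdifferentiableAt p)

theorem bracket_jacobi {X Y Z : VField I M} (hX : IsSmoothField X) (hY : IsSmoothField Y)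
    (hZ : IsSmoothField Z) (p : M) :
    bracket X (bracket Y Z) p = bracket (bracket X Y) Z p + bracket Y (bracket X Z) p :=
  haveI : CompleteSpace E := FiniteDimensional.complete ℝ E
  haveI : IsManifold I (minSmoothness ℝ 3) M := by
    rw [minSmoothness_of_isRCLikeNormedField]; infer_instance
  have h2 : minSmoothness ℝ 2 ≤ ∞ := by
    rw [minSmoothness_of_isRCLikeNormedField]; exact ENat.LEInfty.out
  VectorField.leibniz_identity_mlieBracket_apply ((hX p).of_le h2) ((hY p).of_le h2)
    ((hZ p).of_le h2)

end FiniteDimensional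

/-! ### Extension of germs, local frames, tangent vectors as derivations -/

section Frames

variable {E : Type*} [NormedAddCommGroup E] [NormedSpace ℝ E] [FiniteDimensional ℝ E]
  {H : Type*} [TopologicalSpace H] {I : ModelWithCorners ℝ E H}
  {M : Type*} [TopologicalSpace M] [ChartedSpace H M] [T2Space M]

/-- Smooth functions defined near a point extend to smooth functions on `M` with the same germ. -/
theorem exists_smoothFun_eventuallyEq {p : M} {u : Set M} (hu : u ∈ 𝓝 p) {φ : M → ℝ}
    [IsManifold I ∞ M]
    (hφ : ContMDiffOn I 𝓘(ℝ, ℝ) ∞ φ u) :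
    ∃ ψ : M → ℝ, IsSmoothFun I ψ ∧ ψ =ᶠ[𝓝 p] φ := by
  obtain ⟨ρ, -, hρ⟩ :=
    (SmoothBumpFunction.nhds_basis_tsupport (I := I) p).mem_iff.1 (interior_mem_nhds.2 hu)
  refine ⟨fun q => ρ q * φ q, ?_, ?_⟩
  · refine contMDiff_of_tsupport fun q hq => ?_
    have hq' : q ∈ interior u := hρ (closure_mono (Function.support_mul_subset_left _ _) hq)
    exact ρ.contMDiffAt.mul (hφ.contMDiffAt (mem_interior_iff_mem_nhds.1 hq'))
  · filter_upwards [ρ.eventuallyEq_one] with q hq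
    simp [hq]

variable [IsManifold I ∞ M]

/-- Smooth vector fields defined near a point extend to smooth vector fields on `M` with the same
germ. -/
theorem exists_smoothField_eventuallyEq {p : M} {u : Set M} (hu : u ∈ 𝓝 p) {X : VField I M}
    (hX : ContMDiffOn I I.tangent ∞ (fun p => (⟨p, X p⟩ : TangentBundle I M)) u) :
    ∃ Y : VField I M, IsSmoothField Y ∧ ∀ᶠ q in 𝓝 p, Y q = X q := by
  obtain ⟨ρ, -, hρ⟩ :=
    (SmoothBumpFunction.nhds_basis_tsupport (I := I) p).mem_iff.1 (interior_mem_nhds.2 hu)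
  refine ⟨fun q => ρ q • X q, ?_, ?_⟩
  · exact ContMDiffOn.smul_section_of_tsupport (u := interior u) ρ.contMDiff.contMDiffOn
      isOpen_interior hρ (hX.mono interior_subset)
  · filter_upwards [ρ.eventuallyEq_one] with q hq
    simp [hq]

section Along

variable {E' : Type*} [NormedAddCommGroup E'] [NormedSpace ℝ E'] [FiniteDimensional ℝ E']
  {H' : Type*} [TopologicalSpace H'] {J : ModelWithCorners ℝ E' H'}
  {N : Type*} [TopologicalSpace N] [ChartedSpace H' N] [IsManifold J ∞ N] [T2Space N]

/-- A smooth map `π : N → M` has, near each point, a frame of smooth vector fields on `M` which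
generate the smooth vector fields along `π`. -/
theorem exists_frame_along {π : N → M} (hπ : ContMDiff J I ∞ π) (n₀ : N) :
    ∃ X : Fin (Module.finrank ℝ E) → VField I M, (∀ i, IsSmoothField (X i)) ∧
      ∀ ζ : (n : N) → TangentSpace I (π n),
        ContMDiff J I.tangent ∞ (fun n => (⟨π n, ζ n⟩ : TangentBundle I M)) →
        ∃ φ : Fin (Module.finrank ℝ E) → N → ℝ, (∀ i, IsSmoothFun J (φ i)) ∧
          (∀ᶠ n in 𝓝 n₀, ζ n = ∑ i, φ i n • X i (π n)) ∧ (ζ n₀ = 0 → ∀ i, φ i n₀ = 0) := by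
  classical
  let e := trivializationAt E (TangentSpace I) (π n₀)
  let b := Module.finBasis ℝ E
  have he : e.baseSet ∈ 𝓝 (π n₀) :=
    e.open_baseSet.mem_nhds (FiberBundle.mem_baseSet_trivializationAt' _)
  choose X hX hXe using fun i => exists_smoothField_eventuallyEq he
    (e.contMDiffOn_localFrame_baseSet (I := I) ∞ b i)
  refine ⟨X, hX, fun ζ hζ => ?_⟩
  have hu : π ⁻¹' e.baseSet ∈ 𝓝 n₀ := hπ.continuous.continuousAt he
  -- The coefficients are the coordinates of `ζ` in the trivialization. They are smooth only near
  -- `n₀`, so they are cut off afterwards without changing their germs.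
  have hc : ∀ i, ContMDiffOn J 𝓘(ℝ, ℝ) ∞
      (fun n => b.repr (e (⟨π n, ζ n⟩ : TangentBundle I M)).2 i) (π ⁻¹' e.baseSet) := by
    intro i
    have h1 : ContMDiffOn J (I.prod 𝓘(ℝ, E)) ∞
        (fun n => e (⟨π n, ζ n⟩ : TangentBundle I M)) (π ⁻¹' e.baseSet) := by
      refine (e.contMDiffOn (IB := I) (n := ∞)).comp hζ.contMDiffOn fun n hn => ?_
      exact e.mem_source.2 hn
    have h2 : ContMDiffOn J 𝓘(ℝ, E) ∞
        (fun n => (e (⟨π n, ζ n⟩ : TangentBundle I M)).2) (π ⁻¹' e.baseSet) :=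
      contMDiff_snd.comp_contMDiffOn h1
    have h3 : ContDiff ℝ ∞ (fun v : E => b.repr v i) :=
      (LinearMap.toContinuousLinearMap (b.coord i)).contDiff
    exact h3.contMDiff.comp_contMDiffOn h2
  choose φ hφ hφe using fun i => exists_smoothFun_eventuallyEq hu (hc i)
  refine ⟨φ, hφ, ?_, fun h0 i => ?_⟩
  swap
  · have h1 : (e (⟨π n₀, (0 : TangentSpace I (π n₀))⟩ : TangentBundle I M)).2 = 0 := by
      have := (e.continuousLinearEquivAt ℝ (π n₀)
        (FiberBundle.mem_baseSet_trivializationAt' _)).map_zero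
      exact this
    refine (hφe i).self_of_nhds.trans ?_
    dsimp only
    rw [h0, h1]
    simp
  filter_upwards [hu, Filter.eventually_all.2 hφe,
    hπ.continuous.continuousAt.eventually (Filter.eventually_all.2 hXe)] with n hn h1 h2
  have h3 : ζ n = ∑ i, (e.basisAt b hn).repr (ζ n) i • e.basisAt b hn i :=
    ((e.basisAt b hn).sum_repr (ζ n)).symm
  rw [h3]
  refine Finset.sum_congr rfl fun i _ => ?_
  rw [h1 i, h2 i, e.localFrame_apply_of_mem_baseSet b hn]
  congr 1

end Along

theorem exists_smoothField_apply_eq (p : M) (v : TangentSpace I p) :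
    ∃ X : VField I M, IsSmoothField X ∧ X p = v := by
  let e := trivializationAt E (TangentSpace I) p
  let b := Module.finBasis ℝ E
  have hp : p ∈ e.baseSet := FiberBundle.mem_baseSet_trivializationAt' _
  choose X hX hXe using fun i => exists_smoothField_eventuallyEq (e.open_baseSet.mem_nhds hp)
    (e.contMDiffOn_localFrame_baseSet (I := I) ∞ b i)
  refine ⟨fun q => ∑ i, (e.basisAt b hp).repr v i • X i q,
    IsSmoothField.sum fun i => (hX i).smul (isSmoothFun_const _), ?_⟩
  have h3 : v = ∑ i, (e.basisAt b hp).repr v i • e.basisAt b hp i :=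
    ((e.basisAt b hp).sum_repr v).symm
  conv_rhs => rw [h3]
  refine Finset.sum_congr rfl fun i _ => ?_
  rw [(hXe i).self_of_nhds, e.localFrame_apply_of_mem_baseSet b hp]

/-- Tangent vectors are determined by their action on smooth functions. -/
theorem tangentVector_eq_zero {p : M} {v : TangentSpace I p}
    (h : ∀ φ : M → ℝ, IsSmoothFun I φ → mvfderiv I φ p v = 0) : v = 0 := by
  have hinj : Function.Injective (mfderiv I 𝓘(ℝ, E) (extChartAt I p) p) :=
    (isInvertible_mfderiv_extChartAt (mem_extChartAt_source p)).injective
  apply hinj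
  rw [map_zero]
  have key : ∀ ℓ : E →L[ℝ] ℝ, ℓ (mfderiv I 𝓘(ℝ, E) (extChartAt I p) p v) = 0 := by
    intro ℓ
    have hs : ContMDiffOn I 𝓘(ℝ, ℝ) ∞ (fun q => ℓ (extChartAt I p q)) (chartAt H p).source :=
      ℓ.contMDiff.comp_contMDiffOn contMDiffOn_extChartAt
    obtain ⟨φ, hφ, hφe⟩ := exists_smoothFun_eventuallyEq (chart_source_mem_nhds H p) hs
    have h1 := h φ hφ
    have h2 : mfderiv I 𝓘(ℝ, ℝ) φ p = mfderiv I 𝓘(ℝ, ℝ) (fun q => ℓ (extChartAt I p q)) p :=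
      hφe.mfderiv_eq
    have h3 : mfderiv I 𝓘(ℝ, ℝ) (ℓ ∘ extChartAt I p) p =
        (mfderiv 𝓘(ℝ, E) 𝓘(ℝ, ℝ) ℓ (extChartAt I p p)).comp
          (mfderiv I 𝓘(ℝ, E) (extChartAt I p) p) :=
      mfderiv_comp p ℓ.mdifferentiableAt
        (mdifferentiableAt_extChartAt (mem_chart_source H p))
    rw [ContinuousLinearMap.mfderiv_eq] at h3
    have h4 : mvfderiv I φ p v = (mfderiv I 𝓘(ℝ, ℝ) φ p v : ℝ) := rfl
    rw [h4] at h1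
    have h5 : mfderiv I 𝓘(ℝ, ℝ) φ p v
        = mfderiv I 𝓘(ℝ, ℝ) (fun q => ℓ (extChartAt I p q)) p v := by rw [h2]; rfl
    have h6 := congrArg (fun L => L v) h3
    exact h6.symm.trans (h5.symm.trans h1)
  by_contra hne
  have hsep : ∀ w : E, w ≠ 0 → ∃ ℓ : E →L[ℝ] ℝ, ℓ w ≠ 0 := fun w hw =>
    SeparatingDual.exists_ne_zero hw
  obtain ⟨ℓ, hℓ⟩ := hsep _ hne
  exact hℓ (key ℓ)

/-- The Jacobi identity for `X`, `Y` and `φ Z` is expanded by the Leibniz rule. Subtracting `φ`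
times the identity for `X`, `Y`, `Z` leaves the claimed equation multiplied by `Z p`, so it is
enough to choose `Z` with `Z p ≠ 0`. -/
theorem dirDeriv_bracket {X Y : VField I M} {φ : M → ℝ} (hX : IsSmoothField X)
    (hY : IsSmoothField Y) (hφ : IsSmoothFun I φ) (p : M) :
    dirDeriv (bracket X Y) φ p
      = dirDeriv X (dirDeriv Y φ) p - dirDeriv Y (dirDeriv X φ) p := by
  -- No such `Z` exists when the tangent space is zero, but then all derivatives at `p` vanish.
  by_cases hE : ∀ v : TangentSpace I p, v = 0
  · have h0 : ∀ (Z : VField I M) (ψ : M → ℝ), dirDeriv Z ψ p = 0 := fun Z ψ => by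
      rw [dirDeriv_congr (Y := 0) Filter.EventuallyEq.rfl (hE _), dirDeriv_zero_field]
    simp [h0]
  push Not at hE
  obtain ⟨v, hv⟩ := hE
  obtain ⟨Z, hZ, rfl⟩ := exists_smoothField_apply_eq p v
  have hY' : IsSmoothFun I (dirDeriv Y φ) := hφ.dirDeriv hY
  have hX' : IsSmoothFun I (dirDeriv X φ) := hφ.dirDeriv hX
  have J1 := bracket_jacobi hX hY (IsSmoothField.smul hφ hZ) p
  have J2 := bracket_jacobi hX hY hZ p
  have e1 : ∀ W : VField I M, bracket W (fun q => φ q • Z q)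
      = fun q => dirDeriv W φ q • Z q + φ q • bracket W Z q :=
    fun W => funext fun q => bracket_smul_right hφ hZ q
  rw [e1, e1, bracket_add_right (hZ.smul hY') ((hY.bracket hZ).smul hφ), e1,
    bracket_add_right (hZ.smul hX') ((hX.bracket hZ).smul hφ), bracket_smul_right hY' hZ,
    bracket_smul_right hX' hZ, bracket_smul_right hφ (hY.bracket hZ),
    bracket_smul_right hφ (hX.bracket hZ), J2] at J1
  have J3 : (dirDeriv X (dirDeriv Y φ) p - dirDeriv Y (dirDeriv X φ) p
      - dirDeriv (bracket X Y) φ p) • Z p = 0 := by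
    have := sub_eq_zero.2 J1
    rw [← this]
    module
  rcases smul_eq_zero.1 J3 with h | h
  · linarith
  · exact absurd h hv

end Frames

/-! ### Algebra of the Koszul form -/

section Koszul

variable {E : Type*} [NormedAddCommGroup E] [NormedSpace ℝ E] [FiniteDimensional ℝ E]
  {H : Type*} [TopologicalSpace H] {I : ModelWithCorners ℝ E H}
  {M : Type*} [TopologicalSpace M] [ChartedSpace H M] [IsManifold I ∞ M]
  {g : BilinField I M}

theorem pairing_eventuallyEq {X X' Y Y' : VField I M} {p : M} (hX : X =ᶠ[𝓝 p] X')
    (hY : Y =ᶠ[𝓝 p] Y') : pairing g X Y =ᶠ[𝓝 p] pairing g X' Y' := by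
  filter_upwards [hX, hY] with q h1 h2
  simp only [pairing, h1, h2]

theorem koszul_congr {X X' Y Y' Z Z' : VField I M} {p : M} (hX : X =ᶠ[𝓝 p] X')
    (hY : Y =ᶠ[𝓝 p] Y') (hZ : Z =ᶠ[𝓝 p] Z') : koszul g X Y Z p = koszul g X' Y' Z' p := by
  simp only [koszul]
  rw [dirDeriv_congr (pairing_eventuallyEq hY hZ) hX.self_of_nhds,
    dirDeriv_congr (pairing_eventuallyEq hZ hX) hY.self_of_nhds,
    dirDeriv_congr (pairing_eventuallyEq hX hY) hZ.self_of_nhds]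
  simp only [pairing]
  rw [bracket_congr hY hZ, bracket_congr hZ hX, bracket_congr hX hY, hX.self_of_nhds,
    hY.self_of_nhds, hZ.self_of_nhds]

/-- Metric compatibility of the lower covariant derivative; it needs no inverse of `g`. -/
theorem koszul_add_swap (hg : IsSingularMetric g) (X Y Z : VField I M) (p : M) :
    koszul g X Y Z p + koszul g X Z Y p = dirDeriv X (pairing g Y Z) p := by
  simp only [koszul]
  rw [hg.pairing_comm Z Y, hg.pairing_comm X Y, hg.pairing_comm X Z]
  simp only [pairing]
  rw [bracket_swap Z Y, bracket_swap X Z, bracket_swap Y X]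
  simp only [map_neg]
  ring

/-- Absence of torsion, in its lowered form. -/
theorem koszul_sub_swap (hg : IsSingularMetric g) (X Y Z : VField I M) (p : M) :
    koszul g X Y Z p - koszul g Y X Z p = pairing g (bracket X Y) Z p := by
  simp only [koszul]
  rw [hg.pairing_comm (bracket X Y) Z, hg.pairing_comm Y X, hg.pairing_comm Z Y,
    hg.pairing_comm X Z]
  simp only [pairing]
  rw [bracket_swap Z X, bracket_swap Y X, bracket_swap Y Z]
  simp only [map_neg]
  ring

theorem koszul_add_right (hg : IsSingularMetric g) {X Y Z Z' : VField I M}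
    (hX : IsSmoothField X) (hY : IsSmoothField Y) (hZ : IsSmoothField Z)
    (hZ' : IsSmoothField Z') (p : M) :
    koszul g X Y (fun q => Z q + Z' q) p = koszul g X Y Z p + koszul g X Y Z' p := by
  simp only [koszul, pairing_add_left, pairing_add_right]
  rw [dirDeriv_add (hg.isSmoothFun_pairing hY hZ) (hg.isSmoothFun_pairing hY hZ'),
    dirDeriv_add (hg.isSmoothFun_pairing hZ hX) (hg.isSmoothFun_pairing hZ' hX),
    dirDeriv_add_field]
  simp only [pairing]
  rw [bracket_add_right hZ hZ', bracket_add_left hZ hZ']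
  simp only [map_add]
  ring

theorem koszul_smul_right (hg : IsSingularMetric g) {φ : M → ℝ} {X Y Z : VField I M}
    (hφ : IsSmoothFun I φ) (hX : IsSmoothField X) (hY : IsSmoothField Y)
    (hZ : IsSmoothField Z) (p : M) :
    koszul g X Y (fun q => φ q • Z q) p = φ p * koszul g X Y Z p := by
  simp only [koszul, pairing_smul_left, pairing_smul_right]
  rw [dirDeriv_mul hφ (hg.isSmoothFun_pairing hY hZ),
    dirDeriv_mul hφ (hg.isSmoothFun_pairing hZ hX), dirDeriv_smul_field]
  rw [hg.pairing_comm Z X]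
  simp only [pairing]
  rw [bracket_smul_right hφ hZ, bracket_smul_left hφ hZ]
  simp only [map_add, map_smul, smul_eq_mul]
  rw [hg.symm p (Y p) (Z p), hg.symm p (X p) (Z p)]
  ring

theorem koszul_add_left (hg : IsSingularMetric g) {X X' Y Z : VField I M}
    (hX : IsSmoothField X) (hX' : IsSmoothField X') (hY : IsSmoothField Y)
    (hZ : IsSmoothField Z) (p : M) :
    koszul g (fun q => X q + X' q) Y Z p = koszul g X Y Z p + koszul g X' Y Z p := by
  simp only [koszul, pairing_add_left, pairing_add_right]
  rw [dirDeriv_add (hg.isSmoothFun_pairing hZ hX) (hg.isSmoothFun_pairing hZ hX'),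
    dirDeriv_add (hg.isSmoothFun_pairing hX hY) (hg.isSmoothFun_pairing hX' hY),
    dirDeriv_add_field]
  simp only [pairing]
  rw [bracket_add_right hX hX', bracket_add_left hX hX']
  simp only [map_add]
  ring

theorem koszul_smul_left (hg : IsSingularMetric g) {φ : M → ℝ} {X Y Z : VField I M}
    (hφ : IsSmoothFun I φ) (hX : IsSmoothField X) (hY : IsSmoothField Y)
    (hZ : IsSmoothField Z) (p : M) :
    koszul g (fun q => φ q • X q) Y Z p = φ p * koszul g X Y Z p := by
  simp only [koszul, pairing_smul_left, pairing_smul_right]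
  rw [dirDeriv_mul hφ (hg.isSmoothFun_pairing hZ hX),
    dirDeriv_mul hφ (hg.isSmoothFun_pairing hX hY), dirDeriv_smul_field]
  rw [hg.pairing_comm Z X]
  simp only [pairing]
  rw [bracket_smul_right hφ hX, bracket_smul_left hφ hX]
  simp only [map_add, map_smul, smul_eq_mul]
  rw [hg.symm p (Y p) (X p), hg.symm p (Z p) (X p)]
  ring

theorem koszul_add_middle (hg : IsSingularMetric g) {X Y Y' Z : VField I M}
    (hX : IsSmoothField X) (hY : IsSmoothField Y) (hY' : IsSmoothField Y')
    (hZ : IsSmoothField Z) (p : M) :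
    koszul g X (fun q => Y q + Y' q) Z p = koszul g X Y Z p + koszul g X Y' Z p := by
  simp only [koszul, pairing_add_left, pairing_add_right]
  rw [dirDeriv_add (hg.isSmoothFun_pairing hY hZ) (hg.isSmoothFun_pairing hY' hZ),
    dirDeriv_add (hg.isSmoothFun_pairing hX hY) (hg.isSmoothFun_pairing hX hY'),
    dirDeriv_add_field]
  simp only [pairing]
  rw [bracket_add_right hY hY', bracket_add_left hY hY']
  simp only [map_add]
  ring

/-- The Leibniz rule. Its extra term is a multiple of `Y^♭`, which is why flats of fields accompany
Koszul forms in every later reduction to lifts. -/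
theorem koszul_smul_middle (hg : IsSingularMetric g) {φ : M → ℝ} {X Y Z : VField I M}
    (hφ : IsSmoothFun I φ) (hX : IsSmoothField X) (hY : IsSmoothField Y)
    (hZ : IsSmoothField Z) (p : M) :
    koszul g X (fun q => φ q • Y q) Z p
      = φ p * koszul g X Y Z p + dirDeriv X φ p * pairing g Y Z p := by
  simp only [koszul, pairing_smul_left, pairing_smul_right]
  rw [dirDeriv_mul hφ (hg.isSmoothFun_pairing hY hZ),
    dirDeriv_mul hφ (hg.isSmoothFun_pairing hX hY), dirDeriv_smul_field]
  simp only [pairing]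
  rw [bracket_smul_right hφ hY, bracket_smul_left hφ hY]
  simp only [map_add, map_smul, smul_eq_mul]
  rw [hg.symm p (Z p) (Y p)]
  ring

theorem IsSmoothFun.koszul (hg : IsSingularMetric g) {X Y Z : VField I M}
    (hX : IsSmoothField X) (hY : IsSmoothField Y) (hZ : IsSmoothField Z) :
    IsSmoothFun I (koszul g X Y Z) := by
  refine (isSmoothFun_const (1 / 2)).mul ?_
  have hp := fun {A B : VField I M} => hg.isSmoothFun_pairing (X := A) (Y := B)
  exact ((((((hp hY hZ).dirDeriv hX).add ((hp hZ hX).dirDeriv hY)).sub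
    ((hp hX hY).dirDeriv hZ)).sub (hp hX (hY.bracket hZ))).add (hp hY (hZ.bracket hX))).add
      (hp hZ (hX.bracket hY))

/-- Lets every computation made for `∇̄` serve for `∇` as well. -/
theorem ssKoszul_zero (g : BilinField I M) : ssKoszul g 0 = koszul g := by
  funext X Y Z p
  simp [ssKoszul, pairing]

theorem isOneForm_ssKoszul (hg : IsSingularMetric g) {P X Y : VField I M}
    (hP : IsSmoothField P) (hX : IsSmoothField X) (hY : IsSmoothField Y) :
    IsOneForm (ssKoszul g P X Y) where
  smooth Z hZ := ((IsSmoothFun.koszul hg hX hY hZ).add ((hg.isSmoothFun_pairing hY hP).mul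
    (hg.isSmoothFun_pairing hX hZ))).sub ((hg.isSmoothFun_pairing hX hY).mul
    (hg.isSmoothFun_pairing hP hZ))
  add Z Z' hZ hZ' := by
    funext p
    simp only [ssKoszul, pairing_add_right]
    rw [koszul_add_right hg hX hY hZ hZ']
    ring
  smul φ Z hφ hZ := by
    funext p
    simp only [ssKoszul, pairing_smul_right]
    rw [koszul_smul_right hg hφ hX hY hZ]
    ring

theorem isOneForm_koszul (hg : IsSingularMetric g) {X Y : VField I M}
    (hX : IsSmoothField X) (hY : IsSmoothField Y) : IsOneForm (koszul g X Y) := by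
  rw [← ssKoszul_zero]
  exact isOneForm_ssKoszul hg isSmoothField_zero hX hY

theorem isOneForm_pairing (hg : IsSingularMetric g) {X : VField I M} (hX : IsSmoothField X) :
    IsOneForm (pairing g X) where
  smooth _ hZ := hg.isSmoothFun_pairing hX hZ
  add _ _ _ _ := pairing_add_right ..
  smul _ _ _ _ := pairing_smul_right ..

theorem isOneForm_differential {f : M → ℝ} (hf : IsSmoothFun I f) :
    IsOneForm (differential (I := I) f) where
  smooth _ hZ := hf.dirDeriv hZ
  add _ _ _ _ := funext fun _ => dirDeriv_add_field ..
  smul _ _ _ _ := funext fun _ => dirDeriv_smul_field ..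

end Koszul

/-! ### Locality and tensoriality of one-forms -/

section OneForms

variable {E : Type*} [NormedAddCommGroup E] [NormedSpace ℝ E]
  {H : Type*} [TopologicalSpace H] {I : ModelWithCorners ℝ E H}
  {M : Type*} [TopologicalSpace M] [ChartedSpace H M] [IsManifold I ∞ M]
  {α : FieldFunctional I M}

theorem IsOneForm.map_zero (hα : IsOneForm α) (p : M) : α 0 p = 0 := by
  have h := congrFun (hα.smul (fun _ => 0) 0 (isSmoothFun_const 0) isSmoothField_zero) p
  simp only [zero_smul, zero_mul] at h
  exact h

theorem IsOneForm.map_sum (hα : IsOneForm α) {ι : Type*} (s : Finset ι) {X : ι → VField I M}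
    (hX : ∀ i, IsSmoothField (X i)) (p : M) :
    α (fun q => ∑ i ∈ s, X i q) p = ∑ i ∈ s, α (X i) p := by
  classical
  induction s using Finset.induction_on with
  | empty =>
    simp only [Finset.sum_empty]
    exact hα.map_zero p
  | insert a s ha ih =>
    simp only [Finset.sum_insert ha, ← ih]
    exact congrFun (hα.add _ _ (hX a) (IsSmoothField.sum hX)) p

theorem IsOneForm.comb {β : FieldFunctional I M} (hα : IsOneForm α) (hβ : IsOneForm β)
    {φ ψ : M → ℝ} (hφ : IsSmoothFun I φ) (hψ : IsSmoothFun I ψ) :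
    IsOneForm (fun Z p => φ p * α Z p + ψ p * β Z p) where
  smooth Z hZ := (hφ.mul (hα.smooth Z hZ)).add (hψ.mul (hβ.smooth Z hZ))
  add Z Z' hZ hZ' := by
    funext p
    rw [hα.add Z Z' hZ hZ', hβ.add Z Z' hZ hZ']
    ring
  smul χ Z hχ hZ := by
    funext p
    rw [hα.smul χ Z hχ hZ, hβ.smul χ Z hχ hZ]
    ring

variable [FiniteDimensional ℝ E] [T2Space M]

theorem IsOneForm.eq_of_eventuallyEq (hα : IsOneForm α) {Z Z' : VField I M}
    (hZ : IsSmoothField Z) (hZ' : IsSmoothField Z') {p : M} (h : ∀ᶠ q in 𝓝 p, Z q = Z' q) :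
    α Z p = α Z' p := by
  -- A bump function supported where the two fields agree makes them globally equal after
  -- multiplication, and it equals `1` at `p`.
  obtain ⟨ρ, -, hρ⟩ := (SmoothBumpFunction.nhds_basis_tsupport (I := I) p).mem_iff.1 h
  have h1 : (fun q => ρ q • Z q) = fun q => ρ q • Z' q := by
    funext q
    by_cases hq : q ∈ tsupport ρ
    · rw [show Z q = Z' q from hρ hq]
    · simp [image_eq_zero_of_notMem_tsupport hq]
  have h2 := congrFun (hα.smul ρ Z ρ.contMDiff hZ) p
  have h3 := congrFun (hα.smul ρ Z' ρ.contMDiff hZ') p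
  rw [h1, h3] at h2
  simpa [ρ.eq_one] using h2.symm

theorem IsOneForm.eq_of_apply_eq (hα : IsOneForm α) {Z Z' : VField I M}
    (hZ : IsSmoothField Z) (hZ' : IsSmoothField Z') {p : M} (h : Z p = Z' p) :
    α Z p = α Z' p := by
  -- By linearity it suffices that fields vanishing at `p` are killed. In a local frame their
  -- coefficients vanish at `p`.
  have key : ∀ W : VField I M, IsSmoothField W → W p = 0 → α W p = 0 := by
    intro W hW h0
    obtain ⟨X, hX, hspan⟩ := exists_frame_along (I := I) (J := I) (contMDiff_id (M := M)) p
    obtain ⟨φ, hφ, hWφ, hφ0⟩ := hspan W hW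
    rw [hα.eq_of_eventuallyEq hW (IsSmoothField.sum fun i => (hX i).smul (hφ i)) hWφ,
      hα.map_sum _ fun i => (hX i).smul (hφ i)]
    refine Finset.sum_eq_zero fun i _ => ?_
    simp only [hα.smul _ _ (hφ i) (hX i), hφ0 h0 i, zero_mul]
  have hm : IsSmoothField fun q => (-1 : ℝ) • Z' q := hZ'.smul (isSmoothFun_const _)
  have h1 := key _ (hZ.add hm) (by simp [h])
  rw [hα.add _ _ hZ hm, hα.smul _ _ (isSmoothFun_const _) hZ'] at h1
  linarith

/-- The covector `α_p`. -/
theorem IsOneForm.exists_covector (hα : IsOneForm α) (p : M) :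
    ∃ L : TangentSpace I p →ₗ[ℝ] ℝ, ∀ Z, IsSmoothField Z → α Z p = L (Z p) := by
  choose X hX hXp using exists_smoothField_apply_eq (I := I) p
  refine ⟨⟨⟨fun v => α (X v) p, fun v w => ?_⟩, fun c v => ?_⟩, fun Z hZ => ?_⟩
  · have h := congrFun (hα.add _ _ (hX v) (hX w)) p
    rw [← h]
    exact hα.eq_of_apply_eq (hX _) ((hX v).add (hX w)) (by rw [hXp, hXp, hXp])
  · have h := congrFun (hα.smul _ _ (isSmoothFun_const c) (hX v)) p
    refine Eq.trans ?_ h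
    exact hα.eq_of_apply_eq (hX _) ((hX v).smul (isSmoothFun_const c)) (by rw [hXp, hXp])
  · exact hα.eq_of_apply_eq hZ (hX _) (by rw [hXp])

end OneForms

/-! ### The image of the flat map and its inner product -/

section Flat

variable {E : Type*} [NormedAddCommGroup E] [NormedSpace ℝ E] [FiniteDimensional ℝ E]
  {H : Type*} [TopologicalSpace H] {I : ModelWithCorners ℝ E H}
  {M : Type*} [TopologicalSpace M] [ChartedSpace H M] [IsManifold I ∞ M] [T2Space M]
  {g : BilinField I M} {α β : FieldFunctional I M} {p : M}

theorem finiteDimensional_tangentSpace (p : M) : FiniteDimensional ℝ (TangentSpace I p) :=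
  inferInstanceAs (FiniteDimensional ℝ E)

theorem IsFlatAt.congr {u : TangentSpace I p} (h : IsFlatAt g α p u)
    (hαβ : ∀ Z, IsSmoothField Z → α Z p = β Z p) : IsFlatAt g β p u :=
  fun Z hZ => (hαβ Z hZ).symm.trans (h Z hZ)

theorem IsFlatAt.comb {u v : TangentSpace I p} (hα : IsFlatAt g α p u) (hβ : IsFlatAt g β p v)
    (φ ψ : M → ℝ) :
    IsFlatAt g (fun Z q => φ q * α Z q + ψ q * β Z q) p (φ p • u + ψ p • v) := by
  intro Z hZ
  simp [hα Z hZ, hβ Z hZ]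

theorem isFlatAt_pairing (X : VField I M) (p : M) : IsFlatAt g (pairing g X) p (X p) :=
  fun _ _ => rfl

/-- Two representatives of the same covector differ by an element of the radical, so the
representatives chosen in `coInner` are immaterial. -/
theorem coInner_eq (hg : ∀ u v : TangentSpace I p, g p u v = g p v u) {u v : TangentSpace I p}
    (hα : IsFlatAt g α p u) (hβ : IsFlatAt g β p v) : coInner g α β p = g p u v := by
  have uniq : ∀ {γ : FieldFunctional I M} {w w' : TangentSpace I p}, IsFlatAt g γ p w →
      IsFlatAt g γ p w' → ∀ z, g p w z = g p w' z := by
    intro γ w w' h h' z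
    obtain ⟨Z, hZ, rfl⟩ := exists_smoothField_apply_eq p z
    rw [← h Z hZ, ← h' Z hZ]
  have h : (∃ u, IsFlatAt g α p u) ∧ (∃ v, IsFlatAt g β p v) := ⟨⟨u, hα⟩, ⟨v, hβ⟩⟩
  rw [coInner, dif_pos h, uniq h.1.choose_spec hα, hg, uniq h.2.choose_spec hβ, hg]

/-- A `FieldFunctional` has values on non-smooth fields too. Forms that agree on smooth fields only
need not be equal, but `coInner` cannot tell them apart. -/
theorem coInner_congr {α' β' : FieldFunctional I M}
    (hg : ∀ u v : TangentSpace I p, g p u v = g p v u)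
    (hα : ∀ Z, IsSmoothField Z → α Z p = α' Z p) (hβ : ∀ Z, IsSmoothField Z → β Z p = β' Z p) :
    coInner g α β p = coInner g α' β' p := by
  by_cases h : (∃ u, IsFlatAt g α p u) ∧ (∃ v, IsFlatAt g β p v)
  · obtain ⟨⟨u, hu⟩, ⟨v, hv⟩⟩ := h
    rw [coInner_eq hg hu hv, coInner_eq hg (hu.congr hα) (hv.congr hβ)]
  · have h' : ¬ ((∃ u, IsFlatAt g α' p u) ∧ (∃ v, IsFlatAt g β' p v)) := fun h' =>
      h ⟨h'.1.imp fun u hu => hu.congr fun Z hZ => (hα Z hZ).symm,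
        h'.2.imp fun v hv => hv.congr fun Z hZ => (hβ Z hZ).symm⟩
    rw [coInner, coInner, dif_neg h, dif_neg h']

theorem coInner_comm (hg : ∀ u v : TangentSpace I p, g p u v = g p v u)
    (hα : ∃ u, IsFlatAt g α p u) (hβ : ∃ u, IsFlatAt g β p u) :
    coInner g α β p = coInner g β α p := by
  obtain ⟨u, hu⟩ := hα
  obtain ⟨v, hv⟩ := hβ
  rw [coInner_eq hg hu hv, coInner_eq hg hv hu, hg]

theorem coInner_comb_left {α' : FieldFunctional I M}
    (hg : ∀ u v : TangentSpace I p, g p u v = g p v u)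
    (hα : ∃ u, IsFlatAt g α p u) (hα' : ∃ u, IsFlatAt g α' p u) (hβ : ∃ u, IsFlatAt g β p u)
    (φ ψ : M → ℝ) :
    coInner g (fun Z q => φ q * α Z q + ψ q * α' Z q) β p
      = φ p * coInner g α β p + ψ p * coInner g α' β p := by
  obtain ⟨u, hu⟩ := hα
  obtain ⟨u', hu'⟩ := hα'
  obtain ⟨v, hv⟩ := hβ
  rw [coInner_eq hg (hu.comb hu' φ ψ) hv, coInner_eq hg hu hv, coInner_eq hg hu' hv]
  simp

theorem coInner_pairing_left (hg : ∀ u v : TangentSpace I p, g p u v = g p v u)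
    {X : VField I M} (hX : IsSmoothField X) (hβ : ∃ u, IsFlatAt g β p u) :
    coInner g (pairing g X) β p = β X p := by
  obtain ⟨v, hv⟩ := hβ
  rw [coInner_eq hg (isFlatAt_pairing X p) hv, hg, hv X hX]

/-- A one-form which vanishes on the radical of `g_p` lies in the image of `♭` at `p`. -/
theorem IsOneForm.exists_isFlatAt (hα : IsOneForm α)
    (hg : ∀ u v : TangentSpace I p, g p u v = g p v u)
    (h : ∀ Z, IsSmoothField Z → (∀ v, g p (Z p) v = 0) → α Z p = 0) :
    ∃ u, IsFlatAt g α p u := by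
  have := finiteDimensional_tangentSpace (I := I) p
  obtain ⟨L, hL⟩ := hα.exists_covector p
  let G : TangentSpace I p →ₗ[ℝ] Module.Dual ℝ (TangentSpace I p) :=
    (g p).toLinearMap₁₂
  have hmem : L ∈ LinearMap.range G := by
    -- Symmetry puts the range inside the annihilator of the kernel, and the dimensions agree.
    have h1 : LinearMap.range G = (LinearMap.ker G).dualAnnihilator := by
      apply Submodule.eq_of_le_of_finrank_eq
      · rintro _ ⟨u, rfl⟩
        rw [Submodule.mem_dualAnnihilator]
        intro w hw
        have : G w u = 0 := by rw [LinearMap.mem_ker.1 hw]; rfl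
        exact (hg u w).trans this
      · have h2 := LinearMap.finrank_range_add_finrank_ker G
        have h3 := Subspace.finrank_add_finrank_dualAnnihilator_eq (LinearMap.ker G)
        omega
    rw [h1, Submodule.mem_dualAnnihilator]
    intro w hw
    obtain ⟨Z, hZ, rfl⟩ := exists_smoothField_apply_eq p w
    rw [← hL Z hZ]
    exact h Z hZ fun v => congrArg (fun f => f v) (LinearMap.mem_ker.1 hw)
  obtain ⟨u, hu⟩ := hmem
  refine ⟨u, fun Z hZ => ?_⟩
  rw [hL Z hZ, ← hu]
  rfl

end Flat

/-! ### Semicontinuity of the signature and density of its regions of constancy -/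

section Signature

variable {E : Type*} [NormedAddCommGroup E] [NormedSpace ℝ E] [FiniteDimensional ℝ E]
  {H : Type*} [TopologicalSpace H] {I : ModelWithCorners ℝ E H}
  {M : Type*} [TopologicalSpace M] [ChartedSpace H M] [IsManifold I ∞ M] [T2Space M]
  {g : BilinField I M} {p : M}

theorem quadAt_apply (g : BilinField I M) (p : M) (v : TangentSpace I p) :
    quadAt g p v = g p v v := rfl

/-- The number of positive squares is lower semicontinuous. -/
theorem eventually_sigPos_le
    (hg : ∀ X Y : VField I M, IsSmoothField X → IsSmoothField Y → Continuous (pairing g X Y))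
    (p : M) : ∀ᶠ q in 𝓝 p, sigPos (quadAt g p) ≤ sigPos (quadAt g q) := by
  have hfd := fun q : M => finiteDimensional_tangentSpace (I := I) q
  obtain ⟨V, hV, hpos⟩ := exists_finrank_eq_sigPos_and_posDef (quadAt g p)
  rw [← hV]
  let b := Module.finBasis ℝ V
  choose X hX hXp using fun i => exists_smoothField_apply_eq (I := I) p (b i : TangentSpace I p)
  let F : M → (Fin (Module.finrank ℝ V) → ℝ) → ℝ := fun q c =>
    quadAt g q (∑ i, c i • X i q)
  have hF : ∀ q c, F q c = ∑ i, ∑ j, c i * c j * pairing g (X i) (X j) q := by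
    intro q c
    simp only [F, quadAt_apply, pairing]
    rw [map_sum, Finset.sum_comm]
    refine Finset.sum_congr rfl fun j _ => ?_
    rw [map_smul, map_sum, sum_apply, smul_eq_mul, Finset.mul_sum]
    refine Finset.sum_congr rfl fun i _ => ?_
    rw [map_smul, smul_apply, smul_eq_mul]
    ring
  have hFc : Continuous fun x : M × (Fin (Module.finrank ℝ V) → ℝ) => F x.1 x.2 := by
    simp only [hF]
    refine continuous_finsetSum _ fun i _ => continuous_finsetSum _ fun j _ => ?_
    refine Continuous.mul (by fun_prop) ?_
    exact (hg _ _ (hX i) (hX j)).comp continuous_fst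
  have hFp : ∀ c, c ≠ 0 → 0 < F p c := by
    intro c hc
    have h1 : (∑ i, c i • X i p) = ((∑ i, c i • b i : V) : TangentSpace I p) := by
      simp [hXp]
    have h2 : (∑ i, c i • b i : V) ≠ 0 := fun h0 =>
      hc (funext fun i => Fintype.linearIndependent_iff.1 b.linearIndependent c h0 i)
    have h3 := hpos _ h2
    simp only [F, h1]
    exact h3
  -- Positivity at `p` on the compact unit sphere of coefficients persists for nearby `q`;
  -- homogeneity of degree two then extends it to all nonzero coefficients.
  have hsph : ∀ᶠ q in 𝓝 p, ∀ c ∈ Metric.sphere (0 : Fin (Module.finrank ℝ V) → ℝ) 1,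
      0 < F q c := by
    refine (isCompact_sphere _ _).eventually_forall_of_forall_eventually fun c hc => ?_
    have : c ≠ 0 := by
      rintro rfl
      simp at hc
    exact (hFc.tendsto (p, c)).eventually (lt_mem_nhds (hFp c this))
  filter_upwards [hsph] with q hq
  have hq' : ∀ c, c ≠ 0 → 0 < F q c := by
    intro c hc
    have hn : ‖c‖ ≠ 0 := norm_ne_zero_iff.2 hc
    have h1 := hq (‖c‖⁻¹ • c) (by simp [norm_smul, hn])
    have h2 : F q (‖c‖⁻¹ • c) = ‖c‖⁻¹ ^ 2 * F q c := by
      simp only [hF, Finset.mul_sum, Pi.smul_apply, smul_eq_mul]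
      refine Finset.sum_congr rfl fun i _ => Finset.sum_congr rfl fun j _ => by ring
    rw [h2] at h1
    exact pos_of_mul_pos_right h1 (by positivity)
  let L : (Fin (Module.finrank ℝ V) → ℝ) →ₗ[ℝ] TangentSpace I q :=
    Fintype.linearCombination ℝ (fun i => X i q)
  have hL : ∀ c, quadAt g q (L c) = F q c := fun c => by
    simp only [F, L, Fintype.linearCombination_apply]
  -- Definiteness keeps the extended basis independent at `q`, so it spans a positive definite
  -- subspace of the same dimension as at `p`.
  have hLinj : Function.Injective L := by
    rw [← LinearMap.ker_eq_bot, LinearMap.ker_eq_bot']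
    intro c hc
    by_contra h0
    have h1 := hq' c h0
    rw [← hL, hc] at h1
    simp at h1
  have h1 : Module.finrank ℝ (LinearMap.range L) = Module.finrank ℝ V := by
    rw [LinearMap.finrank_range_of_inj hLinj]; simp
  rw [← h1]
  refine le_sigPos_of_posDef _ ?_
  rintro ⟨_, c, rfl⟩ hc
  have h0 : c ≠ 0 := by
    rintro rfl
    exact hc (by ext; simp)
  have h2 := hq' c h0
  rw [← hL] at h2
  exact h2

/-- The dimension of the radical of `g_p`. -/
def nullityAt (g : BilinField I M) (p : M) : ℕ :=
  Module.finrank ℝ (quadAt g p).radical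

theorem mem_radical_quadAt (hg : ∀ u v : TangentSpace I p, g p u v = g p v u)
    {u : TangentSpace I p} : u ∈ (quadAt g p).radical ↔ ∀ v, g p u v = 0 := by
  rw [QuadraticMap.mem_radical_iff']
  simp only [quadAt_apply, map_add, add_apply]
  constructor
  · rintro ⟨h0, h⟩ v
    have := h v
    rw [h0, hg v u] at this
    linarith
  · intro h
    refine ⟨h u, fun v => ?_⟩
    rw [h, h, hg v u, h]
    ring

theorem sig_add_nullityAt (g : BilinField I M) (p : M) :
    sigPos (quadAt g p) + sigNeg (quadAt g p) + nullityAt g p = Module.finrank ℝ E := by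
  have := finiteDimensional_tangentSpace (I := I) p
  exact QuadraticForm.sigPos_add_sigNeg_add_radical (Q := quadAt g p)

theorem eventually_sig_le (hg : IsSingularMetric g) (p : M) :
    ∀ᶠ q in 𝓝 p, sigPos (quadAt g p) ≤ sigPos (quadAt g q) ∧
      sigNeg (quadAt g p) ≤ sigNeg (quadAt g q) := by
  have h1 := eventually_sigPos_le (g := g)
    (fun X Y hX hY => (hg.isSmoothFun_pairing hX hY).continuous) p
  -- The negative index of `g` is the positive index of `-g`.
  have h2 := eventually_sigPos_le (g := fun q => - g q)
    (fun X Y hX hY => (hg.isSmoothFun_pairing hX hY).continuous.neg) p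
  have h3 : ∀ q, quadAt (fun q => - g q) q = - quadAt g q := fun q => rfl
  filter_upwards [h1, h2] with q h1 h2
  refine ⟨h1, ?_⟩
  simpa only [h3, sigPos_neg] using h2

/-- Near a point both indices can only grow, while together with the nullity they add up to the
dimension. If the nullity does not drop, neither index can change. -/
theorem mem_constSignature_iff (hg : IsSingularMetric g) :
    p ∈ constSignature g ↔ ∀ᶠ q in 𝓝 p, nullityAt g q = nullityAt g p := by
  constructor
  · intro h
    filter_upwards [h] with q hq
    have h1 := sig_add_nullityAt g p
    have h2 := sig_add_nullityAt g q
    simp only [signatureAt, Prod.mk.injEq] at hq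
    omega
  · intro h
    filter_upwards [h, eventually_sig_le hg p] with q hq hle
    have h1 := sig_add_nullityAt g p
    have h2 := sig_add_nullityAt g q
    simp only [signatureAt, Prod.mk.injEq]
    omega

/-- In a nonempty open set, take a point of least nullity. Nearby the nullity cannot increase by
semicontinuity and cannot decrease by minimality. -/
theorem dense_constSignature (hg : IsSingularMetric g) : Dense (constSignature g) := by
  rw [dense_iff_inter_open]
  intro U hU hne
  obtain ⟨q, hq, hmin⟩ := (measure (nullityAt g)).wf.has_min U hne
  refine ⟨q, hq, (mem_constSignature_iff hg).2 ?_⟩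
  filter_upwards [hU.mem_nhds hq, eventually_sig_le hg q] with r hr hle
  have h1 := sig_add_nullityAt g q
  have h2 := sig_add_nullityAt g r
  have h3 : ¬ nullityAt g r < nullityAt g q := hmin r hr
  omega

end Signature

/-! ### The contraction on and off the regions of constant signature -/

section Contraction

variable {E : Type*} [NormedAddCommGroup E] [NormedSpace ℝ E] [FiniteDimensional ℝ E]
  {H : Type*} [TopologicalSpace H] {I : ModelWithCorners ℝ E H}
  {M : Type*} [TopologicalSpace M] [ChartedSpace H M] [IsManifold I ∞ M] [T2Space M]
  {g : BilinField I M} {α β : FieldFunctional I M} {p : M}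

/-- Limits along a dense set are unique, so any continuous candidate that is correct on the regions
of constant signature near `p` gives the value, also at points where the signature jumps. -/
theorem contraction_eq (hg : IsSingularMetric g) {h : M → ℝ} (hc : ContinuousAt h p)
    (heq : ∀ᶠ q in 𝓝 p, q ∈ constSignature g → coInner g α β q = h q) :
    contraction g α β p = h p := by
  refine extendFrom_eq (dense_constSignature hg p) ?_
  refine (hc.tendsto.mono_left nhdsWithin_le_nhds).congr' ?_
  filter_upwards [nhdsWithin_le_nhds heq, self_mem_nhdsWithin] with q h1 h2
  exact (h1 h2).symm

theorem contraction_eventuallyEq (hg : IsSingularMetric g) {h : M → ℝ} (hc : IsSmoothFun I h)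
    (heq : ∀ᶠ q in 𝓝 p, q ∈ constSignature g → coInner g α β q = h q) :
    contraction g α β =ᶠ[𝓝 p] h := by
  filter_upwards [eventually_eventually_nhds.2 heq] with q hq
  exact contraction_eq hg hc.continuous.continuousAt hq

theorem IsSmoothFun.det {ι : Type*} [Fintype ι] [DecidableEq ι] {A : M → Matrix ι ι ℝ}
    (hA : ∀ i j, IsSmoothFun I fun q => A q i j) : IsSmoothFun I fun q => (A q).det := by
  simp only [Matrix.det_apply']
  refine contMDiff_finsetSum fun σ _ => ?_
  exact (isSmoothFun_const _).mul (contMDiff_finsetProd fun i _ => hA _ _)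

/-- On the regions of constant signature the contraction of forms in `𝒜^•` is smooth. -/
theorem exists_smooth_coInner (hg : IsSingularMetric g) (hp : p ∈ constSignature g)
    (hα : IsOneForm α) (hβ : IsOneForm β) (hα' : ∀ q, ∃ u, IsFlatAt g α q u)
    (hβ' : ∀ q, ∃ u, IsFlatAt g β q u) :
    ∃ h : M → ℝ, IsSmoothFun I h ∧ ∀ᶠ q in 𝓝 p, coInner g α β q = h q := by
  have hfd := fun q : M => finiteDimensional_tangentSpace (I := I) q
  -- On a complement of the radical the metric is non-degenerate. A basis of it, extended to fields
  -- `X i`, has an invertible Gram matrix `G` near `p`, and contractions are computed by `G⁻¹`.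
  obtain ⟨S, hS⟩ := Submodule.exists_isCompl (quadAt g p).radical
  let ι := Fin (Module.finrank ℝ S)
  let b := Module.finBasis ℝ S
  choose X hX hXp using fun i : ι =>
    exists_smoothField_apply_eq (I := I) p (b i : TangentSpace I p)
  let G : M → Matrix ι ι ℝ := fun q => Matrix.of fun i j => pairing g (X i) (X j) q
  have hG : ∀ i j, IsSmoothFun I fun q => G q i j :=
    fun i j => hg.isSmoothFun_pairing (hX i) (hX j)
  have hGmul : ∀ q c i, (G q).mulVec c i = g q (X i q) (∑ j, c j • X j q) := by
    intro q c i
    simp only [Matrix.mulVec, dotProduct, G, Matrix.of_apply, pairing, map_sum, map_smul,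
      smul_eq_mul, mul_comm]
  have hdet : (G p).det ≠ 0 := by
    intro h0
    obtain ⟨c, hc, hGc⟩ := Matrix.exists_mulVec_eq_zero_iff.2 h0
    apply hc
    let v : S := ∑ j, c j • b j
    have hv : (∑ j, c j • X j p) = (v : TangentSpace I p) := by simp [v, hXp]
    have hvS : ∀ w : S, g p (w : TangentSpace I p) (v : TangentSpace I p) = 0 := by
      intro w
      have h1 : ∀ i, g p (b i : TangentSpace I p) (v : TangentSpace I p) = 0 := by
        intro i
        rw [← hv, ← hXp i, ← hGmul, hGc]
        rfl
      have h2 : (w : TangentSpace I p) = ∑ i, b.repr w i • (b i : TangentSpace I p) := by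
        have h3 := congrArg Subtype.val (b.sum_repr w)
        rw [AddSubmonoidClass.coe_finsetSum] at h3
        exact h3.symm
      rw [h2]
      simp [h1]
    have hvr : (v : TangentSpace I p) ∈ (quadAt g p).radical := by
      rw [mem_radical_quadAt (hg.symm p)]
      intro w
      obtain ⟨r, hr, s, hs, rfl⟩ := Submodule.mem_sup.1
        (hS.sup_eq_top ▸ Submodule.mem_top : w ∈ (quadAt g p).radical ⊔ S)
      rw [map_add, hg.symm p _ r, (mem_radical_quadAt (hg.symm p)).1 hr, hg.symm p _ s,
        hvS ⟨s, hs⟩, add_zero]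
    have hv0 : v = 0 := by
      have := Submodule.disjoint_def.1 hS.disjoint _ hvr v.2
      exact_mod_cast this
    exact funext fun i => Fintype.linearIndependent_iff.1 b.linearIndependent c hv0 i
  have hdets : IsSmoothFun I fun q => (G q).det := IsSmoothFun.det hG
  have hadj : ∀ i j, IsSmoothFun I fun q => (G q).adjugate i j := by
    intro i j
    simp only [Matrix.adjugate_apply]
    refine IsSmoothFun.det fun k l => ?_
    by_cases hk : k = j
    · subst hk
      simpa using isSmoothFun_const _
    · simpa [Matrix.updateRow_ne hk] using hG k l
  have hdetp : ∀ᶠ q in 𝓝 p, (G q).det ≠ 0 := hdets.continuous.continuousAt.eventually_ne hdet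
  -- This is `∑ G⁻¹ᵢⱼ α(Xⱼ) β(Xᵢ)`, with the inverse written through the adjugate to make smoothness
  -- visible.
  let h : M → ℝ := fun q => ((G q).det)⁻¹ *
    ∑ i, (∑ j, (G q).adjugate i j * α (X j) q) * β (X i) q
  have hh : ContMDiffOn I 𝓘(ℝ, ℝ) ∞ h {q | (G q).det ≠ 0} := by
    refine ContMDiffOn.mul ?_ ?_
    · intro q hq
      exact ((hdets q).inv₀ hq).contMDiffWithinAt
    · refine ContMDiff.contMDiffOn ?_
      refine contMDiff_finsetSum fun i _ => IsSmoothFun.mul ?_ (hβ.smooth _ (hX i))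
      exact contMDiff_finsetSum fun j _ => (hadj i j).mul (hα.smooth _ (hX j))
  obtain ⟨h', hh', heq⟩ := exists_smoothFun_eventuallyEq hdetp hh
  refine ⟨h', hh', ?_⟩
  filter_upwards [heq, hdetp, (mem_constSignature_iff hg).1 hp] with q hq hdq hnull
  rw [hq]
  have hinj : ∀ c, (G q).mulVec c = 0 → c = 0 := fun c hc => by
    by_contra h0
    exact hdq (Matrix.exists_mulVec_eq_zero_iff.1 ⟨c, h0, hc⟩)
  let L : (ι → ℝ) →ₗ[ℝ] TangentSpace I q := Fintype.linearCombination ℝ (fun i => X i q)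
  have hL : ∀ c, L c = ∑ j, c j • X j q := fun c => by
    simp only [L, Fintype.linearCombination_apply]
  have hdisj : Disjoint (LinearMap.range L) (quadAt g q).radical := by
    rw [Submodule.disjoint_def]
    rintro _ ⟨c, rfl⟩ hr
    rw [hinj c, map_zero]
    funext i
    rw [hGmul, ← hL, hg.symm, (mem_radical_quadAt (hg.symm q)).1 hr]
    rfl
  have hLinj : Function.Injective L := by
    rw [← LinearMap.ker_eq_bot, LinearMap.ker_eq_bot']
    intro c hc
    apply hinj
    funext i
    rw [hGmul, ← hL, hc, map_zero]
    rfl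
  -- Here the constant nullity is used: the span of the `X i` meets the radical trivially, and only
  -- because the radical keeps its dimension do the two fill the tangent space at `q`.
  have htop : LinearMap.range L ⊔ (quadAt g q).radical = ⊤ := by
    apply Submodule.eq_top_of_finrank_eq
    have h1 := Submodule.finrank_sup_add_finrank_inf_eq (LinearMap.range L) (quadAt g q).radical
    rw [hdisj.eq_bot, finrank_bot, LinearMap.finrank_range_of_inj hLinj] at h1
    have h2 := Submodule.finrank_add_eq_of_isCompl hS
    have h3 : Module.finrank ℝ (TangentSpace I p) = Module.finrank ℝ E := rfl
    have h4 : Module.finrank ℝ (TangentSpace I q) = Module.finrank ℝ E := rfl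
    simp only [nullityAt] at hnull
    simp only [Module.finrank_fintype_fun_eq_card, ι, Fintype.card_fin] at h1
    omega
  -- The radical component of a representative does not affect its covector, so representatives may
  -- be taken in the span of the `X i`.
  have hflat : ∀ {γ : FieldFunctional I M} {u : TangentSpace I q}, IsFlatAt g γ q u →
      ∃ c : ι → ℝ, IsFlatAt g γ q (∑ j, c j • X j q) := by
    intro γ u hu
    obtain ⟨_, ⟨c, rfl⟩, r, hr, rfl⟩ := Submodule.mem_sup.1
        (htop ▸ Submodule.mem_top : u ∈ LinearMap.range L ⊔ (quadAt g q).radical)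
    refine ⟨c, fun Z hZ => ?_⟩
    rw [hu Z hZ, map_add, add_apply,
      (mem_radical_quadAt (hg.symm q)).1 hr, add_zero, hL]
  obtain ⟨u, hu⟩ := hα' q
  obtain ⟨v, hv⟩ := hβ' q
  obtain ⟨c, hc⟩ := hflat hu
  have ha : ∀ i, α (X i) q = (G q).mulVec c i := fun i => by
    rw [hGmul, hc _ (hX i), hg.symm]
  have hcadj : ∀ i, ((G q).det)⁻¹ * (∑ j, (G q).adjugate i j * α (X j) q) = c i := by
    intro i
    have h1 : (∑ j, (G q).adjugate i j * α (X j) q)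
        = ((G q).adjugate.mulVec ((G q).mulVec c)) i := by
      simp only [ha]
      rfl
    rw [h1, Matrix.mulVec_mulVec, Matrix.adjugate_mul, Matrix.smul_mulVec, Matrix.one_mulVec]
    simp only [Pi.smul_apply, smul_eq_mul]
    rw [inv_mul_cancel_left₀ hdq]
  rw [coInner_eq (hg.symm q) hc hv]
  simp only [h, Finset.mul_sum]
  rw [hg.symm q, map_sum]
  refine Finset.sum_congr rfl fun i _ => ?_
  rw [map_smul, ← hv _ (hX i), smul_eq_mul, ← hcadj i]
  simp only [Finset.mul_sum, Finset.sum_mul]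
  refine Finset.sum_congr rfl fun j _ => by ring

/-- The extension by continuity takes a limit even at points of constant signature; it returns the
original value there because `coInner` is smooth near such a point. -/
theorem contraction_eq_coInner (hg : IsSingularMetric g) (hp : p ∈ constSignature g)
    (hα : IsOneForm α) (hβ : IsOneForm β) (hα' : ∀ q, ∃ u, IsFlatAt g α q u)
    (hβ' : ∀ q, ∃ u, IsFlatAt g β q u) :
    contraction g α β p = coInner g α β p := by
  obtain ⟨h, hh, heq⟩ := exists_smooth_coInner hg hp hα hβ hα' hβ'
  rw [heq.self_of_nhds]
  exact contraction_eq hg hh.continuous.continuousAt (heq.mono fun q hq _ => hq)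

/-! ### Non-degenerate metrics -/

theorem IsNondegenerate.nullityAt_eq_zero (hg : IsSingularMetric g) (hn : IsNondegenerate g)
    (p : M) : nullityAt g p = 0 := by
  have : (quadAt g p).radical = ⊥ := by
    rw [Submodule.eq_bot_iff]
    exact fun u hu => hn p u ((mem_radical_quadAt (hg.symm p)).1 hu)
  rw [nullityAt, this, finrank_bot]

theorem IsNondegenerate.mem_constSignature (hg : IsSingularMetric g) (hn : IsNondegenerate g)
    (p : M) : p ∈ constSignature g := by
  rw [mem_constSignature_iff hg]
  exact Filter.Eventually.of_forall fun q => by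
    rw [hn.nullityAt_eq_zero hg, hn.nullityAt_eq_zero hg]

theorem IsNondegenerate.exists_isFlatAt (hg : IsSingularMetric g) (hn : IsNondegenerate g)
    (hα : IsOneForm α) (p : M) : ∃ u, IsFlatAt g α p u :=
  hα.exists_isFlatAt (hg.symm p) fun Z hZ h => by
    rw [hα.eq_of_apply_eq hZ isSmoothField_zero (hn p _ h), hα.map_zero]

theorem IsNondegenerate.contraction_eq_coInner (hg : IsSingularMetric g)
    (hn : IsNondegenerate g) (hα : IsOneForm α) (hβ : IsOneForm β) :
    contraction g α β = coInner g α β :=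
  funext fun p => SingularGeometry.contraction_eq_coInner hg (hn.mem_constSignature hg p) hα hβ
    (hn.exists_isFlatAt hg hα) (hn.exists_isFlatAt hg hβ)

theorem IsNondegenerate.isSmoothFun_coInner (hg : IsSingularMetric g)
    (hn : IsNondegenerate g) (hα : IsOneForm α) (hβ : IsOneForm β) :
    IsSmoothFun I (coInner g α β) := by
  intro p
  obtain ⟨h, hh, heq⟩ := exists_smooth_coInner hg (hn.mem_constSignature hg p) hα hβ
    (hn.exists_isFlatAt hg hα) (hn.exists_isFlatAt hg hβ)
  exact (hh p).congr_of_eventuallyEq heq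

end Contraction

/-! ### Smoothness of a metric tested on vector fields -/

section MetricCriterion

variable {E : Type*} [NormedAddCommGroup E] [NormedSpace ℝ E] [FiniteDimensional ℝ E]
  {H : Type*} [TopologicalSpace H] {I : ModelWithCorners ℝ E H}
  {M : Type*} [TopologicalSpace M] [ChartedSpace H M] [IsManifold I ∞ M] [T2Space M]
  {p : M}

/-- In finite dimension a linear map is the tuple of its values on a basis, through a continuous
linear equivalence. -/
theorem contMDiffAt_clm_of_basis {V : Type*} [NormedAddCommGroup V] [NormedSpace ℝ V]
    {n : ℕ} (b : Module.Basis (Fin n) ℝ E) {T : M → E →L[ℝ] V}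
    (h : ∀ i, ContMDiffAt I 𝓘(ℝ, V) ∞ (fun q => T q (b i)) p) :
    ContMDiffAt I 𝓘(ℝ, E →L[ℝ] V) ∞ T p := by
  let e₂ : (E →L[ℝ] V) ≃L[ℝ] (Fin n → V) :=
    (b.equivFunL.arrowCongr (1 : V ≃L[ℝ] V)).trans (ContinuousLinearEquiv.piRing (Fin n))
  have h1 : ContMDiffAt I 𝓘(ℝ, Fin n → V) ∞ (fun q => e₂ (T q)) p := by
    rw [contMDiffAt_pi_space]
    intro i
    convert h i using 2 with q
    exact congrArg (T q) (show b.equivFun.symm (Pi.single i 1) = b i by simp)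
  have h2 := e₂.symm.contDiff.contMDiff.contMDiffAt.comp p h1
  simpa [Function.comp_def] using h2

/-- A field of symmetric bilinear forms is smooth if it maps smooth vector fields to smooth
functions. -/
theorem isSingularMetric_of_pairing {g : BilinField I M}
    (hsymm : ∀ (p : M) (u v : TangentSpace I p), g p u v = g p v u)
    (hg : ∀ X Y : VField I M, IsSmoothField X → IsSmoothField Y → IsSmoothFun I (pairing g X Y)) :
    IsSingularMetric g := by
  refine ⟨hsymm, fun p => ?_⟩
  rw [Bundle.contMDiffAt_totalSpace]
  refine ⟨contMDiffAt_id, ?_⟩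
  let b := Module.finBasis ℝ E
  refine contMDiffAt_clm_of_basis b fun i => contMDiffAt_clm_of_basis b fun j => ?_
  let e := trivializationAt E (TangentSpace I) p
  have he : e.baseSet ∈ 𝓝 p :=
    e.open_baseSet.mem_nhds (FiberBundle.mem_baseSet_trivializationAt' _)
  choose X hX hXe using fun i => exists_smoothField_eventuallyEq he
    (e.contMDiffOn_localFrame_baseSet (I := I) ∞ b i)
  refine (hg _ _ (hX i) (hX j) p).congr_of_eventuallyEq ?_
  filter_upwards [he, hXe i, hXe j] with q hq h1 h2
  simp only [pairing]
  rw [h1, h2, e.localFrame_apply_of_mem_baseSet b hq, e.localFrame_apply_of_mem_baseSet b hq]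
  have hq' : q ∈ (trivializationAt (E →L[ℝ] ℝ) (fun x => TangentSpace I x →L[ℝ] ℝ) p).baseSet := by
    rw [hom_trivializationAt_baseSet]
    exact ⟨hq, by simp⟩
  simp only [hom_trivializationAt_apply, ContinuousLinearMap.inCoordinates,
    ContinuousLinearMap.comp_apply, Bundle.Trivialization.continuousLinearMapAt_apply]
  rw [Bundle.Trivialization.coe_linearMapAt_of_mem _ hq']
  simp only [hom_trivializationAt_apply, ContinuousLinearMap.inCoordinates,
    ContinuousLinearMap.comp_apply]
  have hs : ∀ k, e.basisAt b hq k = e.symmL ℝ q (b k) := fun k => by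
    rw [e.symmL_apply hq]
    simp [Bundle.Trivialization.basisAt]
  rw [hs, hs]
  simp [e]

end MetricCriterion

/-! ### Vector fields on a product and their lifts -/

section Product

variable {E₁ : Type*} [NormedAddCommGroup E₁] [NormedSpace ℝ E₁] [FiniteDimensional ℝ E₁]
  {H₁ : Type*} [TopologicalSpace H₁] {I : ModelWithCorners ℝ E₁ H₁}
  {B : Type*} [TopologicalSpace B] [ChartedSpace H₁ B] [IsManifold I ∞ B] [T2Space B]
  {E₂ : Type*} [NormedAddCommGroup E₂] [NormedSpace ℝ E₂] [FiniteDimensional ℝ E₂]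
  {H₂ : Type*} [TopologicalSpace H₂] {J : ModelWithCorners ℝ E₂ H₂}
  {F : Type*} [TopologicalSpace F] [ChartedSpace H₂ F] [IsManifold J ∞ F] [T2Space F]

theorem contMDiff_prod_field {π₁ : B × F → TangentBundle I B} {π₂ : B × F → TangentBundle J F}
    (h₁ : ContMDiff (I.prod J) I.tangent ∞ π₁) (h₂ : ContMDiff (I.prod J) J.tangent ∞ π₂) :
    ContMDiff (I.prod J) (I.prod J).tangent ∞
      (fun p => (equivTangentBundleProd I B J F).symm (π₁ p, π₂ p)) :=
  contMDiff_equivTangentBundleProd_symm.comp (h₁.prodMk h₂)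

theorem IsSmoothField.liftBase {X : VField I B} (hX : IsSmoothField X) :
    IsSmoothField (liftBase (J := J) (F := F) X) :=
  contMDiff_prod_field (hX.comp contMDiff_fst)
    ((isSmoothField_zero (I := J) (M := F)).comp contMDiff_snd)

theorem IsSmoothField.liftFiber {V : VField J F} (hV : IsSmoothField V) :
    IsSmoothField (liftFiber (I := I) (B := B) V) :=
  contMDiff_prod_field ((isSmoothField_zero (I := I) (M := B)).comp contMDiff_fst)
    (hV.comp contMDiff_snd)

theorem IsSmoothField.contMDiff_fst {Z : VField (I.prod J) (B × F)} (hZ : IsSmoothField Z) :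
    ContMDiff (I.prod J) I.tangent ∞ (fun p => (⟨p.1, (Z p).1⟩ : TangentBundle I B)) :=
  _root_.contMDiff_fst.comp (contMDiff_equivTangentBundleProd.comp hZ)

theorem IsSmoothField.contMDiff_snd {Z : VField (I.prod J) (B × F)} (hZ : IsSmoothField Z) :
    ContMDiff (I.prod J) J.tangent ∞ (fun p => (⟨p.2, (Z p).2⟩ : TangentBundle J F)) :=
  _root_.contMDiff_snd.comp (contMDiff_equivTangentBundleProd.comp hZ)

theorem sum_smul_inl_add_sum_smul_inr {V₁ V₂ : Type*} [AddCommGroup V₁] [Module ℝ V₁]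
    [AddCommGroup V₂] [Module ℝ V₂] {m n : ℕ} (c : Fin m → ℝ) (v : Fin m → V₁) (d : Fin n → ℝ)
    (w : Fin n → V₂) :
    ∑ i, c i • ((v i, 0) : V₁ × V₂) + ∑ i, d i • ((0, w i) : V₁ × V₂)
      = (∑ i, c i • v i, ∑ i, d i • w i) := by
  simp [Prod.ext_iff, Prod.fst_sum, Prod.snd_sum]

/-- A local and `C^∞`-linear property of vector fields on a product holds if it holds for lifts. -/
theorem lift_induction (p : B × F) {Pr : VField (I.prod J) (B × F) → Prop}
    (base : ∀ X : VField I B, IsSmoothField X → Pr (liftBase X))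
    (fiber : ∀ V : VField J F, IsSmoothField V → Pr (liftFiber V))
    (add : ∀ Z Z', IsSmoothField Z → IsSmoothField Z' → Pr Z → Pr Z' → Pr fun q => Z q + Z' q)
    (smul : ∀ (φ : B × F → ℝ) (Z : VField (I.prod J) (B × F)), IsSmoothFun (I.prod J) φ →
      IsSmoothField Z → Pr Z → Pr fun q => φ q • Z q)
    (congr : ∀ Z Z', IsSmoothField Z → IsSmoothField Z' → (∀ᶠ q in 𝓝 p, Z q = Z' q) →
      Pr Z → Pr Z')
    {Z : VField (I.prod J) (B × F)} (hZ : IsSmoothField Z) : Pr Z := by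
  have zero : Pr 0 := by
    have h := smul (fun _ => 0) _ (isSmoothFun_const 0) isSmoothField_zero.liftBase
      (base 0 isSmoothField_zero)
    simp only [zero_smul] at h
    exact h
  have sum : ∀ {n : ℕ} (s : Finset (Fin n)) (Y : Fin n → VField (I.prod J) (B × F)),
      (∀ i, IsSmoothField (Y i)) → (∀ i, Pr (Y i)) → Pr fun q => ∑ i ∈ s, Y i q := by
    intro n s Y hY hP
    classical
    induction s using Finset.induction_on with
    | empty =>
      simp only [Finset.sum_empty]
      exact zero
    | insert a s ha ih =>
      simp only [Finset.sum_insert ha]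
      exact add _ _ (hY a) (IsSmoothField.sum hY) (hP a) ih
  -- The two components of `Z` are fields along the projections; their coefficients in frames of the
  -- factors are functions on the product, which is why general coefficients `φ` on `B × F` must be
  -- allowed.
  obtain ⟨X, hX, hspanX⟩ :=
    exists_frame_along (I := I) (J := I.prod J) (_root_.contMDiff_fst (M := B) (N := F)) p
  obtain ⟨V, hV, hspanV⟩ :=
    exists_frame_along (I := J) (J := I.prod J) (_root_.contMDiff_snd (M := B) (N := F)) p
  obtain ⟨φ, hφ, hZφ, -⟩ := hspanX _ hZ.contMDiff_fst
  obtain ⟨ψ, hψ, hZψ, -⟩ := hspanV _ hZ.contMDiff_snd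
  have sX := fun i => (hX i).liftBase (J := J) (F := F) |>.smul (hφ i)
  have sV := fun i => (hV i).liftFiber (I := I) (B := B) |>.smul (hψ i)
  refine congr _ Z ((IsSmoothField.sum (s := Finset.univ) sX).add
    (IsSmoothField.sum (s := Finset.univ) sV)) hZ ?_
    (add _ _ (IsSmoothField.sum sX) (IsSmoothField.sum sV)
      (sum Finset.univ _ sX fun i => smul _ _ (hφ i) (hX i).liftBase (base _ (hX i)))
      (sum Finset.univ _ sV fun i => smul _ _ (hψ i) (hV i).liftFiber (fiber _ (hV i))))
  filter_upwards [hZφ, hZψ] with q h1 h2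
  exact (sum_smul_inl_add_sum_smul_inr (fun i => φ i q) (fun i => X i q.1) (fun i => ψ i q)
    fun i => V i q.2).trans (Prod.ext h1.symm h2.symm)

/-! ### Derivatives along lifts -/

theorem IsSmoothFun.comp_fst {φ : B → ℝ} (hφ : IsSmoothFun I φ) :
    IsSmoothFun (I.prod J) (fun p : B × F => φ p.1) := ContMDiff.comp hφ contMDiff_fst

theorem IsSmoothFun.comp_snd {ψ : F → ℝ} (hψ : IsSmoothFun J ψ) :
    IsSmoothFun (I.prod J) (fun p : B × F => ψ p.2) := ContMDiff.comp hψ contMDiff_snd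

theorem mvfderiv_comp_fst {φ : B → ℝ} (hφ : IsSmoothFun I φ) (p : B × F)
    (v : TangentSpace (I.prod J) p) :
    mvfderiv (I.prod J) (fun p : B × F => φ p.1) p v = mvfderiv I φ p.1 v.1 := by
  have h := mvfderiv_comp_apply (I := I) (I' := I.prod J) (g := φ) (f := Prod.fst) p
    (hφ.mdifferentiableAt p.1) mdifferentiableAt_fst v
  rw [mfderiv_fst] at h
  exact h

theorem mvfderiv_comp_snd {ψ : F → ℝ} (hψ : IsSmoothFun J ψ) (p : B × F)
    (v : TangentSpace (I.prod J) p) :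
    mvfderiv (I.prod J) (fun p : B × F => ψ p.2) p v = mvfderiv J ψ p.2 v.2 := by
  have h := mvfderiv_comp_apply (I := J) (I' := I.prod J) (g := ψ) (f := Prod.snd) p
    (hψ.mdifferentiableAt p.2) mdifferentiableAt_snd v
  rw [mfderiv_snd] at h
  exact h

theorem dirDeriv_liftBase_fst (X : VField I B) {φ : B → ℝ} (hφ : IsSmoothFun I φ) :
    dirDeriv (liftBase (J := J) (F := F) X) (fun p => φ p.1) = fun p => dirDeriv X φ p.1 :=
  funext fun p => mvfderiv_comp_fst hφ p _

theorem dirDeriv_liftBase_snd (X : VField I B) {ψ : F → ℝ} (hψ : IsSmoothFun J ψ) :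
    dirDeriv (liftBase (J := J) (F := F) X) (fun p => ψ p.2) = fun _ => 0 :=
  funext fun p => (mvfderiv_comp_snd hψ p _).trans (map_zero _)

theorem dirDeriv_liftFiber_fst (V : VField J F) {φ : B → ℝ} (hφ : IsSmoothFun I φ) :
    dirDeriv (liftFiber (I := I) (B := B) V) (fun p => φ p.1) = fun _ => 0 :=
  funext fun p => (mvfderiv_comp_fst hφ p _).trans (map_zero _)

theorem dirDeriv_liftFiber_snd (V : VField J F) {ψ : F → ℝ} (hψ : IsSmoothFun J ψ) :
    dirDeriv (liftFiber (I := I) (B := B) V) (fun p => ψ p.2) = fun p => dirDeriv V ψ p.2 :=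
  funext fun p => mvfderiv_comp_snd hψ p _

theorem dirDeriv_liftBase_mul (X : VField I B) {φ : B → ℝ} {ψ : F → ℝ} (hφ : IsSmoothFun I φ)
    (hψ : IsSmoothFun J ψ) (p : B × F) :
    dirDeriv (liftBase (J := J) (F := F) X) (fun p => φ p.1 * ψ p.2) p
      = dirDeriv X φ p.1 * ψ p.2 := by
  rw [dirDeriv_mul hφ.comp_fst hψ.comp_snd, dirDeriv_liftBase_fst X hφ,
    dirDeriv_liftBase_snd X hψ]
  ring

theorem dirDeriv_liftFiber_mul (V : VField J F) {φ : B → ℝ} {ψ : F → ℝ} (hφ : IsSmoothFun I φ)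
    (hψ : IsSmoothFun J ψ) (p : B × F) :
    dirDeriv (liftFiber (I := I) (B := B) V) (fun p => φ p.1 * ψ p.2) p
      = φ p.1 * dirDeriv V ψ p.2 := by
  rw [dirDeriv_mul hφ.comp_fst hψ.comp_snd, dirDeriv_liftFiber_fst V hφ,
    dirDeriv_liftFiber_snd V hψ]
  ring

/-! ### Brackets of lifts -/

/-- Functions pulled back from the two factors suffice to separate tangent vectors of the product;
brackets of lifts are identified by their action on such functions. -/
theorem tangentVector_prod_ext {p : B × F} {v w : TangentSpace (I.prod J) p}
    (h₁ : ∀ φ : B → ℝ, IsSmoothFun I φ →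
      mvfderiv (I.prod J) (fun p : B × F => φ p.1) p v
        = mvfderiv (I.prod J) (fun p : B × F => φ p.1) p w)
    (h₂ : ∀ ψ : F → ℝ, IsSmoothFun J ψ →
      mvfderiv (I.prod J) (fun p : B × F => ψ p.2) p v
        = mvfderiv (I.prod J) (fun p : B × F => ψ p.2) p w) : v = w := by
  refine Prod.ext (sub_eq_zero.1 ?_) (sub_eq_zero.1 ?_)
  · refine tangentVector_eq_zero (I := I) (p := p.1) fun φ hφ => ?_
    have := h₁ φ hφ
    rw [mvfderiv_comp_fst hφ, mvfderiv_comp_fst hφ] at this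
    exact (map_sub (mvfderiv I φ p.1) v.1 w.1).trans (sub_eq_zero.2 this)
  · refine tangentVector_eq_zero (I := J) (p := p.2) fun φ hφ => ?_
    have := h₂ φ hφ
    rw [mvfderiv_comp_snd hφ, mvfderiv_comp_snd hφ] at this
    exact (map_sub (mvfderiv J φ p.2) v.2 w.2).trans (sub_eq_zero.2 this)

theorem field_prod_ext {Z Z' : VField (I.prod J) (B × F)}
    (h₁ : ∀ φ : B → ℝ, IsSmoothFun I φ →
      dirDeriv Z (fun p : B × F => φ p.1) = dirDeriv Z' (fun p : B × F => φ p.1))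
    (h₂ : ∀ ψ : F → ℝ, IsSmoothFun J ψ →
      dirDeriv Z (fun p : B × F => ψ p.2) = dirDeriv Z' (fun p : B × F => ψ p.2)) : Z = Z' :=
  funext fun p => tangentVector_prod_ext (fun φ hφ => congrFun (h₁ φ hφ) p)
    fun ψ hψ => congrFun (h₂ ψ hψ) p

theorem bracket_liftBase_liftBase {X Y : VField I B} (hX : IsSmoothField X)
    (hY : IsSmoothField Y) :
    bracket (liftBase (J := J) (F := F) X) (liftBase Y) = liftBase (bracket X Y) := by
  refine field_prod_ext (fun φ hφ => ?_) fun ψ hψ => ?_ <;> funext p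
  · rw [dirDeriv_bracket hX.liftBase hY.liftBase hφ.comp_fst]
    simp only [dirDeriv_liftBase_fst _ hφ, dirDeriv_liftBase_fst _ (hφ.dirDeriv hX),
      dirDeriv_liftBase_fst _ (hφ.dirDeriv hY), dirDeriv_bracket hX hY hφ]
  · rw [dirDeriv_bracket hX.liftBase hY.liftBase hψ.comp_snd]
    simp only [dirDeriv_liftBase_snd _ hψ, dirDeriv_const, sub_zero]

theorem bracket_liftFiber_liftFiber {U V : VField J F} (hU : IsSmoothField U)
    (hV : IsSmoothField V) :
    bracket (liftFiber (I := I) (B := B) U) (liftFiber V) = liftFiber (bracket U V) := by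
  refine field_prod_ext (fun φ hφ => ?_) fun ψ hψ => ?_ <;> funext p
  · rw [dirDeriv_bracket hU.liftFiber hV.liftFiber hφ.comp_fst]
    simp only [dirDeriv_liftFiber_fst _ hφ, dirDeriv_const, sub_zero]
  · rw [dirDeriv_bracket hU.liftFiber hV.liftFiber hψ.comp_snd]
    simp only [dirDeriv_liftFiber_snd _ hψ, dirDeriv_liftFiber_snd _ (hψ.dirDeriv hU),
      dirDeriv_liftFiber_snd _ (hψ.dirDeriv hV), dirDeriv_bracket hU hV hψ]

theorem bracket_liftBase_liftFiber {X : VField I B} {V : VField J F} (hX : IsSmoothField X)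
    (hV : IsSmoothField V) : bracket (liftBase X) (liftFiber V) = 0 := by
  refine field_prod_ext (fun φ hφ => ?_) fun ψ hψ => ?_ <;> funext p
  · rw [dirDeriv_bracket hX.liftBase hV.liftFiber hφ.comp_fst]
    simp only [dirDeriv_liftBase_fst _ hφ, dirDeriv_liftFiber_fst _ hφ, dirDeriv_const,
      dirDeriv_liftFiber_fst _ (hφ.dirDeriv hX), dirDeriv_zero_field, sub_zero]
  · rw [dirDeriv_bracket hX.liftBase hV.liftFiber hψ.comp_snd]
    simp only [dirDeriv_liftBase_snd _ hψ, dirDeriv_liftFiber_snd _ hψ, dirDeriv_const,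
      dirDeriv_liftBase_snd _ (hψ.dirDeriv hV), dirDeriv_zero_field, sub_zero]

theorem bracket_liftFiber_liftBase {X : VField I B} {V : VField J F} (hX : IsSmoothField X)
    (hV : IsSmoothField V) : bracket (liftFiber V) (liftBase X) = 0 := by
  funext p
  rw [bracket_swap, bracket_liftBase_liftFiber hX hV]
  simp

end Product

/-! ### The warped metric: pairings, Koszul forms and signature -/

section WarpedMetric

variable {E₁ : Type*} [NormedAddCommGroup E₁] [NormedSpace ℝ E₁] [FiniteDimensional ℝ E₁]
  {H₁ : Type*} [TopologicalSpace H₁] {I : ModelWithCorners ℝ E₁ H₁}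
  {B : Type*} [TopologicalSpace B] [ChartedSpace H₁ B] [IsManifold I ∞ B] [T2Space B]
  {E₂ : Type*} [NormedAddCommGroup E₂] [NormedSpace ℝ E₂] [FiniteDimensional ℝ E₂]
  {H₂ : Type*} [TopologicalSpace H₂] {J : ModelWithCorners ℝ E₂ H₂}
  {F : Type*} [TopologicalSpace F] [ChartedSpace H₂ F] [IsManifold J ∞ F] [T2Space F]
  {gB : BilinField I B} {gF : BilinField J F} {f : B → ℝ}

/-- The component in `T_b B` of a tangent vector of `B × F` at `(b, x)`. -/
def tangentFst (p : B × F) : TangentSpace (I.prod J) p →L[ℝ] TangentSpace I p.1 :=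
  ContinuousLinearMap.fst ℝ E₁ E₂

/-- The component in `T_x F` of a tangent vector of `B × F` at `(b, x)`. -/
def tangentSnd (p : B × F) : TangentSpace (I.prod J) p →L[ℝ] TangentSpace J p.2 :=
  ContinuousLinearMap.snd ℝ E₁ E₂

/-- The tangent vector of `B × F` with the given components. -/
def tangentMk (p : B × F) (u : TangentSpace I p.1) (v : TangentSpace J p.2) :
    TangentSpace (I.prod J) p :=
  ((u, v) : E₁ × E₂)

theorem tangentFst_mk (p : B × F) (u : TangentSpace I p.1) (v : TangentSpace J p.2) :
    tangentFst p (tangentMk p u v) = u := rfl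

theorem tangentSnd_mk (p : B × F) (u : TangentSpace I p.1) (v : TangentSpace J p.2) :
    tangentSnd p (tangentMk p u v) = v := rfl

theorem tangent_prod_ext {p : B × F} {u v : TangentSpace (I.prod J) p}
    (h₁ : tangentFst p u = tangentFst p v) (h₂ : tangentSnd p u = tangentSnd p v) : u = v :=
  Prod.ext h₁ h₂

/-- The tangent vectors of `B × F` with vanishing component in `T_b B`. -/
def tangentInr (p : B × F) : TangentSpace J p.2 →ₗ[ℝ] TangentSpace (I.prod J) p :=
  LinearMap.inr ℝ E₁ E₂

theorem tangentFst_inr (p : B × F) (v : TangentSpace J p.2) :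
    tangentFst p (tangentInr (I := I) p v) = 0 := rfl

theorem tangentSnd_inr (p : B × F) (v : TangentSpace J p.2) :
    tangentSnd p (tangentInr (I := I) p v) = v := rfl

theorem tangentInr_injective (p : B × F) : Function.Injective (tangentInr (I := I) (J := J) p) :=
  fun _ _ h => congrArg (tangentSnd (I := I) p) h

theorem tangentFst_liftBase (X : VField I B) (p : B × F) :
    tangentFst (J := J) p (liftBase X p) = X p.1 := rfl

theorem tangentSnd_liftBase (X : VField I B) (p : B × F) :
    tangentSnd (J := J) p (liftBase X p) = 0 := rfl

theorem tangentFst_liftFiber (V : VField J F) (p : B × F) :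
    tangentFst (I := I) p (liftFiber V p) = 0 := rfl

theorem tangentSnd_liftFiber (V : VField J F) (p : B × F) :
    tangentSnd (I := I) p (liftFiber V p) = V p.2 := rfl

theorem warpedMetric_apply (p : B × F) (u v : TangentSpace (I.prod J) p) :
    warpedMetric f gB gF p u v = gB p.1 (tangentFst p u) (tangentFst p v)
      + f p.1 ^ 2 * gF p.2 (tangentSnd p u) (tangentSnd p v) := by
  simp only [warpedMetric, pullbackForm]
  rw [mfderiv_fst, mfderiv_snd]
  rfl

theorem isSingularMetric_warpedMetric (hgB : IsSingularMetric gB) (hgF : IsSingularMetric gF)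
    (hf : IsSmoothFun I f) : IsSingularMetric (warpedMetric f gB gF) := by
  refine isSingularMetric_of_pairing (fun p u v => ?_) fun X Y hX hY => ?_
  · rw [warpedMetric_apply, warpedMetric_apply, hgB.symm p.1, hgF.symm p.2]
  · have h1 := ContMDiff.clm_bundle_apply₂ (F₁ := E₁) (F₂ := E₁) (F₃ := ℝ)
      (E₁ := TangentSpace I) (E₂ := TangentSpace I) (E₃ := fun _ : B => ℝ)
      (hgB.smooth.comp (contMDiff_fst (M := B) (N := F) (J := J))) hX.contMDiff_fst
      hY.contMDiff_fst
    have h2 := ContMDiff.clm_bundle_apply₂ (F₁ := E₂) (F₂ := E₂) (F₃ := ℝ)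
      (E₁ := TangentSpace J) (E₂ := TangentSpace J) (E₃ := fun _ : F => ℝ)
      (hgF.smooth.comp (contMDiff_snd (M := B) (N := F) (I := I))) hX.contMDiff_snd
      hY.contMDiff_snd
    have h3 : IsSmoothFun (I.prod J) fun p : B × F => gB p.1 (tangentFst p (X p)) (tangentFst p (Y p)) := by
      intro p
      have h4 := (Bundle.contMDiffAt_totalSpace.1 (h1 p)).2
      simp only [Bundle.Trivial.trivialization_apply,
        Bundle.Trivial.fiberBundle_trivializationAt'] at h4
      exact h4
    have h4 : IsSmoothFun (I.prod J) fun p : B × F => gF p.2 (tangentSnd p (X p)) (tangentSnd p (Y p)) := by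
      intro p
      have h4 := (Bundle.contMDiffAt_totalSpace.1 (h2 p)).2
      simp only [Bundle.Trivial.trivialization_apply,
        Bundle.Trivial.fiberBundle_trivializationAt'] at h4
      exact h4
    have h5 : pairing (warpedMetric f gB gF) X Y = fun p =>
        gB p.1 (tangentFst p (X p)) (tangentFst p (Y p)) + f p.1 ^ 2 * gF p.2 (tangentSnd p (X p)) (tangentSnd p (Y p)) :=
      funext fun p => warpedMetric_apply p _ _
    rw [h5]
    exact h3.add ((hf.comp_fst.pow 2).mul h4)

/-! ### Pairings of lifts -/

theorem pairing_base_base (X Y : VField I B) :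
    pairing (warpedMetric f gB gF) (liftBase X) (liftBase Y) = fun p => pairing gB X Y p.1 := by
  funext p
  rw [pairing, warpedMetric_apply]
  simp [tangentFst_liftBase, tangentSnd_liftBase, pairing]

theorem pairing_fiber_fiber (U V : VField J F) :
    pairing (warpedMetric f gB gF) (liftFiber U) (liftFiber V)
      = fun p => f p.1 ^ 2 * pairing gF U V p.2 := by
  funext p
  rw [pairing, warpedMetric_apply]
  simp [tangentFst_liftFiber, tangentSnd_liftFiber, pairing]

theorem pairing_base_fiber (X : VField I B) (V : VField J F) :
    pairing (warpedMetric f gB gF) (liftBase X) (liftFiber V) = fun _ => 0 := by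
  funext p
  rw [pairing, warpedMetric_apply]
  simp [tangentFst_liftFiber, tangentSnd_liftBase]

theorem pairing_fiber_base (X : VField I B) (V : VField J F) :
    pairing (warpedMetric f gB gF) (liftFiber V) (liftBase X) = fun _ => 0 := by
  funext p
  rw [pairing, warpedMetric_apply]
  simp [tangentFst_liftFiber, tangentSnd_liftBase]

theorem pairing_zero_right {E : Type*} [NormedAddCommGroup E] [NormedSpace ℝ E]
    {H : Type*} [TopologicalSpace H] {I : ModelWithCorners ℝ E H} {M : Type*}
    [TopologicalSpace M] [ChartedSpace H M] (g : BilinField I M) (X : VField I M) :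
    pairing g X 0 = fun _ => 0 := by
  funext p
  simp [pairing]

theorem dirDeriv_sq {E : Type*} [NormedAddCommGroup E] [NormedSpace ℝ E]
    {H : Type*} [TopologicalSpace H] {I : ModelWithCorners ℝ E H} {M : Type*}
    [TopologicalSpace M] [ChartedSpace H M] {φ : M → ℝ} (hφ : IsSmoothFun I φ)
    (X : VField I M) (p : M) :
    dirDeriv X (fun q => φ q ^ 2) p = 2 * φ p * dirDeriv X φ p := by
  simp only [pow_two]
  rw [dirDeriv_mul hφ hφ]
  ring

/-! ### The Koszul form on lifts -/

section Koszul

variable {P X Y Z : VField I B} {U V W : VField J F}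

theorem koszul_base_base_base (hgB : IsSingularMetric gB) (hX : IsSmoothField X)
    (hY : IsSmoothField Y) (hZ : IsSmoothField Z) :
    koszul (warpedMetric f gB gF) (liftBase X) (liftBase Y) (liftBase Z)
      = fun p => koszul gB X Y Z p.1 := by
  funext p
  simp only [koszul, pairing_base_base, bracket_liftBase_liftBase hX hY,
    bracket_liftBase_liftBase hY hZ, bracket_liftBase_liftBase hZ hX,
    dirDeriv_liftBase_fst _ (hgB.isSmoothFun_pairing hY hZ),
    dirDeriv_liftBase_fst _ (hgB.isSmoothFun_pairing hZ hX),
    dirDeriv_liftBase_fst _ (hgB.isSmoothFun_pairing hX hY)]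

theorem koszul_base_base_fiber (hgB : IsSingularMetric gB) (hX : IsSmoothField X)
    (hY : IsSmoothField Y) (hV : IsSmoothField V) :
    koszul (warpedMetric f gB gF) (liftBase X) (liftBase Y) (liftFiber V) = fun _ => 0 := by
  funext p
  simp [koszul, pairing_base_base, pairing_base_fiber, pairing_fiber_base, pairing_zero_right,
    bracket_liftBase_liftBase hX hY, bracket_liftBase_liftFiber hY hV,
    bracket_liftFiber_liftBase hX hV, dirDeriv_const,
    dirDeriv_liftFiber_fst _ (hgB.isSmoothFun_pairing hX hY)]

theorem koszul_base_fiber_base (hgB : IsSingularMetric gB) (hX : IsSmoothField X)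
    (hY : IsSmoothField Y) (hV : IsSmoothField V) :
    koszul (warpedMetric f gB gF) (liftBase X) (liftFiber V) (liftBase Y) = fun _ => 0 := by
  funext p
  simp [koszul, pairing_base_base, pairing_base_fiber, pairing_fiber_base, pairing_zero_right,
    bracket_liftBase_liftBase hY hX, bracket_liftFiber_liftBase hY hV,
    bracket_liftBase_liftFiber hX hV, dirDeriv_const,
    dirDeriv_liftFiber_fst _ (hgB.isSmoothFun_pairing hY hX)]

theorem koszul_fiber_base_base (hgB : IsSingularMetric gB) (hX : IsSmoothField X)
    (hY : IsSmoothField Y) (hV : IsSmoothField V) :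
    koszul (warpedMetric f gB gF) (liftFiber V) (liftBase X) (liftBase Y) = fun _ => 0 := by
  funext p
  simp [koszul, pairing_base_base, pairing_base_fiber, pairing_fiber_base, pairing_zero_right,
    bracket_liftBase_liftBase hX hY, bracket_liftFiber_liftBase hX hV,
    bracket_liftBase_liftFiber hY hV, dirDeriv_const,
    dirDeriv_liftFiber_fst _ (hgB.isSmoothFun_pairing hX hY)]

theorem koszul_base_fiber_fiber (hgF : IsSingularMetric gF) (hf : IsSmoothFun I f)
    (hX : IsSmoothField X) (hV : IsSmoothField V) (hW : IsSmoothField W) :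
    koszul (warpedMetric f gB gF) (liftBase X) (liftFiber V) (liftFiber W)
      = fun p => f p.1 * dirDeriv X f p.1 * pairing gF V W p.2 := by
  funext p
  simp [koszul, pairing_fiber_fiber, pairing_base_fiber, pairing_fiber_base, pairing_zero_right,
    bracket_liftFiber_liftFiber hV hW, bracket_liftFiber_liftBase hX hW,
    bracket_liftBase_liftFiber hX hV, dirDeriv_const,
    dirDeriv_liftBase_mul X (hf.pow 2) (hgF.isSmoothFun_pairing hV hW), dirDeriv_sq hf]
  ring

theorem koszul_fiber_base_fiber (hgF : IsSingularMetric gF) (hf : IsSmoothFun I f)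
    (hX : IsSmoothField X) (hV : IsSmoothField V) (hW : IsSmoothField W) :
    koszul (warpedMetric f gB gF) (liftFiber V) (liftBase X) (liftFiber W)
      = fun p => f p.1 * dirDeriv X f p.1 * pairing gF V W p.2 := by
  funext p
  rw [hgF.pairing_comm V W]
  simp [koszul, pairing_fiber_fiber, pairing_base_fiber, pairing_fiber_base, pairing_zero_right,
    bracket_liftFiber_liftFiber hW hV, bracket_liftFiber_liftBase hX hV,
    bracket_liftBase_liftFiber hX hW, dirDeriv_const,
    dirDeriv_liftBase_mul X (hf.pow 2) (hgF.isSmoothFun_pairing hW hV), dirDeriv_sq hf]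
  ring

theorem koszul_fiber_fiber_base (hgF : IsSingularMetric gF) (hf : IsSmoothFun I f)
    (hX : IsSmoothField X) (hV : IsSmoothField V) (hW : IsSmoothField W) :
    koszul (warpedMetric f gB gF) (liftFiber V) (liftFiber W) (liftBase X)
      = fun p => - (f p.1 * dirDeriv X f p.1 * pairing gF V W p.2) := by
  funext p
  simp [koszul, pairing_fiber_fiber, pairing_base_fiber, pairing_fiber_base, pairing_zero_right,
    bracket_liftFiber_liftFiber hV hW, bracket_liftFiber_liftBase hX hW,
    bracket_liftBase_liftFiber hX hV, dirDeriv_const,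
    dirDeriv_liftBase_mul X (hf.pow 2) (hgF.isSmoothFun_pairing hV hW), dirDeriv_sq hf]
  ring

theorem koszul_fiber_fiber_fiber (hgF : IsSingularMetric gF) (hf : IsSmoothFun I f)
    (hU : IsSmoothField U) (hV : IsSmoothField V) (hW : IsSmoothField W) :
    koszul (warpedMetric f gB gF) (liftFiber U) (liftFiber V) (liftFiber W)
      = fun p => f p.1 ^ 2 * koszul gF U V W p.2 := by
  funext p
  simp only [koszul, pairing_fiber_fiber, bracket_liftFiber_liftFiber hU hV,
    bracket_liftFiber_liftFiber hV hW, bracket_liftFiber_liftFiber hW hU,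
    dirDeriv_liftFiber_mul _ (hf.pow 2) (hgF.isSmoothFun_pairing hV hW),
    dirDeriv_liftFiber_mul _ (hf.pow 2) (hgF.isSmoothFun_pairing hW hU),
    dirDeriv_liftFiber_mul _ (hf.pow 2) (hgF.isSmoothFun_pairing hU hV)]
  ring

end Koszul

/-! ### The regions of constant signature of a warped product -/

/-- Where `f ≠ 0` the radical is `0 ⊕ rad g_F`: horizontal test vectors and non-degeneracy of `g_B`
kill the base component, vertical ones give the condition on the fibre component. -/
theorem nullityAt_warpedMetric (hgB : IsSingularMetric gB) (hB : IsNondegenerate gB)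
    (hgF : IsSingularMetric gF) (hf : IsSmoothFun I f) {p : B × F} (hp : f p.1 ≠ 0) :
    nullityAt (warpedMetric f gB gF) p = nullityAt gF p.2 := by
  have hW := isSingularMetric_warpedMetric hgB hgF hf
  have key : (quadAt (warpedMetric f gB gF) p).radical
      = (quadAt gF p.2).radical.map (tangentInr p) := by
    ext u
    rw [mem_radical_quadAt (hW.symm p), Submodule.mem_map]
    constructor
    · intro h
      refine ⟨tangentSnd p u, ?_, tangent_prod_ext (Eq.symm ?_) rfl⟩
      · rw [mem_radical_quadAt (hgF.symm p.2)]
        intro v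
        have := h (tangentMk p 0 v)
        rw [warpedMetric_apply, tangentFst_mk, tangentSnd_mk, map_zero, zero_add] at this
        exact (mul_eq_zero.1 this).resolve_left (pow_ne_zero 2 hp)
      · refine hB p.1 (tangentFst p u) fun v => ?_
        have := h (tangentMk p v 0)
        rwa [warpedMetric_apply, tangentFst_mk, tangentSnd_mk, map_zero, mul_zero,
          add_zero] at this
    · rintro ⟨w, hw, rfl⟩ v
      rw [warpedMetric_apply, tangentFst_inr, tangentSnd_inr, (mem_radical_quadAt (hgF.symm p.2)).1 hw]
      simp
  rw [nullityAt, key]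
  exact (Submodule.equivMapOfInjective _ (tangentInr_injective p) _).finrank_eq.symm

/-- Restriction to the slice `{b} × F`, on which `f` is a nonzero constant. -/
theorem mem_constSignature_fiber (hgB : IsSingularMetric gB) (hB : IsNondegenerate gB)
    (hgF : IsSingularMetric gF) (hf : IsSmoothFun I f) {p : B × F}
    (hp : p ∈ constSignature (warpedMetric f gB gF)) (h0 : f p.1 ≠ 0) :
    p.2 ∈ constSignature gF := by
  rw [mem_constSignature_iff (isSingularMetric_warpedMetric hgB hgF hf)] at hp
  rw [mem_constSignature_iff hgF]
  have hc : Filter.Tendsto (fun x : F => (p.1, x)) (𝓝 p.2) (𝓝 p) :=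
    (Continuous.prodMk_right p.1).tendsto p.2
  filter_upwards [hc.eventually hp] with x hx
  rwa [nullityAt_warpedMetric hgB hB hgF hf h0,
    nullityAt_warpedMetric hgB hB hgF hf (p := (p.1, x)) h0] at hx

/-- Over a zero of `f` the radical contains the whole fibre direction. If `f` were nonzero at base
points `b` arbitrarily close, the nullity at `(b, p.2)` would be that of `g_F` at `p.2`; constancy
then makes it full, so `g_F` vanishes there. This excludes the signature jumps at which the
contraction formula differs from the pointwise one. -/
theorem eventually_eq_zero_or_of_mem_constSignature (hgB : IsSingularMetric gB)
    (hB : IsNondegenerate gB) (hgF : IsSingularMetric gF) (hf : IsSmoothFun I f) {p : B × F}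
    (hp : p ∈ constSignature (warpedMetric f gB gF)) (h0 : f p.1 = 0) :
    (∀ᶠ b in 𝓝 p.1, f b = 0) ∨ ∀ u v : TangentSpace J p.2, gF p.2 u v = 0 := by
  have hW := isSingularMetric_warpedMetric hgB hgF hf
  rw [mem_constSignature_iff hW] at hp
  have hc : Filter.Tendsto (fun b : B => (b, p.2)) (𝓝 p.1) (𝓝 p) :=
    (Continuous.prodMk_left p.2).tendsto p.1
  have hfd := finiteDimensional_tangentSpace (I := J) p.2
  have hfd' := finiteDimensional_tangentSpace (I := I.prod J) p
  have h1 : Module.finrank ℝ E₂ ≤ nullityAt (warpedMetric f gB gF) p := by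
    have h2 : LinearMap.range (tangentInr p)
        ≤ (quadAt (warpedMetric f gB gF) p).radical := by
      rintro _ ⟨w, rfl⟩
      refine (mem_radical_quadAt (hW.symm p)).2 fun v => ?_
      rw [warpedMetric_apply, tangentFst_inr, h0]
      simp
    have h3 := Submodule.finrank_mono h2
    rw [LinearMap.finrank_range_of_inj (tangentInr_injective p)] at h3
    exact h3
  by_cases hg : ∀ u v : TangentSpace J p.2, gF p.2 u v = 0
  · exact Or.inr hg
  refine Or.inl ?_
  filter_upwards [hc.eventually hp] with b hb
  by_contra hne
  rw [nullityAt_warpedMetric hgB hB hgF hf (p := (b, p.2)) hne] at hb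
  apply hg
  have h4 : (quadAt gF p.2).radical = ⊤ := by
    apply Submodule.eq_top_of_finrank_eq
    apply le_antisymm (Submodule.finrank_le _)
    exact h1.trans hb.symm.le
  intro u v
  have : u ∈ (quadAt gF p.2).radical := h4 ▸ Submodule.mem_top
  exact (mem_radical_quadAt (hgF.symm p.2)).1 this v

end WarpedMetric

/-! ### The zero form and smooth contractions of Koszul forms -/

section ZeroForm

variable {E : Type*} [NormedAddCommGroup E] [NormedSpace ℝ E] [FiniteDimensional ℝ E]
  {H : Type*} [TopologicalSpace H] {I : ModelWithCorners ℝ E H}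
  {M : Type*} [TopologicalSpace M] [ChartedSpace H M] [IsManifold I ∞ M] [T2Space M]
  {g : BilinField I M} {α β : FieldFunctional I M} {p : M}

theorem isOneForm_zero : IsOneForm (0 : FieldFunctional I M) where
  smooth _ _ := isSmoothFun_const 0
  add _ _ _ _ := by funext p; simp
  smul _ _ _ _ := by funext p; simp

theorem isFlatAt_zero (g : BilinField I M) (p : M) : IsFlatAt g 0 p 0 :=
  fun _ _ => by simp

theorem coInner_zero_left (hg : IsSingularMetric g) (β : FieldFunctional I M) :
    coInner g 0 β = fun _ => 0 := by
  funext p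
  by_cases h : ∃ v, IsFlatAt g β p v
  · obtain ⟨v, hv⟩ := h
    rw [coInner_eq (hg.symm p) (isFlatAt_zero g p) hv]
    simp
  · rw [coInner, dif_neg fun h' => h h'.2]

theorem coInner_zero_right (hg : IsSingularMetric g) (β : FieldFunctional I M) :
    coInner g β 0 = fun _ => 0 := by
  funext p
  by_cases h : ∃ v, IsFlatAt g β p v
  · obtain ⟨v, hv⟩ := h
    rw [coInner_eq (hg.symm p) hv (isFlatAt_zero g p)]
    simp
  · rw [coInner, dif_neg fun h' => h h'.1]

theorem contraction_zero_left (hg : IsSingularMetric g) (β : FieldFunctional I M) :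
    contraction g 0 β = fun _ => 0 :=
  funext fun p => contraction_eq (h := fun _ => 0) hg continuousAt_const
    (Filter.Eventually.of_forall fun q _ => by rw [coInner_zero_left hg])

theorem contraction_zero_right (hg : IsSingularMetric g) (β : FieldFunctional I M) :
    contraction g β 0 = fun _ => 0 :=
  funext fun p => contraction_eq (h := fun _ => 0) hg continuousAt_const
    (Filter.Eventually.of_forall fun q _ => by rw [coInner_zero_right hg])

theorem ssKoszul_zero_left (hg : IsSingularMetric g) (P : VField I M) {Y Z : VField I M}
    (hY : IsSmoothField Y) (hZ : IsSmoothField Z) (p : M) : ssKoszul g P 0 Y Z p = 0 := by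
  have h := koszul_smul_left hg (isSmoothFun_const 0) isSmoothField_zero hY hZ p
  simp only [zero_smul, zero_mul] at h
  have h' : koszul g 0 Y Z p = 0 := h
  simp [ssKoszul, h', pairing]

/-- The definition of `∇_X` is solved for the contraction: it is the difference of `X(𝒦(Z, T, Y))`
and `(∇_X ∇^♭_Z T)(Y)`, both smooth. -/
theorem IsSemiRegular.isSmoothFun_contraction (hg : IsSemiRegular g) {X Y Z T : VField I M}
    (hX : IsSmoothField X) (hY : IsSmoothField Y) (hZ : IsSmoothField Z)
    (hT : IsSmoothField T) : IsSmoothFun I (contraction g (koszul g X Y) (koszul g Z T)) := by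
  have h1 := (hg.cov_mem Z T X hZ hT hX).isOneForm.smooth Y hY
  have h2 := (IsSmoothFun.koszul hg.isSingularMetric hZ hT hY).dirDeriv hX
  have h3 : contraction g (koszul g X Y) (koszul g Z T)
      = fun p => dirDeriv X (koszul g Z T Y) p - cov g X (lowerCov g Z T) Y p := by
    funext p
    simp only [cov, lowerCov]
    ring
  rw [h3]
  exact h2.sub h1

/-- The one-forms `0` and `∇^♭_X Y`. -/
def IsKoszulForm (g : BilinField I M) (κ : FieldFunctional I M) : Prop :=
  κ = 0 ∨ ∃ X Y, IsSmoothField X ∧ IsSmoothField Y ∧ κ = koszul g X Y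

theorem IsKoszulForm.isRadicalAnnihilator (hg : IsSemiRegular g) {κ : FieldFunctional I M}
    (hκ : IsKoszulForm g κ) : IsRadicalAnnihilator g κ := by
  obtain rfl | ⟨X, Y, hX, hY, rfl⟩ := hκ
  · exact ⟨isOneForm_zero, fun p => ⟨0, isFlatAt_zero g p⟩⟩
  · exact hg.lowerCov_mem X Y hX hY

theorem IsKoszulForm.isSmoothFun_contraction (hg : IsSemiRegular g) {κ κ' : FieldFunctional I M}
    (hκ : IsKoszulForm g κ) (hκ' : IsKoszulForm g κ') : IsSmoothFun I (contraction g κ κ') := by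
  obtain rfl | ⟨X, Y, hX, hY, rfl⟩ := hκ
  · rw [contraction_zero_left hg.isSingularMetric]
    exact isSmoothFun_const 0
  obtain rfl | ⟨Z, T, hZ, hT, rfl⟩ := hκ'
  · rw [contraction_zero_right hg.isSingularMetric]
    exact isSmoothFun_const 0
  exact hg.isSmoothFun_contraction hX hY hZ hT

end ZeroForm

/-! ### Split forms and their contraction -/

section SplitForm

variable {E₁ : Type*} [NormedAddCommGroup E₁] [NormedSpace ℝ E₁] [FiniteDimensional ℝ E₁]
  {H₁ : Type*} [TopologicalSpace H₁] {I : ModelWithCorners ℝ E₁ H₁}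
  {B : Type*} [TopologicalSpace B] [ChartedSpace H₁ B] [IsManifold I ∞ B] [T2Space B]
  {E₂ : Type*} [NormedAddCommGroup E₂] [NormedSpace ℝ E₂] [FiniteDimensional ℝ E₂]
  {H₂ : Type*} [TopologicalSpace H₂] {J : ModelWithCorners ℝ E₂ H₂}
  {F : Type*} [TopologicalSpace F] [ChartedSpace H₂ F] [IsManifold J ∞ F] [T2Space F]
  {gB : BilinField I B} {gF : BilinField J F} {f : B → ℝ}

/-- The data of a warped product with non-degenerate base and semi-regular fibre. -/
structure IsWarpedData (gB : BilinField I B) (gF : BilinField J F) (f : B → ℝ) : Prop where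
  base : IsSingularMetric gB
  nondegenerate : IsNondegenerate gB
  fiber : IsSemiRegular gF
  smooth : IsSmoothFun I f

theorem IsWarpedData.fiberMetric (h : IsWarpedData gB gF f) : IsSingularMetric gF :=
  h.fiber.isSingularMetric

theorem IsWarpedData.metric (h : IsWarpedData gB gF f) :
    IsSingularMetric (warpedMetric f gB gF) :=
  isSingularMetric_warpedMetric h.base h.fiberMetric h.smooth

theorem isFlatAt_warpedMetric {α : FieldFunctional (I.prod J) (B × F)} (hα : IsOneForm α)
    {p : B × F} {u : TangentSpace I p.1} {v : TangentSpace J p.2}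
    (hu : ∀ X : VField I B, IsSmoothField X → α (liftBase X) p = gB p.1 u (X p.1))
    (hv : ∀ V : VField J F, IsSmoothField V → α (liftFiber V) p = f p.1 ^ 2 * gF p.2 v (V p.2)) :
    IsFlatAt (warpedMetric f gB gF) α p (tangentMk p u v) := by
  intro Z hZ
  obtain ⟨X, hX, hXp⟩ := exists_smoothField_apply_eq (I := I) p.1 (tangentFst p (Z p))
  obtain ⟨V, hV, hVp⟩ := exists_smoothField_apply_eq (I := J) p.2 (tangentSnd p (Z p))
  have h : Z p = liftBase X p + liftFiber V p := by
    refine tangent_prod_ext ?_ ?_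
    · rw [map_add, tangentFst_liftBase, tangentFst_liftFiber, hXp, add_zero]
    · rw [map_add, tangentSnd_liftBase, tangentSnd_liftFiber, hVp, zero_add]
  rw [hα.eq_of_apply_eq hZ (hX.liftBase.add hV.liftFiber) h,
    congrFun (hα.add _ _ hX.liftBase hV.liftFiber) p, hu X hX, hv V hV, warpedMetric_apply, hXp, hVp,
    tangentFst_mk, tangentSnd_mk]

/-- One-forms on `B ×_f F` with horizontal part `a η` and vertical part
`f e V^♭ + f² κ`, where `a` lives on `F` and `e` on `B`. -/
structure IsSplitForm (f : B → ℝ) (gF : BilinField J F) (α : FieldFunctional (I.prod J) (B × F))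
    (a : F → ℝ) (η : FieldFunctional I B) (e : B → ℝ) (V : VField J F)
    (κ : FieldFunctional J F) : Prop where
  isOneForm : IsOneForm α
  coeff : IsSmoothFun J a
  horizontal : IsOneForm η
  factor : IsSmoothFun I e
  factor_eq_zero : ∀ b, (∀ᶠ b' in 𝓝 b, f b' = 0) → e b = 0
  field : IsSmoothField V
  koszulForm : IsKoszulForm gF κ
  base_apply : ∀ X, IsSmoothField X → α (liftBase X) = fun p => a p.2 * η X p.1
  fiber_apply : ∀ W, IsSmoothField W → α (liftFiber W) = fun p =>
    f p.1 * e p.1 * pairing gF V W p.2 + f p.1 ^ 2 * κ W p.2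

variable {α α' : FieldFunctional (I.prod J) (B × F)} {a a' : F → ℝ} {η η' : FieldFunctional I B}
  {e e' : B → ℝ} {V V' : VField J F} {κ κ' : FieldFunctional J F}

/-- The fibre component of the representative is `(e/f) V + v`. At a zero of `f` the quotient is `0`
by convention, which is harmless: the vertical part of the form vanishes there and the metric has no
vertical part. -/
theorem IsSplitForm.isFlatAt (hα : IsSplitForm f gF α a η e V κ) {p : B × F}
    {u : TangentSpace I p.1} {v : TangentSpace J p.2} (hu : IsFlatAt gB η p.1 u)
    (hv : IsFlatAt gF κ p.2 v) :
    IsFlatAt (warpedMetric f gB gF) α p (tangentMk p (a p.2 • u) ((e p.1 / f p.1) • V p.2 + v)) := by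
  refine isFlatAt_warpedMetric hα.isOneForm (fun X hX => ?_) fun W hW => ?_
  · rw [congrFun (hα.base_apply X hX) p, map_smul, hu X hX]
    rfl
  · rw [congrFun (hα.fiber_apply W hW) p, map_add, map_smul, hv W hW]
    simp only [pairing, add_apply, smul_apply, smul_eq_mul]
    by_cases h0 : f p.1 = 0
    · simp [h0]
    · field_simp

theorem IsSplitForm.exists_isFlatAt (h : IsWarpedData gB gF f)
    (hα : IsSplitForm f gF α a η e V κ) (p : B × F) :
    ∃ u, IsFlatAt (warpedMetric f gB gF) α p u := by
  obtain ⟨u, hu⟩ := h.nondegenerate.exists_isFlatAt h.base hα.horizontal p.1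
  obtain ⟨v, hv⟩ := (hα.koszulForm.isRadicalAnnihilator h.fiber).mem p.2
  exact ⟨_, hα.isFlatAt hu hv⟩

/-- The contraction of two split forms. -/
def splitContraction (f : B → ℝ) (gB : BilinField I B) (gF : BilinField J F) (a a' : F → ℝ)
    (η η' : FieldFunctional I B) (e e' : B → ℝ) (V V' : VField J F)
    (κ κ' : FieldFunctional J F) : B × F → ℝ := fun p =>
  a p.2 * a' p.2 * coInner gB η η' p.1 + e p.1 * e' p.1 * pairing gF V V' p.2
    + f p.1 * e p.1 * κ' V p.2 + f p.1 * e' p.1 * κ V' p.2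
    + f p.1 ^ 2 * contraction gF κ κ' p.2

theorem IsSplitForm.isSmoothFun_splitContraction (h : IsWarpedData gB gF f)
    (hα : IsSplitForm f gF α a η e V κ) (hα' : IsSplitForm f gF α' a' η' e' V' κ') :
    IsSmoothFun (I.prod J) (splitContraction f gB gF a a' η η' e e' V V' κ κ') := by
  have h1 := h.nondegenerate.isSmoothFun_coInner h.base hα.horizontal hα'.horizontal
  have h2 := h.fiberMetric.isSmoothFun_pairing hα.field hα'.field
  have h3 := (hα'.koszulForm.isRadicalAnnihilator h.fiber).isOneForm.smooth V hα.field
  have h4 := (hα.koszulForm.isRadicalAnnihilator h.fiber).isOneForm.smooth V' hα'.field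
  have h5 := hα.koszulForm.isSmoothFun_contraction h.fiber hα'.koszulForm
  have hf := h.smooth
  exact ((((((hα.coeff.mul hα'.coeff).comp_snd).mul h1.comp_fst).add
    ((hα.factor.mul hα'.factor).comp_fst.mul h2.comp_snd)).add
    ((hf.mul hα.factor).comp_fst.mul h3.comp_snd)).add
    ((hf.mul hα'.factor).comp_fst.mul h4.comp_snd)).add ((hf.pow 2).comp_fst.mul h5.comp_snd)

/-- Restricting to constant signature is essential: at an isolated zero of `f`, for example, the
pointwise inner product lacks the term `e e' g_F(V, V')` that the limit has. -/
theorem IsSplitForm.coInner_eq (h : IsWarpedData gB gF f) (hα : IsSplitForm f gF α a η e V κ)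
    (hα' : IsSplitForm f gF α' a' η' e' V' κ') {p : B × F}
    (hp : p ∈ constSignature (warpedMetric f gB gF)) :
    coInner (warpedMetric f gB gF) α α' p
      = splitContraction f gB gF a a' η η' e e' V V' κ κ' p := by
  have hκ := hα.koszulForm.isRadicalAnnihilator h.fiber
  have hκ' := hα'.koszulForm.isRadicalAnnihilator h.fiber
  obtain ⟨u, hu⟩ := h.nondegenerate.exists_isFlatAt h.base hα.horizontal p.1
  obtain ⟨u', hu'⟩ := h.nondegenerate.exists_isFlatAt h.base hα'.horizontal p.1
  obtain ⟨v, hv⟩ := hκ.mem p.2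
  obtain ⟨v', hv'⟩ := hκ'.mem p.2
  rw [SingularGeometry.coInner_eq (h.metric.symm p) (hα.isFlatAt hu hv) (hα'.isFlatAt hu' hv'),
    warpedMetric_apply, tangentFst_mk, tangentFst_mk, tangentSnd_mk, tangentSnd_mk,
    splitContraction, SingularGeometry.coInner_eq (h.base.symm p.1) hu hu']
  by_cases h0 : f p.1 = 0
  · have h1 : e p.1 * e' p.1 * pairing gF V V' p.2 = 0 := by
      obtain hz | hz := eventually_eq_zero_or_of_mem_constSignature h.base h.nondegenerate
        h.fiberMetric h.smooth hp h0
      · rw [hα.factor_eq_zero _ hz]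
        ring
      · rw [pairing, hz, mul_zero]
    rw [h1]
    simp [h0]
    ring
  -- Away from the zeros of `f` the fibre point is itself of constant signature, so the extended
  -- contraction on `F` is the pointwise one.
  · have h1 := contraction_eq_coInner h.fiberMetric
      (mem_constSignature_fiber h.base h.nondegenerate h.fiberMetric h.smooth hp h0)
      hκ.isOneForm hκ'.isOneForm hκ.mem hκ'.mem
    rw [h1, SingularGeometry.coInner_eq (h.fiberMetric.symm p.2) hv hv', hv _ hα'.field,
      hv' _ hα.field, h.fiberMetric.symm p.2 v']
    simp only [map_add, map_smul, add_apply, smul_apply, smul_eq_mul, pairing]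
    field_simp
    ring

theorem IsSplitForm.contraction_eq (h : IsWarpedData gB gF f)
    (hα : IsSplitForm f gF α a η e V κ) (hα' : IsSplitForm f gF α' a' η' e' V' κ') :
    contraction (warpedMetric f gB gF) α α'
      = splitContraction f gB gF a a' η η' e e' V V' κ κ' :=
  funext fun _ => SingularGeometry.contraction_eq h.metric
    (hα.isSmoothFun_splitContraction h hα').continuous.continuousAt
    (Filter.Eventually.of_forall fun _ hq => hα.coInner_eq h hα' hq)

/-! ### The forms `∇̄^♭` of lifts -/

section Lift

variable {P X Y Z : VField I B} {U V W : VField J F}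

theorem ssKoszul_base_base_base (hgB : IsSingularMetric gB) (hX : IsSmoothField X)
    (hY : IsSmoothField Y) (hZ : IsSmoothField Z) :
    ssKoszul (warpedMetric f gB gF) (liftBase P) (liftBase X) (liftBase Y) (liftBase Z)
      = fun p => ssKoszul gB P X Y Z p.1 := by
  funext p
  simp only [ssKoszul, koszul_base_base_base hgB hX hY hZ, pairing_base_base]

theorem ssKoszul_base_base_fiber (hgB : IsSingularMetric gB) (hX : IsSmoothField X)
    (hY : IsSmoothField Y) (hV : IsSmoothField V) :
    ssKoszul (warpedMetric f gB gF) (liftBase P) (liftBase X) (liftBase Y) (liftFiber V)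
      = fun _ => 0 := by
  funext p
  simp [ssKoszul, koszul_base_base_fiber hgB hX hY hV, pairing_base_fiber]

theorem ssKoszul_base_fiber_base (hgB : IsSingularMetric gB) (hX : IsSmoothField X)
    (hY : IsSmoothField Y) (hV : IsSmoothField V) :
    ssKoszul (warpedMetric f gB gF) (liftBase P) (liftBase X) (liftFiber V) (liftBase Y)
      = fun _ => 0 := by
  funext p
  simp [ssKoszul, koszul_base_fiber_base hgB hX hY hV, pairing_base_fiber, pairing_fiber_base]

theorem ssKoszul_fiber_base_base (hgB : IsSingularMetric gB) (hX : IsSmoothField X)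
    (hY : IsSmoothField Y) (hV : IsSmoothField V) :
    ssKoszul (warpedMetric f gB gF) (liftBase P) (liftFiber V) (liftBase X) (liftBase Y)
      = fun _ => 0 := by
  funext p
  simp [ssKoszul, koszul_fiber_base_base hgB hX hY hV, pairing_fiber_base]

theorem ssKoszul_base_fiber_fiber (hgF : IsSingularMetric gF) (hf : IsSmoothFun I f)
    (hX : IsSmoothField X) (hV : IsSmoothField V) (hW : IsSmoothField W) :
    ssKoszul (warpedMetric f gB gF) (liftBase P) (liftBase X) (liftFiber V) (liftFiber W)
      = fun p => f p.1 * dirDeriv X f p.1 * pairing gF V W p.2 := by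
  funext p
  simp [ssKoszul, koszul_base_fiber_fiber hgF hf hX hV hW, pairing_base_fiber]

theorem ssKoszul_fiber_base_fiber (hgF : IsSingularMetric gF) (hf : IsSmoothFun I f)
    (hX : IsSmoothField X) (hV : IsSmoothField V) (hW : IsSmoothField W) :
    ssKoszul (warpedMetric f gB gF) (liftBase P) (liftFiber V) (liftBase X) (liftFiber W)
      = fun p => f p.1 * (dirDeriv X f p.1 + f p.1 * pairing gB X P p.1) * pairing gF V W p.2 := by
  funext p
  simp only [ssKoszul, koszul_fiber_base_fiber hgF hf hX hV hW, pairing_base_fiber,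
    pairing_base_base, pairing_fiber_fiber]
  ring

theorem ssKoszul_fiber_fiber_base (hgF : IsSingularMetric gF) (hf : IsSmoothFun I f)
    (hX : IsSmoothField X) (hV : IsSmoothField V) (hW : IsSmoothField W) :
    ssKoszul (warpedMetric f gB gF) (liftBase P) (liftFiber V) (liftFiber W) (liftBase X)
      = fun p => - pairing gF V W p.2
        * (f p.1 * dirDeriv X f p.1 + f p.1 ^ 2 * pairing gB P X p.1) := by
  funext p
  simp only [ssKoszul, koszul_fiber_fiber_base hgF hf hX hV hW, pairing_fiber_base,
    pairing_base_base, pairing_fiber_fiber]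
  ring

theorem ssKoszul_fiber_fiber_fiber (hgF : IsSingularMetric gF) (hf : IsSmoothFun I f)
    (hU : IsSmoothField U) (hV : IsSmoothField V) (hW : IsSmoothField W) :
    ssKoszul (warpedMetric f gB gF) (liftBase P) (liftFiber U) (liftFiber V) (liftFiber W)
      = fun p => f p.1 ^ 2 * koszul gF U V W p.2 := by
  funext p
  simp [ssKoszul, koszul_fiber_fiber_fiber hgF hf hU hV hW, pairing_base_fiber,
    pairing_fiber_base]

theorem dirDeriv_eq_zero_of_eventually (X : VField I B) {b : B} (h : ∀ᶠ b' in 𝓝 b, f b' = 0) :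
    dirDeriv X f b = 0 := by
  rw [dirDeriv_congr (ψ := fun _ => 0) h rfl, dirDeriv_const]

/-- The one-form `f df + f² P^♭`. -/
def warpForm (f : B → ℝ) (gB : BilinField I B) (P : VField I B) : FieldFunctional I B :=
  fun X b => f b * differential f X b + f b ^ 2 * pairing gB P X b

theorem isSplitForm_base_base (h : IsWarpedData gB gF f) (hP : IsSmoothField P)
    (hX : IsSmoothField X) (hY : IsSmoothField Y) :
    IsSplitForm f gF (ssKoszul (warpedMetric f gB gF) (liftBase P) (liftBase X) (liftBase Y))
      (fun _ => 1) (ssKoszul gB P X Y) (fun _ => 0) 0 0 where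
  isOneForm := isOneForm_ssKoszul h.metric hP.liftBase hX.liftBase hY.liftBase
  coeff := isSmoothFun_const 1
  horizontal := isOneForm_ssKoszul h.base hP hX hY
  factor := isSmoothFun_const 0
  factor_eq_zero _ _ := rfl
  field := isSmoothField_zero
  koszulForm := Or.inl rfl
  base_apply Z hZ := by
    rw [ssKoszul_base_base_base h.base hX hY hZ]
    simp
  fiber_apply W hW := by
    rw [ssKoszul_base_base_fiber h.base hX hY hW]
    simp

theorem isSplitForm_base_fiber (h : IsWarpedData gB gF f) (hP : IsSmoothField P)
    (hX : IsSmoothField X) (hV : IsSmoothField V) :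
    IsSplitForm f gF (ssKoszul (warpedMetric f gB gF) (liftBase P) (liftBase X) (liftFiber V))
      (fun _ => 0) 0 (dirDeriv X f) V 0 where
  isOneForm := isOneForm_ssKoszul h.metric hP.liftBase hX.liftBase hV.liftFiber
  coeff := isSmoothFun_const 0
  horizontal := isOneForm_zero
  factor := h.smooth.dirDeriv hX
  factor_eq_zero _ hb := dirDeriv_eq_zero_of_eventually X hb
  field := hV
  koszulForm := Or.inl rfl
  base_apply Z hZ := by
    rw [ssKoszul_base_fiber_base h.base hX hZ hV]
    simp
  fiber_apply W hW := by
    rw [ssKoszul_base_fiber_fiber h.fiberMetric h.smooth hX hV hW]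
    simp

theorem isSplitForm_fiber_base (h : IsWarpedData gB gF f) (hP : IsSmoothField P)
    (hX : IsSmoothField X) (hV : IsSmoothField V) :
    IsSplitForm f gF (ssKoszul (warpedMetric f gB gF) (liftBase P) (liftFiber V) (liftBase X))
      (fun _ => 0) 0 (fun b => dirDeriv X f b + f b * pairing gB X P b) V 0 where
  isOneForm := isOneForm_ssKoszul h.metric hP.liftBase hV.liftFiber hX.liftBase
  coeff := isSmoothFun_const 0
  horizontal := isOneForm_zero
  factor := (h.smooth.dirDeriv hX).add (h.smooth.mul (h.base.isSmoothFun_pairing hX hP))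
  -- Both summands depend on the germ of `f` only through its value and first derivative.
  factor_eq_zero _ hb := by
    rw [dirDeriv_eq_zero_of_eventually X hb, hb.self_of_nhds]
    simp
  field := hV
  koszulForm := Or.inl rfl
  base_apply Z hZ := by
    rw [ssKoszul_fiber_base_base h.base hX hZ hV]
    simp
  fiber_apply W hW := by
    rw [ssKoszul_fiber_base_fiber h.fiberMetric h.smooth hX hV hW]
    simp

theorem isSplitForm_fiber_fiber (h : IsWarpedData gB gF f) (hP : IsSmoothField P)
    (hU : IsSmoothField U) (hV : IsSmoothField V) :
    IsSplitForm f gF (ssKoszul (warpedMetric f gB gF) (liftBase P) (liftFiber U) (liftFiber V))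
      (fun x => - pairing gF U V x) (warpForm f gB P) (fun _ => 0) 0 (koszul gF U V) where
  isOneForm := isOneForm_ssKoszul h.metric hP.liftBase hU.liftFiber hV.liftFiber
  coeff := (h.fiberMetric.isSmoothFun_pairing hU hV).neg
  horizontal := (isOneForm_differential h.smooth).comb (isOneForm_pairing h.base hP) h.smooth
    (h.smooth.pow 2)
  factor := isSmoothFun_const 0
  factor_eq_zero _ _ := rfl
  field := isSmoothField_zero
  koszulForm := Or.inr ⟨U, V, hU, hV, rfl⟩
  base_apply Z hZ := by
    rw [ssKoszul_fiber_fiber_base h.fiberMetric h.smooth hZ hU hV]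
    rfl
  fiber_apply W hW := by
    rw [ssKoszul_fiber_fiber_fiber h.fiberMetric h.smooth hU hV hW]
    simp

end Lift

end SplitForm

/-! ### Contractions with the warping form and covariant derivatives on lifts -/

section WarpedCov

variable {E₁ : Type*} [NormedAddCommGroup E₁] [NormedSpace ℝ E₁] [FiniteDimensional ℝ E₁]
  {H₁ : Type*} [TopologicalSpace H₁] {I : ModelWithCorners ℝ E₁ H₁}
  {B : Type*} [TopologicalSpace B] [ChartedSpace H₁ B] [IsManifold I ∞ B] [T2Space B]
  {E₂ : Type*} [NormedAddCommGroup E₂] [NormedSpace ℝ E₂] [FiniteDimensional ℝ E₂]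
  {H₂ : Type*} [TopologicalSpace H₂] {J : ModelWithCorners ℝ E₂ H₂}
  {F : Type*} [TopologicalSpace F] [ChartedSpace H₂ F] [IsManifold J ∞ F] [T2Space F]
  {gB : BilinField I B} {gF : BilinField J F} {f : B → ℝ}
  {P X Y Z T : VField I B} {U V W Q : VField J F}

theorem isOneForm_warpForm (hgB : IsSingularMetric gB) (hf : IsSmoothFun I f)
    (hP : IsSmoothField P) : IsOneForm (warpForm f gB P) :=
  (isOneForm_differential hf).comb (isOneForm_pairing hgB hP) hf (hf.pow 2)

/-- Contracting a one-form with `P^♭` evaluates it at `P`, so only the contraction with `df` remains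
unevaluated. -/
theorem coInner_warpForm_left (hgB : IsSingularMetric gB) (hB : IsNondegenerate gB)
    (hf : IsSmoothFun I f) (hP : IsSmoothField P) {η : FieldFunctional I B} (hη : IsOneForm η)
    (b : B) :
    coInner gB (warpForm f gB P) η b
      = f b * coInner gB (differential f) η b + f b ^ 2 * η P b := by
  have h1 := hB.exists_isFlatAt hgB hη b
  have h2 := hB.exists_isFlatAt hgB (isOneForm_differential hf) b
  rw [← coInner_pairing_left (hgB.symm b) hP h1]
  exact coInner_comb_left (hgB.symm b) h2 ⟨_, isFlatAt_pairing P b⟩ h1 f fun b => f b ^ 2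

theorem coInner_warpForm_right (hgB : IsSingularMetric gB) (hB : IsNondegenerate gB)
    (hf : IsSmoothFun I f) (hP : IsSmoothField P) {η : FieldFunctional I B} (hη : IsOneForm η)
    (b : B) :
    coInner gB η (warpForm f gB P) b
      = f b * coInner gB η (differential f) b + f b ^ 2 * η P b := by
  have h1 := hB.exists_isFlatAt hgB hη b
  rw [coInner_comm (hgB.symm b) h1
    (hB.exists_isFlatAt hgB (isOneForm_warpForm hgB hf hP) b), coInner_warpForm_left hgB hB hf hP hη,
    coInner_comm (hgB.symm b) h1 (hB.exists_isFlatAt hgB (isOneForm_differential hf) b)]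

theorem coInner_warpForm_warpForm (hgB : IsSingularMetric gB) (hB : IsNondegenerate gB)
    (hf : IsSmoothFun I f) (hP : IsSmoothField P) (b : B) :
    coInner gB (warpForm f gB P) (warpForm f gB P) b
      = f b ^ 2 * coInner gB (differential f) (differential f) b + 2 * f b ^ 3 * dirDeriv P f b
        + f b ^ 4 * pairing gB P P b := by
  rw [coInner_warpForm_left hgB hB hf hP (isOneForm_warpForm hgB hf hP),
    coInner_warpForm_right hgB hB hf hP (isOneForm_differential hf)]
  simp only [warpForm, differential]
  ring

/-! ### Covariant derivatives of the forms `∇̄^♭` of lifts -/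

theorem ssCov_base_base_base_base (h : IsWarpedData gB gF f) (hP : IsSmoothField P)
    (hX : IsSmoothField X) (hY : IsSmoothField Y) (hZ : IsSmoothField Z)
    (hT : IsSmoothField T) (p : B × F) :
    ssCov (warpedMetric f gB gF) (liftBase P) (liftBase Z)
        (ssKoszul (warpedMetric f gB gF) (liftBase P) (liftBase X) (liftBase Y)) (liftBase T) p
      = ssCov gB P Z (ssKoszul gB P X Y) T p.1 := by
  simp only [ssCov, ssLowerCov]
  rw [(isSplitForm_base_base h hP hZ hT).contraction_eq h (isSplitForm_base_base h hP hX hY),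
    ssKoszul_base_base_base h.base hX hY hT,
    dirDeriv_liftBase_fst Z ((isOneForm_ssKoszul h.base hP hX hY).smooth T hT),
    h.nondegenerate.contraction_eq_coInner h.base (isOneForm_ssKoszul h.base hP hZ hT)
      (isOneForm_ssKoszul h.base hP hX hY)]
  simp [splitContraction, contraction_zero_left h.fiberMetric]

theorem ssCov_base_fiber_base_base (h : IsWarpedData gB gF f) (hP : IsSmoothField P)
    (hX : IsSmoothField X) (hW : IsSmoothField W) (hZ : IsSmoothField Z)
    (hT : IsSmoothField T) (p : B × F) :
    ssCov (warpedMetric f gB gF) (liftBase P) (liftBase Z)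
        (ssKoszul (warpedMetric f gB gF) (liftBase P) (liftFiber W) (liftBase X)) (liftBase T) p
      = 0 := by
  simp only [ssCov, ssLowerCov]
  rw [(isSplitForm_base_base h hP hZ hT).contraction_eq h (isSplitForm_fiber_base h hP hX hW),
    ssKoszul_fiber_base_base h.base hX hT hW, dirDeriv_const]
  simp [splitContraction, contraction_zero_left h.fiberMetric]

theorem ssCov_base_fiber_fiber_base (h : IsWarpedData gB gF f) (hP : IsSmoothField P)
    (hU : IsSmoothField U) (hW : IsSmoothField W) (hZ : IsSmoothField Z)
    (hT : IsSmoothField T) (p : B × F) :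
    ssCov (warpedMetric f gB gF) (liftBase P) (liftBase Z)
        (ssKoszul (warpedMetric f gB gF) (liftBase P) (liftFiber U) (liftFiber W)) (liftBase T) p
      = - pairing gF U W p.2 * ssCov gB P Z (warpForm f gB P) T p.1 := by
  have hw := isOneForm_warpForm h.base h.smooth hP
  simp only [ssCov, ssLowerCov]
  rw [(isSplitForm_base_base h hP hZ hT).contraction_eq h (isSplitForm_fiber_fiber h hP hU hW),
    (isSplitForm_fiber_fiber h hP hU hW).base_apply T hT,
    dirDeriv_mul (h.fiberMetric.isSmoothFun_pairing hU hW).neg.comp_snd (hw.smooth T hT).comp_fst,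
    dirDeriv_liftBase_snd Z (h.fiberMetric.isSmoothFun_pairing hU hW).neg,
    dirDeriv_liftBase_fst Z (hw.smooth T hT),
    h.nondegenerate.contraction_eq_coInner h.base (isOneForm_ssKoszul h.base hP hZ hT) hw]
  simp [splitContraction, contraction_zero_left h.fiberMetric]
  ring

theorem ssCov_fiber_base_base_base (h : IsWarpedData gB gF f) (hP : IsSmoothField P)
    (hX : IsSmoothField X) (hY : IsSmoothField Y) (hV : IsSmoothField V)
    (hT : IsSmoothField T) (p : B × F) :
    ssCov (warpedMetric f gB gF) (liftBase P) (liftFiber V)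
        (ssKoszul (warpedMetric f gB gF) (liftBase P) (liftBase X) (liftBase Y)) (liftBase T) p
      = 0 := by
  simp only [ssCov, ssLowerCov]
  rw [(isSplitForm_fiber_base h hP hT hV).contraction_eq h (isSplitForm_base_base h hP hX hY),
    ssKoszul_base_base_base h.base hX hY hT,
    dirDeriv_liftFiber_fst V ((isOneForm_ssKoszul h.base hP hX hY).smooth T hT)]
  simp [splitContraction, contraction_zero_left h.fiberMetric]

theorem ssCov_fiber_base_fiber_base (h : IsWarpedData gB gF f) (hP : IsSmoothField P)
    (hX : IsSmoothField X) (hW : IsSmoothField W) (hV : IsSmoothField V)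
    (hT : IsSmoothField T) (p : B × F) :
    ssCov (warpedMetric f gB gF) (liftBase P) (liftFiber V)
        (ssKoszul (warpedMetric f gB gF) (liftBase P) (liftBase X) (liftFiber W)) (liftBase T) p
      = - ((dirDeriv T f p.1 + f p.1 * pairing gB T P p.1) * dirDeriv X f p.1
        * pairing gF V W p.2) := by
  simp only [ssCov, ssLowerCov]
  rw [(isSplitForm_fiber_base h hP hT hV).contraction_eq h (isSplitForm_base_fiber h hP hX hW),
    ssKoszul_base_fiber_base h.base hX hT hW, dirDeriv_const]
  simp [splitContraction, contraction_zero_left h.fiberMetric]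

theorem ssCov_fiber_fiber_base_base (h : IsWarpedData gB gF f) (hP : IsSmoothField P)
    (hX : IsSmoothField X) (hW : IsSmoothField W) (hV : IsSmoothField V)
    (hT : IsSmoothField T) (p : B × F) :
    ssCov (warpedMetric f gB gF) (liftBase P) (liftFiber V)
        (ssKoszul (warpedMetric f gB gF) (liftBase P) (liftFiber W) (liftBase X)) (liftBase T) p
      = - ((dirDeriv T f p.1 + f p.1 * pairing gB T P p.1)
        * (dirDeriv X f p.1 + f p.1 * pairing gB X P p.1) * pairing gF V W p.2) := by
  simp only [ssCov, ssLowerCov]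
  rw [(isSplitForm_fiber_base h hP hT hV).contraction_eq h (isSplitForm_fiber_base h hP hX hW),
    ssKoszul_fiber_base_base h.base hX hT hW, dirDeriv_const]
  simp [splitContraction, contraction_zero_left h.fiberMetric]

theorem ssCov_base_base_base_fiber (h : IsWarpedData gB gF f) (hP : IsSmoothField P)
    (hX : IsSmoothField X) (hY : IsSmoothField Y) (hZ : IsSmoothField Z)
    (hQ : IsSmoothField Q) (p : B × F) :
    ssCov (warpedMetric f gB gF) (liftBase P) (liftBase Z)
        (ssKoszul (warpedMetric f gB gF) (liftBase P) (liftBase X) (liftBase Y)) (liftFiber Q) p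
      = 0 := by
  simp only [ssCov, ssLowerCov]
  rw [(isSplitForm_base_fiber h hP hZ hQ).contraction_eq h (isSplitForm_base_base h hP hX hY),
    ssKoszul_base_base_fiber h.base hX hY hQ, dirDeriv_const]
  simp [splitContraction, contraction_zero_left h.fiberMetric]

theorem ssCov_base_base_fiber_fiber (h : IsWarpedData gB gF f) (hP : IsSmoothField P)
    (hX : IsSmoothField X) (hW : IsSmoothField W) (hZ : IsSmoothField Z)
    (hQ : IsSmoothField Q) (p : B × F) :
    ssCov (warpedMetric f gB gF) (liftBase P) (liftBase Z)
        (ssKoszul (warpedMetric f gB gF) (liftBase P) (liftBase X) (liftFiber W)) (liftFiber Q) p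
      = f p.1 * dirDeriv Z (dirDeriv X f) p.1 * pairing gF W Q p.2 := by
  simp only [ssCov, ssLowerCov]
  rw [(isSplitForm_base_fiber h hP hZ hQ).contraction_eq h (isSplitForm_base_fiber h hP hX hW),
    ssKoszul_base_fiber_fiber h.fiberMetric h.smooth hX hW hQ,
    dirDeriv_liftBase_mul Z (h.smooth.mul (h.smooth.dirDeriv hX))
      (h.fiberMetric.isSmoothFun_pairing hW hQ), dirDeriv_mul h.smooth (h.smooth.dirDeriv hX)]
  -- The contraction is `Z(f) X(f) g_F(W, Q)`; it cancels the first-order part of the derivative of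
  -- `f X(f)` and leaves only `f Z(X(f))`.
  simp [splitContraction, contraction_zero_left h.fiberMetric, h.fiberMetric.pairing_comm Q W]
  ring

theorem ssCov_base_fiber_base_fiber (h : IsWarpedData gB gF f) (hP : IsSmoothField P)
    (hX : IsSmoothField X) (hW : IsSmoothField W) (hZ : IsSmoothField Z)
    (hQ : IsSmoothField Q) (p : B × F) :
    ssCov (warpedMetric f gB gF) (liftBase P) (liftBase Z)
        (ssKoszul (warpedMetric f gB gF) (liftBase P) (liftFiber W) (liftBase X)) (liftFiber Q) p
      = f p.1 * dirDeriv Z (fun b => dirDeriv X f b + f b * pairing gB X P b) p.1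
        * pairing gF W Q p.2 := by
  have he := (isSplitForm_fiber_base h hP hX hW).factor
  simp only [ssCov, ssLowerCov]
  rw [(isSplitForm_base_fiber h hP hZ hQ).contraction_eq h (isSplitForm_fiber_base h hP hX hW),
    ssKoszul_fiber_base_fiber h.fiberMetric h.smooth hX hW hQ,
    dirDeriv_liftBase_mul Z (h.smooth.mul he)
      (h.fiberMetric.isSmoothFun_pairing hW hQ), dirDeriv_mul h.smooth he]
  simp [splitContraction, contraction_zero_left h.fiberMetric, h.fiberMetric.pairing_comm Q W]
  ring

theorem ssCov_base_fiber_fiber_fiber (h : IsWarpedData gB gF f) (hP : IsSmoothField P)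
    (hU : IsSmoothField U) (hW : IsSmoothField W) (hZ : IsSmoothField Z)
    (hQ : IsSmoothField Q) (p : B × F) :
    ssCov (warpedMetric f gB gF) (liftBase P) (liftBase Z)
        (ssKoszul (warpedMetric f gB gF) (liftBase P) (liftFiber U) (liftFiber W)) (liftFiber Q) p
      = f p.1 * dirDeriv Z f p.1 * koszul gF U W Q p.2 := by
  simp only [ssCov, ssLowerCov]
  rw [(isSplitForm_base_fiber h hP hZ hQ).contraction_eq h (isSplitForm_fiber_fiber h hP hU hW),
    ssKoszul_fiber_fiber_fiber h.fiberMetric h.smooth hU hW hQ,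
    dirDeriv_liftBase_mul Z (h.smooth.pow 2) (IsSmoothFun.koszul h.fiberMetric hU hW hQ),
    dirDeriv_sq h.smooth]
  simp [splitContraction, contraction_zero_left h.fiberMetric]
  ring

theorem ssCov_fiber_base_base_fiber (h : IsWarpedData gB gF f) (hP : IsSmoothField P)
    (hX : IsSmoothField X) (hY : IsSmoothField Y) (hV : IsSmoothField V)
    (hQ : IsSmoothField Q) (p : B × F) :
    ssCov (warpedMetric f gB gF) (liftBase P) (liftFiber V)
        (ssKoszul (warpedMetric f gB gF) (liftBase P) (liftBase X) (liftBase Y)) (liftFiber Q) p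
      = (f p.1 * coInner gB (differential f) (ssKoszul gB P X Y) p.1
        + f p.1 ^ 2 * ssKoszul gB P X Y P p.1) * pairing gF V Q p.2 := by
  simp only [ssCov, ssLowerCov]
  rw [(isSplitForm_fiber_fiber h hP hV hQ).contraction_eq h (isSplitForm_base_base h hP hX hY),
    ssKoszul_base_base_fiber h.base hX hY hQ, dirDeriv_const]
  simp [splitContraction, contraction_zero_right h.fiberMetric, coInner_warpForm_left h.base
    h.nondegenerate h.smooth hP (isOneForm_ssKoszul h.base hP hX hY)]
  ring

/-- Metric compatibility splits `V⟨W, Q⟩` into `𝒦(V, W, Q) + 𝒦(V, Q, W)`, and the contraction is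
exactly the second part, multiplied by `f X(f)`. -/
theorem ssCov_fiber_base_fiber_fiber (h : IsWarpedData gB gF f) (hP : IsSmoothField P)
    (hX : IsSmoothField X) (hW : IsSmoothField W) (hV : IsSmoothField V)
    (hQ : IsSmoothField Q) (p : B × F) :
    ssCov (warpedMetric f gB gF) (liftBase P) (liftFiber V)
        (ssKoszul (warpedMetric f gB gF) (liftBase P) (liftBase X) (liftFiber W)) (liftFiber Q) p
      = f p.1 * dirDeriv X f p.1 * koszul gF V W Q p.2 := by
  simp only [ssCov, ssLowerCov]
  rw [(isSplitForm_fiber_fiber h hP hV hQ).contraction_eq h (isSplitForm_base_fiber h hP hX hW),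
    ssKoszul_base_fiber_fiber h.fiberMetric h.smooth hX hW hQ,
    dirDeriv_liftFiber_mul V (h.smooth.mul (h.smooth.dirDeriv hX))
      (h.fiberMetric.isSmoothFun_pairing hW hQ), ← koszul_add_swap h.fiberMetric]
  simp [splitContraction, contraction_zero_right h.fiberMetric]
  ring

theorem ssCov_fiber_fiber_base_fiber (h : IsWarpedData gB gF f) (hP : IsSmoothField P)
    (hX : IsSmoothField X) (hW : IsSmoothField W) (hV : IsSmoothField V)
    (hQ : IsSmoothField Q) (p : B × F) :
    ssCov (warpedMetric f gB gF) (liftBase P) (liftFiber V)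
        (ssKoszul (warpedMetric f gB gF) (liftBase P) (liftFiber W) (liftBase X)) (liftFiber Q) p
      = f p.1 * (dirDeriv X f p.1 + f p.1 * pairing gB X P p.1) * koszul gF V W Q p.2 := by
  have he := (isSplitForm_fiber_base h hP hX hW).factor
  simp only [ssCov, ssLowerCov]
  rw [(isSplitForm_fiber_fiber h hP hV hQ).contraction_eq h (isSplitForm_fiber_base h hP hX hW),
    ssKoszul_fiber_base_fiber h.fiberMetric h.smooth hX hW hQ,
    dirDeriv_liftFiber_mul V (h.smooth.mul he)
      (h.fiberMetric.isSmoothFun_pairing hW hQ), ← koszul_add_swap h.fiberMetric]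
  simp [splitContraction, contraction_zero_right h.fiberMetric]
  ring

/-- The vertical parts reproduce the covariant derivative of `F` multiplied by `f²`. The horizontal
parts are multiples of the warping form, and their contraction is its square norm. -/
theorem ssCov_fiber_fiber_fiber_fiber (h : IsWarpedData gB gF f) (hP : IsSmoothField P)
    (hU : IsSmoothField U) (hW : IsSmoothField W) (hV : IsSmoothField V)
    (hQ : IsSmoothField Q) (p : B × F) :
    ssCov (warpedMetric f gB gF) (liftBase P) (liftFiber V)
        (ssKoszul (warpedMetric f gB gF) (liftBase P) (liftFiber U) (liftFiber W)) (liftFiber Q) p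
      = f p.1 ^ 2 * cov gF V (lowerCov gF U W) Q p.2
        - (f p.1 ^ 2 * coInner gB (differential f) (differential f) p.1
          + 2 * f p.1 ^ 3 * dirDeriv P f p.1 + f p.1 ^ 4 * pairing gB P P p.1)
          * (pairing gF U W p.2 * pairing gF V Q p.2) := by
  simp only [ssCov, ssLowerCov, cov, lowerCov]
  rw [(isSplitForm_fiber_fiber h hP hV hQ).contraction_eq h (isSplitForm_fiber_fiber h hP hU hW),
    ssKoszul_fiber_fiber_fiber h.fiberMetric h.smooth hU hW hQ,
    dirDeriv_liftFiber_mul V (h.smooth.pow 2) (IsSmoothFun.koszul h.fiberMetric hU hW hQ),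
    ← coInner_warpForm_warpForm h.base h.nondegenerate h.smooth hP]
  simp [splitContraction]
  ring

end WarpedCov

/-! ### The curvature on lifts -/

section WarpedCurvature

variable {E₁ : Type*} [NormedAddCommGroup E₁] [NormedSpace ℝ E₁] [FiniteDimensional ℝ E₁]
  {H₁ : Type*} [TopologicalSpace H₁] {I : ModelWithCorners ℝ E₁ H₁}
  {B : Type*} [TopologicalSpace B] [ChartedSpace H₁ B] [IsManifold I ∞ B] [T2Space B]
  {E₂ : Type*} [NormedAddCommGroup E₂] [NormedSpace ℝ E₂] [FiniteDimensional ℝ E₂]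
  {H₂ : Type*} [TopologicalSpace H₂] {J : ModelWithCorners ℝ E₂ H₂}
  {F : Type*} [TopologicalSpace F] [ChartedSpace H₂ F] [IsManifold J ∞ F] [T2Space F]
  {gB : BilinField I B} {gF : BilinField J F} {f : B → ℝ}
  {P X Y Z T : VField I B} {U V W Q : VField J F}

/-- The correction turning `∇^♭` into `∇̄^♭` is a combination of `X^♭` and `P^♭`, whose contractions
with `η` are evaluations. -/
theorem coInner_ssKoszul_left {η : FieldFunctional I B} (hgB : IsSingularMetric gB)
    (hB : IsNondegenerate gB) (hP : IsSmoothField P) (hX : IsSmoothField X)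
    (hY : IsSmoothField Y) (hη : IsOneForm η) (b : B) :
    coInner gB (ssKoszul gB P X Y) η b = coInner gB (koszul gB X Y) η b
      + pairing gB Y P b * η X b - pairing gB X Y b * η P b := by
  have h1 := hB.exists_isFlatAt hgB hη b
  have h2 := hB.exists_isFlatAt hgB (isOneForm_koszul hgB hX hY) b
  have h3 : ∃ u, IsFlatAt gB (fun Z q => pairing gB Y P q * pairing gB X Z q
      + (- pairing gB X Y q) * pairing gB P Z q) b u :=
    ⟨_, (isFlatAt_pairing X b).comb (isFlatAt_pairing P b) (pairing gB Y P)
      fun q => - pairing gB X Y q⟩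
  have h4 := coInner_comb_left (hgB.symm b) h2 h3 h1 (fun _ => 1) fun _ => 1
  rw [coInner_comb_left (hgB.symm b) ⟨_, isFlatAt_pairing X b⟩ ⟨_, isFlatAt_pairing P b⟩ h1
    (pairing gB Y P) fun q => - pairing gB X Y q, coInner_pairing_left (hgB.symm b) hX h1,
    coInner_pairing_left (hgB.symm b) hP h1] at h4
  have h5 := coInner_congr (hgB.symm b) (α := ssKoszul gB P X Y) (β := η) (β' := η)
    (α' := fun Z q => 1 * koszul gB X Y Z q + 1 * (pairing gB Y P q * pairing gB X Z q
      + (- pairing gB X Y q) * pairing gB P Z q))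
    (fun Z _ => by simp only [ssKoszul]; ring) fun _ _ => rfl
  rw [h5, h4]
  ring

/-- The second derivative of `f` and the contraction of `∇^♭_X T` with `df` combine into the
Hessian. From the derivative of `g_B(P, T)`, metric compatibility gives two Koszul terms; the
contraction with `P^♭` removes `𝒦(X, T, P)` and leaves `𝒦(X, P, T)`. -/
theorem ssCov_warpForm (hgB : IsSingularMetric gB) (hB : IsNondegenerate gB)
    (hf : IsSmoothFun I f) (hP : IsSmoothField P) (hX : IsSmoothField X) (hT : IsSmoothField T)
    (b : B) :
    ssCov gB P X (warpForm f gB P) T b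
      = f b * hessian gB f X T b + dirDeriv X f b * (dirDeriv T f b + f b * pairing gB T P b)
        - f b ^ 2 * pairing gB X P b * pairing gB P T b
        + f b * dirDeriv P f b * pairing gB X T b + f b ^ 2 * pairing gB P P b * pairing gB X T b
        + f b ^ 2 * koszul gB X P T b := by
  have hd := isOneForm_differential hf
  have h1 : dirDeriv X (warpForm f gB P T) b
      = f b * dirDeriv X (dirDeriv T f) b + dirDeriv X f b * dirDeriv T f b
        + (f b ^ 2 * (koszul gB X P T b + koszul gB X T P b)
          + 2 * f b * dirDeriv X f b * pairing gB P T b) := by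
    have h2 : warpForm f gB P T = fun b => f b * dirDeriv T f b + f b ^ 2 * pairing gB P T b := rfl
    rw [h2, dirDeriv_add (hf.mul (hf.dirDeriv hT))
      ((hf.pow 2).mul (hgB.isSmoothFun_pairing hP hT)), dirDeriv_mul hf (hf.dirDeriv hT),
      dirDeriv_mul (hf.pow 2) (hgB.isSmoothFun_pairing hP hT), dirDeriv_sq hf, koszul_add_swap hgB]
  simp only [ssCov, ssLowerCov, hessian, cov, lowerCov]
  rw [h1, hB.contraction_eq_coInner hgB (isOneForm_koszul hgB hX hT) hd,
    hB.contraction_eq_coInner hgB (isOneForm_ssKoszul hgB hP hX hT)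
      (isOneForm_warpForm hgB hf hP),
    coInner_warpForm_right hgB hB hf hP (isOneForm_ssKoszul hgB hP hX hT),
    coInner_ssKoszul_left hgB hB hP hX hT hd]
  simp only [ssKoszul, differential, hgB.pairing_comm P T]
  ring

/-! ### The curvature of a warped product -/

theorem ssCurvature_base_base_base_base (h : IsWarpedData gB gF f) (hP : IsSmoothField P)
    (hX : IsSmoothField X) (hY : IsSmoothField Y) (hZ : IsSmoothField Z)
    (hT : IsSmoothField T) (p : B × F) :
    ssCurvature (warpedMetric f gB gF) (liftBase P) (liftBase X) (liftBase Y) (liftBase Z)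
      (liftBase T) p = ssCurvature gB P X Y Z T p.1 := by
  simp only [ssCurvature, ssLowerCov]
  rw [ssCov_base_base_base_base h hP hY hZ hX hT, ssCov_base_base_base_base h hP hX hZ hY hT,
    bracket_liftBase_liftBase hX hY, ssKoszul_base_base_base h.base (hX.bracket hY) hZ hT]

theorem ssCurvature_base_base_base_fiber (h : IsWarpedData gB gF f) (hP : IsSmoothField P)
    (hX : IsSmoothField X) (hY : IsSmoothField Y) (hZ : IsSmoothField Z)
    (hQ : IsSmoothField Q) (p : B × F) :
    ssCurvature (warpedMetric f gB gF) (liftBase P) (liftBase X) (liftBase Y) (liftBase Z)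
      (liftFiber Q) p = 0 := by
  simp only [ssCurvature, ssLowerCov]
  rw [ssCov_base_base_base_fiber h hP hY hZ hX hQ, ssCov_base_base_base_fiber h hP hX hZ hY hQ,
    bracket_liftBase_liftBase hX hY, ssKoszul_base_base_fiber h.base (hX.bracket hY) hZ hQ]
  simp

theorem ssCurvature_base_fiber_base_base (h : IsWarpedData gB gF f) (hP : IsSmoothField P)
    (hX : IsSmoothField X) (hY : IsSmoothField Y) (hZ : IsSmoothField Z)
    (hQ : IsSmoothField Q) (p : B × F) :
    ssCurvature (warpedMetric f gB gF) (liftBase P) (liftBase Z) (liftFiber Q) (liftBase X)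
      (liftBase Y) p = 0 := by
  simp only [ssCurvature, ssLowerCov]
  rw [ssCov_base_fiber_base_base h hP hX hQ hZ hY, ssCov_fiber_base_base_base h hP hZ hX hQ hY,
    bracket_liftBase_liftFiber hZ hQ, ssKoszul_zero_left h.metric _ hX.liftBase hY.liftBase]
  simp

theorem ssCurvature_base_base_fiber_fiber (h : IsWarpedData gB gF f) (hP : IsSmoothField P)
    (hX : IsSmoothField X) (hY : IsSmoothField Y) (hW : IsSmoothField W)
    (hQ : IsSmoothField Q) (p : B × F) :
    ssCurvature (warpedMetric f gB gF) (liftBase P) (liftBase X) (liftBase Y) (liftFiber W)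
      (liftFiber Q) p = 0 := by
  simp only [ssCurvature, ssLowerCov]
  rw [ssCov_base_base_fiber_fiber h hP hY hW hX hQ, ssCov_base_base_fiber_fiber h hP hX hW hY hQ,
    bracket_liftBase_liftBase hX hY,
    ssKoszul_base_fiber_fiber h.fiberMetric h.smooth (hX.bracket hY) hW hQ]
  -- What remains is `f g_F(W, Q)` times `X(Y(f)) - Y(X(f)) - [X, Y](f)`.
  simp only [dirDeriv_bracket hX hY h.smooth]
  ring

theorem ssCurvature_fiber_fiber_base_base (h : IsWarpedData gB gF f) (hP : IsSmoothField P)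
    (hX : IsSmoothField X) (hY : IsSmoothField Y) (hW : IsSmoothField W)
    (hQ : IsSmoothField Q) (p : B × F) :
    ssCurvature (warpedMetric f gB gF) (liftBase P) (liftFiber W) (liftFiber Q) (liftBase X)
      (liftBase Y) p = 0 := by
  simp only [ssCurvature, ssLowerCov]
  rw [ssCov_fiber_fiber_base_base h hP hX hQ hW hY, ssCov_fiber_fiber_base_base h hP hX hW hQ hY,
    bracket_liftFiber_liftFiber hW hQ, ssKoszul_fiber_base_base h.base hX hY (hW.bracket hQ),
    h.fiberMetric.pairing_comm Q W]
  ring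

/-- The product of first derivatives `X(f) (T(f) + f g_B(T, P))` occurs in both covariant
derivatives and cancels. The bracket term is absent because lifts from the two factors commute. -/
theorem ssCurvature_base_fiber_fiber_base (h : IsWarpedData gB gF f) (hP : IsSmoothField P)
    (hX : IsSmoothField X) (hT : IsSmoothField T) (hV : IsSmoothField V)
    (hW : IsSmoothField W) (p : B × F) :
    ssCurvature (warpedMetric f gB gF) (liftBase P) (liftBase X) (liftFiber V) (liftFiber W)
        (liftBase T) p
      = - f p.1 * hessian gB f X T p.1 * pairing gF V W p.2
        + f p.1 ^ 2 * pairing gB X P p.1 * pairing gF V W p.2 * pairing gB P T p.1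
        - f p.1 * dirDeriv P f p.1 * pairing gF V W p.2 * pairing gB X T p.1
        - f p.1 ^ 2 * pairing gB P P p.1 * pairing gF V W p.2 * pairing gB X T p.1
        - f p.1 ^ 2 * pairing gF V W p.2 * koszul gB X P T p.1 := by
  simp only [ssCurvature, ssLowerCov]
  rw [ssCov_base_fiber_fiber_base h hP hV hW hX hT, ssCov_fiber_base_fiber_base h hP hX hW hV hT,
    bracket_liftBase_liftFiber hX hV, ssKoszul_zero_left h.metric _ hW.liftFiber hT.liftBase,
    ssCov_warpForm h.base h.nondegenerate h.smooth hP hX hT]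
  ring

theorem ssCurvature_fiber_fiber_base_fiber (h : IsWarpedData gB gF f) (hP : IsSmoothField P)
    (hZ : IsSmoothField Z) (hU : IsSmoothField U) (hV : IsSmoothField V)
    (hQ : IsSmoothField Q) (p : B × F) :
    ssCurvature (warpedMetric f gB gF) (liftBase P) (liftFiber U) (liftFiber V) (liftBase Z)
      (liftFiber Q) p = 0 := by
  simp only [ssCurvature, ssLowerCov]
  rw [ssCov_fiber_fiber_base_fiber h hP hZ hV hU hQ, ssCov_fiber_fiber_base_fiber h hP hZ hU hV hQ,
    bracket_liftFiber_liftFiber hU hV,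
    ssKoszul_fiber_base_fiber h.fiberMetric h.smooth hZ (hU.bracket hV) hQ]
  -- The three terms have the common factor `f (Z(f) + f g_B(Z, P))` and cancel because the Koszul
  -- form of `F` is torsion-free.
  simp only [← koszul_sub_swap h.fiberMetric U V Q]
  ring

theorem ssCurvature_base_fiber_fiber_fiber (h : IsWarpedData gB gF f) (hP : IsSmoothField P)
    (hZ : IsSmoothField Z) (hU : IsSmoothField U) (hV : IsSmoothField V)
    (hQ : IsSmoothField Q) (p : B × F) :
    ssCurvature (warpedMetric f gB gF) (liftBase P) (liftBase Z) (liftFiber Q) (liftFiber U)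
      (liftFiber V) p = 0 := by
  simp only [ssCurvature, ssLowerCov]
  rw [ssCov_base_fiber_fiber_fiber h hP hQ hU hZ hV, ssCov_fiber_base_fiber_fiber h hP hZ hU hQ hV,
    bracket_liftBase_liftFiber hZ hQ, ssKoszul_zero_left h.metric _ hU.liftFiber hV.liftFiber]
  ring

theorem ssCurvature_fiber_fiber_fiber_fiber (h : IsWarpedData gB gF f) (hP : IsSmoothField P)
    (hU : IsSmoothField U) (hV : IsSmoothField V) (hW : IsSmoothField W)
    (hQ : IsSmoothField Q) (p : B × F) :
    ssCurvature (warpedMetric f gB gF) (liftBase P) (liftFiber U) (liftFiber V) (liftFiber W)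
        (liftFiber Q) p
      = f p.1 ^ 2 * curvature gF U V W Q p.2
        + (f p.1 ^ 2 * coInner gB (differential f) (differential f) p.1
            + 2 * f p.1 ^ 3 * dirDeriv P f p.1 + f p.1 ^ 4 * pairing gB P P p.1)
          * (pairing gF U W p.2 * pairing gF V Q p.2
            - pairing gF V W p.2 * pairing gF U Q p.2) := by
  simp only [ssCurvature, ssLowerCov, curvature]
  rw [ssCov_fiber_fiber_fiber_fiber h hP hV hW hU hQ,
    ssCov_fiber_fiber_fiber_fiber h hP hU hW hV hQ, bracket_liftFiber_liftFiber hU hV,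
    ssKoszul_fiber_fiber_fiber h.fiberMetric h.smooth (hU.bracket hV) hW hQ]
  simp only [lowerCov]
  ring

end WarpedCurvature

/-! ### Covariant derivatives of one-forms when contractions are smooth -/

section Cov

variable {E : Type*} [NormedAddCommGroup E] [NormedSpace ℝ E] [FiniteDimensional ℝ E]
  {H : Type*} [TopologicalSpace H] {I : ModelWithCorners ℝ E H}
  {M : Type*} [TopologicalSpace M] [ChartedSpace H M] [IsManifold I ∞ M] [T2Space M]
  {g : BilinField I M} {α β γ : FieldFunctional I M} {p : M}

theorem ssCov_zero (g : BilinField I M) : ssCov g 0 = cov g := by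
  funext X α Y p
  simp only [ssCov, cov, ssLowerCov, lowerCov, ssKoszul_zero]

theorem IsRadicalAnnihilator.comb (hα : IsRadicalAnnihilator g α) (hβ : IsRadicalAnnihilator g β)
    {φ ψ : M → ℝ} (hφ : IsSmoothFun I φ) (hψ : IsSmoothFun I ψ) :
    IsRadicalAnnihilator g (fun Z p => φ p * α Z p + ψ p * β Z p) where
  isOneForm := hα.isOneForm.comb hβ.isOneForm hφ hψ
  mem p := by
    obtain ⟨u, hu⟩ := hα.mem p
    obtain ⟨v, hv⟩ := hβ.mem p
    exact ⟨_, hu.comb hv φ ψ⟩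

theorem isRadicalAnnihilator_pairing (hg : IsSingularMetric g) {X : VField I M}
    (hX : IsSmoothField X) : IsRadicalAnnihilator g (pairing g X) :=
  ⟨isOneForm_pairing hg hX, fun p => ⟨X p, isFlatAt_pairing X p⟩⟩

theorem contraction_comm (hg : IsSingularMetric g) (hα : IsRadicalAnnihilator g α)
    (hβ : IsRadicalAnnihilator g β) : contraction g α β = contraction g β α := by
  have : coInner g α β = coInner g β α :=
    funext fun p => coInner_comm (hg.symm p) (hα.mem p) (hβ.mem p)
  rw [contraction, this, contraction]

/-- The contraction depends only on germs, and only on the values at smooth fields. Smoothness of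
one contraction makes it a valid continuous extension for the other. -/
theorem contraction_congr (hg : IsSingularMetric g) {α' β' : FieldFunctional I M}
    (hα : ∀ᶠ q in 𝓝 p, ∀ Z, IsSmoothField Z → α Z q = α' Z q)
    (hβ : ∀ᶠ q in 𝓝 p, ∀ Z, IsSmoothField Z → β Z q = β' Z q)
    (hα' : IsRadicalAnnihilator g α') (hβ' : IsRadicalAnnihilator g β')
    (hc : IsSmoothFun I (contraction g α' β')) :
    contraction g α β p = contraction g α' β' p := by
  refine contraction_eq hg hc.continuous.continuousAt ?_
  filter_upwards [hα, hβ] with q h1 h2 hq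
  rw [coInner_congr (hg.symm q) h1 h2, contraction_eq_coInner hg hq hα'.isOneForm hβ'.isOneForm
    hα'.mem hβ'.mem]

/-- Bilinearity holds pointwise on the regions of constant signature, but the extension inherits it
only when the individual contractions extend continuously; hence the two smoothness assumptions. -/
theorem contraction_comb_left (hg : IsSingularMetric g) (hα : IsRadicalAnnihilator g α)
    (hβ : IsRadicalAnnihilator g β) (hγ : IsRadicalAnnihilator g γ)
    (hαγ : IsSmoothFun I (contraction g α γ)) (hβγ : IsSmoothFun I (contraction g β γ))
    {φ ψ : M → ℝ} (hφ : IsSmoothFun I φ) (hψ : IsSmoothFun I ψ) {δ : FieldFunctional I M}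
    (hδ : ∀ Z, IsSmoothField Z → ∀ q, δ Z q = φ q * α Z q + ψ q * β Z q) (p : M) :
    contraction g δ γ p = φ p * contraction g α γ p + ψ p * contraction g β γ p := by
  refine contraction_eq (h := fun p => φ p * contraction g α γ p + ψ p * contraction g β γ p) hg
    ((hφ.mul hαγ).add (hψ.mul hβγ)).continuous.continuousAt ?_
  refine Filter.Eventually.of_forall fun q hq => ?_
  rw [coInner_congr (α' := fun Z q => φ q * α Z q + ψ q * β Z q) (hg.symm q)
      (fun Z hZ => hδ Z hZ q) (fun _ _ => rfl),
    coInner_comb_left (hg.symm q) (hα.mem q) (hβ.mem q) (hγ.mem q) φ ψ,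
    contraction_eq_coInner hg hq hα.isOneForm hγ.isOneForm hα.mem hγ.mem,
    contraction_eq_coInner hg hq hβ.isOneForm hγ.isOneForm hβ.mem hγ.mem]

theorem contraction_pairing_left (hg : IsSingularMetric g) {X : VField I M}
    (hX : IsSmoothField X) (hα : IsRadicalAnnihilator g α) :
    contraction g (pairing g X) α = α X :=
  funext fun _ => contraction_eq hg (hα.isOneForm.smooth X hX).continuous.continuousAt
    (Filter.Eventually.of_forall fun q _ => coInner_pairing_left (hg.symm q) hX (hα.mem q))

/-- Forms in `𝒜^•` which have smooth contractions with all `∇^♭_C T`. -/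
structure IsContractible (g : BilinField I M) (α : FieldFunctional I M) : Prop where
  mem : IsRadicalAnnihilator g α
  smooth : ∀ C T, IsSmoothField C → IsSmoothField T →
    IsSmoothFun I (contraction g (koszul g C T) α)

/-- The conditions of semi-regularity that do not involve second derivatives of the metric. -/
structure IsRadicalStationary (g : BilinField I M) : Prop where
  isSingularMetric : IsSingularMetric g
  isContractible : ∀ X Y, IsSmoothField X → IsSmoothField Y → IsContractible g (koszul g X Y)

theorem IsRadicalStationary.isContractible_pairing (hg : IsRadicalStationary g) {X : VField I M}
    (hX : IsSmoothField X) : IsContractible g (pairing g X) := by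
  have h := isRadicalAnnihilator_pairing hg.isSingularMetric hX
  refine ⟨h, fun C T hC hT => ?_⟩
  have hK := (hg.isContractible C T hC hT).mem
  rw [contraction_comm hg.isSingularMetric hK h, contraction_pairing_left hg.isSingularMetric hX hK]
  exact hK.isOneForm.smooth X hX

theorem IsRadicalStationary.contraction_comb_right (hg : IsRadicalStationary g)
    (hα : IsContractible g α) (hβ : IsContractible g β) {φ ψ : M → ℝ} (hφ : IsSmoothFun I φ)
    (hψ : IsSmoothFun I ψ) {C T : VField I M} (hC : IsSmoothField C) (hT : IsSmoothField T)
    (p : M) :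
    contraction g (koszul g C T) (fun Z p => φ p * α Z p + ψ p * β Z p) p
      = φ p * contraction g (koszul g C T) α p + ψ p * contraction g (koszul g C T) β p := by
  have hK := (hg.isContractible C T hC hT).mem
  have h0 := hg.isSingularMetric
  have h1 := contraction_comm h0 hK hα.mem
  have h2 := contraction_comm h0 hK hβ.mem
  rw [contraction_comm h0 hK (hα.mem.comb hβ.mem hφ hψ), contraction_comb_left h0 hα.mem hβ.mem hK
    (h1 ▸ hα.smooth C T hC hT) (h2 ▸ hβ.smooth C T hC hT) hφ hψ (fun _ _ _ => rfl), h1, h2]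

theorem IsRadicalStationary.comb (hg : IsRadicalStationary g) (hα : IsContractible g α)
    (hβ : IsContractible g β) {φ ψ : M → ℝ} (hφ : IsSmoothFun I φ) (hψ : IsSmoothFun I ψ) :
    IsContractible g (fun Z p => φ p * α Z p + ψ p * β Z p) where
  mem := hα.mem.comb hβ.mem hφ hψ
  smooth C T hC hT := by
    rw [funext (hg.contraction_comb_right hα hβ hφ hψ hC hT)]
    exact (hφ.mul (hα.smooth C T hC hT)).add (hψ.mul (hβ.smooth C T hC hT))

theorem IsRadicalStationary.contraction_koszul_add_middle (hg : IsRadicalStationary g)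
    (hα : IsContractible g α) {C T T' : VField I M} (hC : IsSmoothField C)
    (hT : IsSmoothField T) (hT' : IsSmoothField T') (p : M) :
    contraction g (koszul g C (fun q => T q + T' q)) α p
      = contraction g (koszul g C T) α p + contraction g (koszul g C T') α p := by
  have h0 := hg.isSingularMetric
  have h3 := contraction_comb_left h0 (hg.isContractible C T hC hT).mem
    (hg.isContractible C T' hC hT').mem hα.mem (hα.smooth C T hC hT) (hα.smooth C T' hC hT')
    (isSmoothFun_const 1) (isSmoothFun_const 1)
    (δ := koszul g C (fun q => T q + T' q)) (fun Z hZ q => by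
      rw [koszul_add_middle h0 hC hT hT' hZ, one_mul, one_mul]) p
  rw [h3]
  ring

theorem IsRadicalStationary.contraction_koszul_smul_middle (hg : IsRadicalStationary g)
    (hα : IsContractible g α) {φ : M → ℝ} (hφ : IsSmoothFun I φ) {C T : VField I M}
    (hC : IsSmoothField C) (hT : IsSmoothField T) (p : M) :
    contraction g (koszul g C (fun q => φ q • T q)) α p
      = φ p * contraction g (koszul g C T) α p + dirDeriv C φ p * α T p := by
  have h0 := hg.isSingularMetric
  have hs : IsSmoothFun I (contraction g (pairing g T) α) := by
    rw [contraction_pairing_left h0 hT hα.mem]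
    exact hα.mem.isOneForm.smooth T hT
  rw [contraction_comb_left h0 (hg.isContractible C T hC hT).mem
    (isRadicalAnnihilator_pairing h0 hT) hα.mem (hα.smooth C T hC hT) hs hφ (hφ.dirDeriv hC)
    (fun Z hZ q => koszul_smul_middle h0 hφ hC hT hZ q), contraction_pairing_left h0 hT hα.mem]

theorem IsRadicalStationary.contraction_koszul_add_left (hg : IsRadicalStationary g)
    (hα : IsContractible g α) {C C' T : VField I M} (hC : IsSmoothField C)
    (hC' : IsSmoothField C') (hT : IsSmoothField T) (p : M) :
    contraction g (koszul g (fun q => C q + C' q) T) α p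
      = contraction g (koszul g C T) α p + contraction g (koszul g C' T) α p := by
  have h0 := hg.isSingularMetric
  have h3 := contraction_comb_left h0 (hg.isContractible C T hC hT).mem
    (hg.isContractible C' T hC' hT).mem hα.mem (hα.smooth C T hC hT) (hα.smooth C' T hC' hT)
    (isSmoothFun_const 1) (isSmoothFun_const 1)
    (δ := koszul g (fun q => C q + C' q) T) (fun Z hZ q => by
      rw [koszul_add_left h0 hC hC' hT hZ, one_mul, one_mul]) p
  rw [h3]
  ring

theorem IsRadicalStationary.contraction_koszul_smul_left (hg : IsRadicalStationary g)
    (hα : IsContractible g α) {φ : M → ℝ} (hφ : IsSmoothFun I φ) {C T : VField I M}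
    (hC : IsSmoothField C) (hT : IsSmoothField T) (p : M) :
    contraction g (koszul g (fun q => φ q • C q) T) α p
      = φ p * contraction g (koszul g C T) α p := by
  have h0 := hg.isSingularMetric
  have h3 := contraction_comb_left h0 (hg.isContractible C T hC hT).mem
    (hg.isContractible C T hC hT).mem hα.mem (hα.smooth C T hC hT) (hα.smooth C T hC hT)
    -- The combination rule is binary; the second copy is given coefficient zero.
    hφ (isSmoothFun_const 0)
    (δ := koszul g (fun q => φ q • C q) T) (fun Z hZ q => by
      rw [koszul_smul_left h0 hφ hC hT hZ, zero_mul, add_zero]) p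
  rw [h3]
  ring

/-- Replacing `T` by `φ T` creates `C(φ) α(T)` twice: from the derivative of `φ α(T)`, and from
contracting the Leibniz term `C(φ) T^♭` with `α`. They cancel. -/
theorem IsRadicalStationary.isOneForm_cov (hg : IsRadicalStationary g)
    (hα : IsContractible g α) {C : VField I M} (hC : IsSmoothField C) :
    IsOneForm (cov g C α) where
  smooth T hT := ((hα.mem.isOneForm.smooth T hT).dirDeriv hC).sub (hα.smooth C T hC hT)
  add T T' hT hT' := by
    funext p
    simp only [cov, lowerCov]
    rw [hα.mem.isOneForm.add T T' hT hT', dirDeriv_add (hα.mem.isOneForm.smooth T hT)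
      (hα.mem.isOneForm.smooth T' hT'), hg.contraction_koszul_add_middle hα hC hT hT']
    ring
  smul φ T hφ hT := by
    funext p
    simp only [cov, lowerCov]
    rw [hα.mem.isOneForm.smul φ T hφ hT, dirDeriv_mul hφ (hα.mem.isOneForm.smooth T hT),
      hg.contraction_koszul_smul_middle hα hφ hC hT]
    ring

theorem IsRadicalStationary.cov_comb (hg : IsRadicalStationary g) (hα : IsContractible g α)
    (hβ : IsContractible g β) {φ ψ : M → ℝ} (hφ : IsSmoothFun I φ) (hψ : IsSmoothFun I ψ)
    {C T : VField I M} (hC : IsSmoothField C) (hT : IsSmoothField T) (p : M) :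
    cov g C (fun Z p => φ p * α Z p + ψ p * β Z p) T p
      = (φ p * cov g C α T p + dirDeriv C φ p * α T p)
        + (ψ p * cov g C β T p + dirDeriv C ψ p * β T p) := by
  simp only [cov, lowerCov]
  rw [hg.contraction_comb_right hα hβ hφ hψ hC hT,
    dirDeriv_add (hφ.mul (hα.mem.isOneForm.smooth T hT)) (hψ.mul (hβ.mem.isOneForm.smooth T hT)),
    dirDeriv_mul hφ (hα.mem.isOneForm.smooth T hT), dirDeriv_mul hψ (hβ.mem.isOneForm.smooth T hT)]
  ring

theorem IsRadicalStationary.cov_congr (hg : IsRadicalStationary g) (hβ : IsContractible g β)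
    (h : ∀ᶠ q in 𝓝 p, ∀ Z, IsSmoothField Z → α Z q = β Z q) {C T : VField I M}
    (hC : IsSmoothField C) (hT : IsSmoothField T) : cov g C α T p = cov g C β T p := by
  simp only [cov, lowerCov]
  rw [contraction_congr hg.isSingularMetric (Filter.Eventually.of_forall fun _ _ _ => rfl) h
    (hg.isContractible C T hC hT).mem hβ.mem (hβ.smooth C T hC hT),
    dirDeriv_congr (h.mono fun q hq => hq T hT) rfl]

/-- `∇_C X^♭ = ∇^♭_C X`: for flats of fields, the second-order condition of semi-regularity reduces
to the first-order one. -/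
theorem IsRadicalStationary.cov_pairing (hg : IsRadicalStationary g) {X C T : VField I M}
    (hX : IsSmoothField X) (hC : IsSmoothField C) (hT : IsSmoothField T) (p : M) :
    cov g C (pairing g X) T p = koszul g C X T p := by
  have h0 := hg.isSingularMetric
  have hK := (hg.isContractible C T hC hT).mem
  simp only [cov, lowerCov]
  rw [contraction_comm h0 hK (isRadicalAnnihilator_pairing h0 hX),
    contraction_pairing_left h0 hX hK, ← koszul_add_swap h0]
  ring

end Cov

/-! ### Semi-regularity of the warped product -/

section WarpedSemiRegular

variable {E₁ : Type*} [NormedAddCommGroup E₁] [NormedSpace ℝ E₁] [FiniteDimensional ℝ E₁]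
  {H₁ : Type*} [TopologicalSpace H₁] {I : ModelWithCorners ℝ E₁ H₁}
  {B : Type*} [TopologicalSpace B] [ChartedSpace H₁ B] [IsManifold I ∞ B] [T2Space B]
  {E₂ : Type*} [NormedAddCommGroup E₂] [NormedSpace ℝ E₂] [FiniteDimensional ℝ E₂]
  {H₂ : Type*} [TopologicalSpace H₂] {J : ModelWithCorners ℝ E₂ H₂}
  {F : Type*} [TopologicalSpace F] [ChartedSpace H₂ F] [IsManifold J ∞ F] [T2Space F]
  {gB : BilinField I B} {gF : BilinField J F} {f : B → ℝ}
  {P X Y Z T : VField I B} {U V W Q : VField J F}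
  {A C D : VField (I.prod J) (B × F)}

/-- Lifts to `B × F` of smooth vector fields on `B` or on `F`. -/
inductive IsLift : VField (I.prod J) (B × F) → Prop
  | base (X : VField I B) (hX : IsSmoothField X) : IsLift (liftBase X)
  | fiber (V : VField J F) (hV : IsSmoothField V) : IsLift (liftFiber V)

theorem IsLift.isSmoothField (hA : IsLift A) : IsSmoothField A := by
  cases hA with
  | base X hX => exact hX.liftBase
  | fiber V hV => exact hV.liftFiber

/-- The ordinary connection is treated as the case `P = 0`, so the formulas on lifts need not be
computed again. -/
theorem koszul_eq_ssKoszul_liftBase :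
    koszul (warpedMetric f gB gF) = ssKoszul (warpedMetric f gB gF) (liftBase 0) :=
  (ssKoszul_zero _).symm

theorem cov_eq_ssCov_liftBase :
    cov (warpedMetric f gB gF) = ssCov (warpedMetric f gB gF) (liftBase 0) :=
  (ssCov_zero _).symm

theorem IsWarpedData.exists_isSplitForm (h : IsWarpedData gB gF f) (hA : IsLift A)
    (hC : IsLift C) :
    ∃ a η e V κ, IsSplitForm f gF (koszul (warpedMetric f gB gF) A C) a η e V κ := by
  rw [koszul_eq_ssKoszul_liftBase]
  cases hA with
  | base X hX =>
    cases hC with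
    | base Y hY => exact ⟨_, _, _, _, _, isSplitForm_base_base h isSmoothField_zero hX hY⟩
    | fiber V hV => exact ⟨_, _, _, _, _, isSplitForm_base_fiber h isSmoothField_zero hX hV⟩
  | fiber V hV =>
    cases hC with
    | base Y hY => exact ⟨_, _, _, _, _, isSplitForm_fiber_base h isSmoothField_zero hY hV⟩
    | fiber W hW => exact ⟨_, _, _, _, _, isSplitForm_fiber_fiber h isSmoothField_zero hV hW⟩

/-- A local property of one-forms, stable under `C^∞`-linear combinations, holds for all
`∇^♭_A C` if it holds for lifts and for the forms `C^♭`. -/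
theorem koszul_induction {g : BilinField (I.prod J) (B × F)} (hg : IsSingularMetric g)
    (p : B × F) {Pr : FieldFunctional (I.prod J) (B × F) → Prop}
    (lift : ∀ A C, IsLift A → IsLift C → Pr (koszul g A C))
    (flat : ∀ C, IsSmoothField C → Pr (pairing g C))
    (comb : ∀ α β (φ ψ : B × F → ℝ), IsSmoothFun (I.prod J) φ → IsSmoothFun (I.prod J) ψ →
      Pr α → Pr β → Pr fun Z q => φ q * α Z q + ψ q * β Z q)
    (congr : ∀ α A C, IsSmoothField A → IsSmoothField C →
      (∀ᶠ q in 𝓝 p, ∀ Z, IsSmoothField Z → α Z q = koszul g A C Z q) → Pr α →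
      Pr (koszul g A C))
    (hA : IsSmoothField A) (hC : IsSmoothField C) : Pr (koszul g A C) := by
  have one := isSmoothFun_const (I := I.prod J) (M := B × F) 1
  have zero := isSmoothFun_const (I := I.prod J) (M := B × F) 0
  -- The second argument is generalized first, with the first still a lift.
  have middle : ∀ A, IsLift A → ∀ C, IsSmoothField C → Pr (koszul g A C) := by
    intro A hA C hC
    have hA' := hA.isSmoothField
    refine lift_induction p (Pr := fun C => Pr (koszul g A C))
      (fun X hX => lift _ _ hA (.base X hX)) (fun V hV => lift _ _ hA (.fiber V hV))
      (fun Z Z' hZ hZ' h1 h2 => ?_) (fun φ Z hφ hZ h1 => ?_) (fun Z Z' hZ hZ' he h1 => ?_) hC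
    · refine congr _ _ _ hA' (hZ.add hZ') (.of_forall fun q T hT => ?_)
        (comb _ _ _ _ one one h1 h2)
      rw [koszul_add_middle hg hA' hZ hZ' hT, one_mul, one_mul]
    · refine congr _ _ _ hA' (hZ.smul hφ) (.of_forall fun q T hT => ?_)
        (comb _ _ _ _ hφ (hφ.dirDeriv hA') h1 (flat Z hZ))
      rw [koszul_smul_middle hg hφ hA' hZ hT]
    · refine congr _ _ _ hA' hZ' ?_ h1
      filter_upwards [eventually_eventually_nhds.2 he] with q hq T _
      exact koszul_congr .rfl hq .rfl
  refine lift_induction p (Pr := fun A => Pr (koszul g A C))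
    (fun X hX => middle _ (.base X hX) C hC) (fun V hV => middle _ (.fiber V hV) C hC)
    (fun Z Z' hZ hZ' h1 h2 => ?_) (fun φ Z hφ hZ h1 => ?_) (fun Z Z' hZ hZ' he h1 => ?_) hA
  · refine congr _ _ _ (hZ.add hZ') hC (.of_forall fun q T hT => ?_)
      (comb _ _ _ _ one one h1 h2)
    rw [koszul_add_left hg hZ hZ' hC hT, one_mul, one_mul]
  · refine congr _ _ _ (hZ.smul hφ) hC (.of_forall fun q T hT => ?_)
      (comb _ _ _ _ hφ zero h1 h1)
    rw [koszul_smul_left hg hφ hZ hC hT, zero_mul, add_zero]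
  · refine congr _ _ _ hZ' hC ?_ h1
    filter_upwards [eventually_eventually_nhds.2 he] with q hq T _
    exact koszul_congr hq .rfl .rfl

theorem IsWarpedData.isRadicalAnnihilator_koszul (h : IsWarpedData gB gF f)
    (hA : IsSmoothField A) (hC : IsSmoothField C) :
    IsRadicalAnnihilator (warpedMetric f gB gF) (koszul (warpedMetric f gB gF) A C) := by
  refine ⟨isOneForm_koszul h.metric hA hC, fun p => ?_⟩
  refine koszul_induction h.metric p
    (Pr := fun α => ∃ u, IsFlatAt (warpedMetric f gB gF) α p u) ?_ ?_ ?_ ?_ hA hC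
  · intro A C hA hC
    obtain ⟨a, η, e, V, κ, hs⟩ := h.exists_isSplitForm hA hC
    exact hs.exists_isFlatAt h p
  · exact fun C _ => ⟨_, isFlatAt_pairing C p⟩
  · rintro α β φ ψ - - ⟨u, hu⟩ ⟨v, hv⟩
    exact ⟨_, hu.comb hv φ ψ⟩
  · rintro α A C - - he ⟨u, hu⟩
    exact ⟨u, hu.congr he.self_of_nhds⟩

/-- Smoothness is local, so the reduction to lifts applies near each point. The inductive property
speaks of `coInner` on the regions of constant signature, where it is additive without further
conditions; the extension is taken only at the end. -/
theorem IsWarpedData.isSmoothFun_contraction_of_lift (h : IsWarpedData gB gF f)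
    {β : FieldFunctional (I.prod J) (B × F)}
    (hβ : IsRadicalAnnihilator (warpedMetric f gB gF) β)
    (lift : ∀ A C, IsLift A → IsLift C → IsSmoothFun (I.prod J)
      (contraction (warpedMetric f gB gF) (koszul (warpedMetric f gB gF) A C) β))
    (hA : IsSmoothField A) (hC : IsSmoothField C) :
    IsSmoothFun (I.prod J)
      (contraction (warpedMetric f gB gF) (koszul (warpedMetric f gB gF) A C) β) := by
  intro p
  have key : IsRadicalAnnihilator (warpedMetric f gB gF) (koszul (warpedMetric f gB gF) A C) ∧
      ∃ k : B × F → ℝ, IsSmoothFun (I.prod J) k ∧ ∀ᶠ q in 𝓝 p,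
        q ∈ constSignature (warpedMetric f gB gF) →
          coInner (warpedMetric f gB gF) (koszul (warpedMetric f gB gF) A C) β q = k q := by
    refine koszul_induction h.metric p (Pr := fun α => IsRadicalAnnihilator _ α ∧
      ∃ k : B × F → ℝ, IsSmoothFun (I.prod J) k ∧ ∀ᶠ q in 𝓝 p,
        q ∈ constSignature (warpedMetric f gB gF) →
          coInner (warpedMetric f gB gF) α β q = k q) ?_ ?_ ?_ ?_ hA hC
    · intro A C hA hC
      have hr := h.isRadicalAnnihilator_koszul hA.isSmoothField hC.isSmoothField
      refine ⟨hr, _, lift A C hA hC, .of_forall fun q hq => ?_⟩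
      rw [contraction_eq_coInner h.metric hq hr.isOneForm hβ.isOneForm hr.mem hβ.mem]
    · intro C hC
      exact ⟨isRadicalAnnihilator_pairing h.metric hC, β C, hβ.isOneForm.smooth C hC,
        .of_forall fun q _ => coInner_pairing_left (h.metric.symm q) hC (hβ.mem q)⟩
    · rintro α α' φ ψ hφ hψ ⟨h1, k, hk, hαk⟩ ⟨h2, k', hk', hαk'⟩
      refine ⟨h1.comb h2 hφ hψ, _, (hφ.mul hk).add (hψ.mul hk'), ?_⟩
      filter_upwards [hαk, hαk'] with q h3 h4 hq
      rw [coInner_comb_left (h.metric.symm q) (h1.mem q) (h2.mem q) (hβ.mem q), h3 hq, h4 hq]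
    · rintro α A C hA hC he ⟨-, k, hk, hαk⟩
      refine ⟨h.isRadicalAnnihilator_koszul hA hC, k, hk, ?_⟩
      filter_upwards [he, hαk] with q h1 h2 hq
      rw [← h2 hq]
      exact coInner_congr (h.metric.symm q) (fun Z hZ => (h1 Z hZ).symm) fun _ _ => rfl
  obtain ⟨-, k, hk, heq⟩ := key
  exact (hk p).congr_of_eventuallyEq (contraction_eventuallyEq h.metric hk heq)

/-- The reduction to lifts is applied in one slot of the contraction, then by symmetry in the other.
What remains is a contraction of split forms. -/
theorem IsWarpedData.isRadicalStationary (h : IsWarpedData gB gF f) :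
    IsRadicalStationary (warpedMetric f gB gF) where
  isSingularMetric := h.metric
  isContractible X Y hX hY := by
    have hr := fun {A C : VField (I.prod J) (B × F)} =>
      h.isRadicalAnnihilator_koszul (A := A) (C := C)
    refine ⟨hr hX hY, fun C T hC hT => h.isSmoothFun_contraction_of_lift (hr hX hY) ?_ hC hT⟩
    intro A D hA hD
    rw [contraction_comm h.metric (hr hA.isSmoothField hD.isSmoothField) (hr hX hY)]
    refine h.isSmoothFun_contraction_of_lift (hr hA.isSmoothField hD.isSmoothField) ?_ hX hY
    intro A' D' hA' hD'
    obtain ⟨a, η, e, V, κ, hs⟩ := h.exists_isSplitForm hA hD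
    obtain ⟨a', η', e', V', κ', hs'⟩ := h.exists_isSplitForm hA' hD'
    rw [hs'.contraction_eq h hs]
    exact hs'.isSmoothFun_splitContraction h hs

theorem pairing_eq_zero_of_radical {x : F} (hV : ∀ w, gF x (V x) w = 0) (W : VField J F)
    (hgF : IsSingularMetric gF) : pairing gF W V x = 0 := by
  rw [hgF.pairing_comm]
  exact hV _

theorem IsRadicalAnnihilator.eq_zero_of_radical {κ : FieldFunctional J F}
    (hκ : IsRadicalAnnihilator gF κ) (hgF : IsSingularMetric gF) {x : F}
    (hV : IsSmoothField V) (hV0 : ∀ w, gF x (V x) w = 0) : κ V x = 0 := by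
  obtain ⟨u, hu⟩ := hκ.mem x
  rw [hu V hV, hgF.symm, hV0]

/-- Each vertical component is zero or carries a factor `f`, and is built from `g_F(·, V)` and from
Koszul forms of `F` and their covariant derivatives at `V`. Semi-regularity of `F` makes all of
these vanish on the radical of `g_F`. The disjunction `h0` is what membership of the lift in the
radical of the warped metric provides. -/
theorem IsWarpedData.cov_koszul_liftFiber_eq_zero (h : IsWarpedData gB gF f) (hA : IsLift A)
    (hC : IsLift C) (hD : IsLift D) (hV : IsSmoothField V) {p : B × F}
    (h0 : f p.1 = 0 ∨ ∀ w, gF p.2 (V p.2) w = 0) :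
    cov (warpedMetric f gB gF) D (koszul (warpedMetric f gB gF) A C) (liftFiber V) p = 0 := by
  have hP := isSmoothField_zero (I := I) (M := B)
  have hp := fun (W : VField J F) (h1 : ∀ w, gF p.2 (V p.2) w = 0) =>
    pairing_eq_zero_of_radical h1 W h.fiberMetric
  have hk : ∀ {U W : VField J F}, IsSmoothField U → IsSmoothField W →
      (∀ w, gF p.2 (V p.2) w = 0) → koszul gF U W V p.2 = 0 := fun hU hW h1 =>
    (h.fiber.lowerCov_mem _ _ hU hW).eq_zero_of_radical h.fiberMetric hV h1
  rw [koszul_eq_ssKoszul_liftBase, cov_eq_ssCov_liftBase]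
  cases hD with
  | base Z hZ =>
    cases hA with
    | base X hX =>
      cases hC with
      | base Y hY => exact ssCov_base_base_base_fiber h hP hX hY hZ hV p
      | fiber W hW =>
        rw [ssCov_base_base_fiber_fiber h hP hX hW hZ hV]
        obtain h1 | h1 := h0
        · simp [h1]
        · simp [hp W h1]
    | fiber U hU =>
      cases hC with
      | base X hX =>
        rw [ssCov_base_fiber_base_fiber h hP hX hU hZ hV]
        obtain h1 | h1 := h0
        · simp [h1]
        · simp [hp U h1]
      | fiber W hW =>
        rw [ssCov_base_fiber_fiber_fiber h hP hU hW hZ hV]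
        obtain h1 | h1 := h0
        · simp [h1]
        · simp [hk hU hW h1]
  | fiber Q hQ =>
    cases hA with
    | base X hX =>
      cases hC with
      | base Y hY =>
        rw [ssCov_fiber_base_base_fiber h hP hX hY hQ hV]
        obtain h1 | h1 := h0
        · simp [h1]
        · simp [hp Q h1]
      | fiber W hW =>
        rw [ssCov_fiber_base_fiber_fiber h hP hX hW hQ hV]
        obtain h1 | h1 := h0
        · simp [h1]
        · simp [hk hQ hW h1]
    | fiber U hU =>
      cases hC with
      | base X hX =>
        rw [ssCov_fiber_fiber_base_fiber h hP hX hU hQ hV]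
        obtain h1 | h1 := h0
        · simp [h1]
        · simp [hk hQ hU h1]
      | fiber W hW =>
        rw [ssCov_fiber_fiber_fiber_fiber h hP hU hW hQ hV]
        obtain h1 | h1 := h0
        · simp [h1]
        · simp [hp Q h1, (h.fiber.cov_mem U W Q hU hW hQ).eq_zero_of_radical h.fiberMetric hV h1]

theorem IsWarpedData.exists_isFlatAt_cov_of_lift (h : IsWarpedData gB gF f) (hA : IsLift A)
    (hC : IsLift C) (hD : IsLift D) (p : B × F) :
    ∃ u, IsFlatAt (warpedMetric f gB gF)
      (cov (warpedMetric f gB gF) D (koszul (warpedMetric f gB gF) A C)) p u := by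
  have hone := h.isRadicalStationary.isOneForm_cov
    (h.isRadicalStationary.isContractible A C hA.isSmoothField hC.isSmoothField) hD.isSmoothField
  -- A one-form that kills the radical is a flat; non-degeneracy of the base makes radical vectors
  -- vertical.
  refine hone.exists_isFlatAt (h.metric.symm p) fun Z hZ hrad => ?_
  have h1 : tangentFst p (Z p) = 0 := by
    refine h.nondegenerate p.1 _ fun v => ?_
    have := hrad (tangentMk p v 0)
    rwa [warpedMetric_apply, tangentFst_mk, tangentSnd_mk, map_zero, mul_zero, add_zero] at this
  obtain ⟨V, hV, hVp⟩ := exists_smoothField_apply_eq (I := J) p.2 (tangentSnd p (Z p))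
  have h2 : Z p = liftFiber V p := by
    refine tangent_prod_ext ?_ ?_
    · rw [h1, tangentFst_liftFiber]
    · rw [tangentSnd_liftFiber, hVp]
  rw [hone.eq_of_apply_eq hZ hV.liftFiber h2]
  refine h.cov_koszul_liftFiber_eq_zero hA hC hD hV ?_
  by_cases h0 : f p.1 = 0
  · exact Or.inl h0
  refine Or.inr fun w => ?_
  have := hrad (tangentMk p 0 w)
  rw [warpedMetric_apply, tangentFst_mk, tangentSnd_mk, map_zero, zero_add, ← hVp] at this
  exact (mul_eq_zero.1 this).resolve_left (pow_ne_zero 2 h0)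

theorem IsWarpedData.exists_isFlatAt_cov (h : IsWarpedData gB gF f) (hA : IsSmoothField A)
    (hC : IsSmoothField C) (hD : IsSmoothField D) (p : B × F) :
    ∃ u, IsFlatAt (warpedMetric f gB gF)
      (cov (warpedMetric f gB gF) D (koszul (warpedMetric f gB gF) A C)) p u := by
  have hs := h.isRadicalStationary
  have hK := hs.isContractible A C hA hC
  -- For a lifted `D`, the arguments `A` and `C` are reduced to lifts. Contractibility is carried
  -- along, since the Leibniz rule for `∇_D` requires smooth contractions.
  have lift : ∀ D, IsLift D → ∃ u, IsFlatAt (warpedMetric f gB gF)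
      (cov (warpedMetric f gB gF) D (koszul (warpedMetric f gB gF) A C)) p u := by
    intro D hD
    have hD' := hD.isSmoothField
    refine (koszul_induction h.metric p (Pr := fun α => IsContractible (warpedMetric f gB gF) α ∧
      ∃ u, IsFlatAt (warpedMetric f gB gF) (cov (warpedMetric f gB gF) D α) p u)
      ?_ ?_ ?_ ?_ hA hC).2
    · exact fun A C hA hC => ⟨hs.isContractible A C hA.isSmoothField hC.isSmoothField,
        h.exists_isFlatAt_cov_of_lift hA hC hD p⟩
    · intro C hC
      refine ⟨hs.isContractible_pairing hC, ?_⟩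
      obtain ⟨u, hu⟩ := (hs.isContractible D C hD' hC).mem.mem p
      exact ⟨u, hu.congr fun T hT => (hs.cov_pairing hC hD' hT p).symm⟩
    · rintro α β φ ψ hφ hψ ⟨h1, u, hu⟩ ⟨h2, v, hv⟩
      refine ⟨hs.comb h1 h2 hφ hψ, ?_⟩
      obtain ⟨u', hu'⟩ := h1.mem.mem p
      obtain ⟨v', hv'⟩ := h2.mem.mem p
      have h3 := (hu.comb hu' φ (dirDeriv D φ)).comb (hv.comb hv' ψ (dirDeriv D ψ))
        (fun _ => 1) fun _ => 1
      refine ⟨_, h3.congr fun T hT => ?_⟩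
      rw [hs.cov_comb h1 h2 hφ hψ hD' hT, one_mul, one_mul]
    · rintro α A C hA hC he ⟨-, u, hu⟩
      have hAC := hs.isContractible A C hA hC
      exact ⟨hAC, u, hu.congr fun T hT => hs.cov_congr hAC he hD' hT⟩
  -- Then `D` itself is generalized, which is possible because `∇_D` is `C^∞`-linear and local in
  -- `D`.
  refine lift_induction p (Pr := fun D => ∃ u, IsFlatAt (warpedMetric f gB gF)
      (cov (warpedMetric f gB gF) D (koszul (warpedMetric f gB gF) A C)) p u)
    (fun X hX => lift _ (.base X hX)) (fun V hV => lift _ (.fiber V hV)) ?_ ?_ ?_ hD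
  · rintro Z Z' hZ hZ' ⟨u, hu⟩ ⟨v, hv⟩
    refine ⟨_, (hu.comb hv (fun _ => 1) fun _ => 1).congr fun T hT => ?_⟩
    simp only [cov, lowerCov]
    rw [hs.contraction_koszul_add_left hK hZ hZ' hT, dirDeriv_add_field]
    ring
  · rintro φ Z hφ hZ ⟨u, hu⟩
    refine ⟨_, (hu.comb hu φ fun _ => 0).congr fun T hT => ?_⟩
    simp only [cov, lowerCov]
    rw [hs.contraction_koszul_smul_left hK hφ hZ hT, dirDeriv_smul_field]
    ring
  · rintro Z Z' hZ hZ' he ⟨u, hu⟩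
    refine ⟨u, hu.congr fun T hT => ?_⟩
    simp only [cov, lowerCov]
    rw [dirDeriv_congr .rfl he.self_of_nhds, contraction_congr h.metric ?_
      (.of_forall fun _ _ _ => rfl) (hs.isContractible Z' T hZ' hT).mem hK.mem
      (hK.smooth Z' T hZ' hT)]
    filter_upwards [eventually_eventually_nhds.2 he] with q hq S _
    exact koszul_congr hq .rfl .rfl

theorem IsWarpedData.isSemiRegular (h : IsWarpedData gB gF f) :
    IsSemiRegular (warpedMetric f gB gF) where
  isSingularMetric := h.metric
  lowerCov_mem _ _ hX hY := h.isRadicalAnnihilator_koszul hX hY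
  cov_mem X Y _ hX hY hZ :=
    ⟨h.isRadicalStationary.isOneForm_cov (h.isRadicalStationary.isContractible X Y hX hY) hZ,
      h.exists_isFlatAt_cov hX hY hZ⟩

end WarpedSemiRegular

end SingularGeometry

end

/-! ### The theorem -/

open SingularGeometry in
theorem theorem2p17
    {E₁ : Type*} [NormedAddCommGroup E₁] [NormedSpace ℝ E₁] [FiniteDimensional ℝ E₁]
    {B : Type*} [TopologicalSpace B] [T2Space B] [SecondCountableTopology B]
    [ChartedSpace E₁ B] [IsManifold 𝓘(ℝ, E₁) ∞ B]
    {E₂ : Type*} [NormedAddCommGroup E₂] [NormedSpace ℝ E₂] [FiniteDimensional ℝ E₂]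
    {F : Type*} [TopologicalSpace F] [T2Space F] [SecondCountableTopology F]
    [ChartedSpace E₂ F] [IsManifold 𝓘(ℝ, E₂) ∞ F]
    (gB : BilinField 𝓘(ℝ, E₁) B) (hgB : IsSingularMetric gB) (hB : IsNondegenerate gB)
    (gF : BilinField 𝓘(ℝ, E₂) F) (hF : IsSemiRegular gF)
    (f : B → ℝ) (hf : IsSmoothFun 𝓘(ℝ, E₁) f)
    (P : VField 𝓘(ℝ, E₁) B) (hP : IsSmoothField P) :
    IsSemiRegular (warpedMetric f gB gF) ∧
    ∀ X Y Z T : VField 𝓘(ℝ, E₁) B,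
      IsSmoothField X → IsSmoothField Y → IsSmoothField Z → IsSmoothField T →
    ∀ U V W Q : VField 𝓘(ℝ, E₂) F,
      IsSmoothField U → IsSmoothField V → IsSmoothField W → IsSmoothField Q →
    ∀ (b : B) (x : F),
      ssCurvature (warpedMetric f gB gF) (liftBase P)
          (liftBase X) (liftBase Y) (liftBase Z) (liftBase T) (b, x)
        = ssCurvature gB P X Y Z T b ∧
      ssCurvature (warpedMetric f gB gF) (liftBase P)
          (liftBase X) (liftBase Y) (liftBase Z) (liftFiber Q) (b, x) = 0 ∧
      ssCurvature (warpedMetric f gB gF) (liftBase P)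
          (liftBase Z) (liftFiber Q) (liftBase X) (liftBase Y) (b, x) = 0 ∧
      ssCurvature (warpedMetric f gB gF) (liftBase P)
          (liftBase X) (liftBase Y) (liftFiber W) (liftFiber Q) (b, x) = 0 ∧
      ssCurvature (warpedMetric f gB gF) (liftBase P)
          (liftFiber W) (liftFiber Q) (liftBase X) (liftBase Y) (b, x) = 0 ∧
      ssCurvature (warpedMetric f gB gF) (liftBase P)
          (liftBase X) (liftFiber V) (liftFiber W) (liftBase T) (b, x)
        = - f b * hessian gB f X T b * pairing gF V W x
          + f b ^ 2 * pairing gB X P b * pairing gF V W x * pairing gB P T b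
          - f b * dirDeriv P f b * pairing gF V W x * pairing gB X T b
          - f b ^ 2 * pairing gB P P b * pairing gF V W x * pairing gB X T b
          - f b ^ 2 * pairing gF V W x * koszul gB X P T b ∧
      ssCurvature (warpedMetric f gB gF) (liftBase P)
          (liftFiber U) (liftFiber V) (liftBase Z) (liftFiber Q) (b, x) = 0 ∧
      ssCurvature (warpedMetric f gB gF) (liftBase P)
          (liftBase Z) (liftFiber Q) (liftFiber U) (liftFiber V) (b, x) = 0 ∧
      ssCurvature (warpedMetric f gB gF) (liftBase P)
          (liftFiber U) (liftFiber V) (liftFiber W) (liftFiber Q) (b, x)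
        = f b ^ 2 * curvature gF U V W Q x
          + (f b ^ 2 * coInner gB (differential f) (differential f) b
              + 2 * f b ^ 3 * dirDeriv P f b + f b ^ 4 * pairing gB P P b)
            * (pairing gF U W x * pairing gF V Q x - pairing gF V W x * pairing gF U Q x) := by
  have h : IsWarpedData gB gF f := ⟨hgB, hB, hF, hf⟩
  refine ⟨h.isSemiRegular, fun X Y Z T hX hY hZ hT U V W Q hU hV hW hQ b x => ⟨?_, ?_, ?_, ?_, ?_,
    ?_, ?_, ?_, ?_⟩⟩
  · exact ssCurvature_base_base_base_base h hP hX hY hZ hT (b, x)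
  · exact ssCurvature_base_base_base_fiber h hP hX hY hZ hQ (b, x)
  · exact ssCurvature_base_fiber_base_base h hP hX hY hZ hQ (b, x)
  · exact ssCurvature_base_base_fiber_fiber h hP hX hY hW hQ (b, x)
  · exact ssCurvature_fiber_fiber_base_base h hP hX hY hW hQ (b, x)
  · exact ssCurvature_base_fiber_fiber_base h hP hX hT hV hW (b, x)
  · exact ssCurvature_fiber_fiber_base_fiber h hP hZ hU hV hQ (b, x)
  · exact ssCurvature_base_fiber_fiber_fiber h hP hZ hU hV hQ (b, x)
  · exact ssCurvature_fiber_fiber_fiber_fiber h hP hU hV hW hQ (b, x)
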